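/- **Setting.** Let $a>1$ and, for $d\ge 1$, let $Q=\mathrm{diag}(\lambda_1,\dots,\lambda_d)$ with $\lambda_i=i^{-a}/\sum_{j=1}^d j^{-a}$, and write $\langle x,y\rangle_Q=x^\top Qy$. Let $w^\star=g/\|Q^{1/2}g\|$ with $g\sim\mathcal N(0,I_d)$, and, independently, let $w_0$ be uniform on the unit sphere of $\mathbb R^d$. Let $w(t)$, $t\ge0$, solve the gradient flow $\dot w=-\nabla\mathcal L(w)$, $w(0)=w_0$, of the population loss $\mathcal L(w)=\mathbb E_{x\sim\mathcal N(0,Q)}\bigl[\bigl((x^\top w)^2-(x^\top w^\star)^2\bigr)^2\bigr]$. Put $$u(t)=\langle w(t),w^\star\rangle_Q,\quad s(t)=\langle w(t),w(t)\rangle_Q,\quad \sigma_\star^2=\tfrac1d\sum_{i}(w_i^\star)^2,\quad \mathrm{MSE}(t)=\tfrac1d\sum_i (w_i(t)-w_i^\star)^2 .$$ **Initialization assumption.** Let $a_0(t)=\sum_i w_i(0)w_i^\star\lambda_i e^{4\lambda_i t}$ and $\mathcal K(t)=\sum_i (w_i^\star)^2\lambda_i^2e^{4\lambda_i t}$, let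 $\hat{\ }$ denote the Laplace transform, and let $\rho>4\lambda_1$ be the unique solution of $8\widehat{\mathcal K}(\rho)=1$. For constants $c,C>0$ let $A_d(c,C)$ be the event $$c\,d^{-1/2}\le|u(0)|\le C d^{-1/2},\qquad c\,d^{-1/2}\le|\hat a_0(\rho)|\le C d^{-1/2},\qquad c\le|w_1^\star|\le C .$$ **Proposition.** For all $a>1$ and $c,C,c_0>0$ there is a constant $K>0$, depending only on $a,c,C,c_0$, such that the probability that $A_d(c,C)$ holds and the following conclusion fails tends to $0$ as $d\to\infty$. *Conclusion:* for every $\varepsilon\in[c_0d^{-(a-1)/2},1)$ there is a first time $T_2\ge 0$ at which both $|u(T_2)|\in[1-\varepsilon,1]$ and $s(T_2)\in[1-\varepsilon,1]$; it satisfies $T_2\le K\bigl(\log d+\varepsilon^{-2a/(a-1)}\log(1/\varepsilon)\bigr)$, and $$\bigl|\mathrm{MSE}(T_2)-\sigma_\star^2\bigr|\;\le\;K\left[\Bigl(\frac{\varepsilon^{-a}}{d}\Bigr)^{1/3}+\Bigl(\frac{\log d}{d}\Bigr)^{1/3}\right].$$ The same bound holds with $\mathrm{MSE}(T_2)$ replaced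 by the sign-invariant error $\frac1d\min\{\|w(T_2)-w^\star\|^2,\|w(T_2)+w^\star\|^2\}$. -/

import Mathlib

open Filter Topology MeasureTheory ProbabilityTheory Set

namespace PhaseRetrieval

/-- Euclidean `d`-space. Coordinates are numbered from `0`, so `i : Fin d` is the `(i+1)`-st. -/
abbrev Vec (d : ℕ) : Type := EuclideanSpace ℝ (Fin d)

/-- Power-law spectrum of unit trace: `(i+1)^{-a}` normalised by the sum over all coordinates. -/
noncomputable def eig (a : ℝ) {d : ℕ} (i : Fin d) : ℝ :=
  (((i : ℕ) : ℝ) + 1) ^ (-a) / ∑ j : Fin d, (((j : ℕ) : ℝ) + 1) ^ (-a)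

/-- The input distribution `N(0, Q)` with `Q = diag(λ₁, …, λ_d)`. -/
noncomputable def inputLaw (a : ℝ) (d : ℕ) : Measure (Vec d) :=
  multivariateGaussian 0 (Matrix.diagonal (eig a))

/-- Population loss of the student `w` for the teacher `v`. -/
noncomputable def populationLoss (a : ℝ) {d : ℕ} (v w : Vec d) : ℝ :=
  ∫ x, ((inner ℝ x w) ^ 2 - (inner ℝ x v) ^ 2) ^ 2 ∂(inputLaw a d)

/-- `w` solves the gradient flow of the population loss on `[0, ∞)`, started at `w₀`. -/
def IsGradientFlow (a : ℝ) {d : ℕ} (v w₀ : Vec d) (w : ℝ → Vec d) : Prop :=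
  w 0 = w₀ ∧
    ∀ t, 0 ≤ t → HasDerivWithinAt w (-(gradient (populationLoss a v) (w t))) (Ici 0) t

/-- The inner product `⟨x, y⟩_Q = xᵀ Q y`. -/
noncomputable def qInner (a : ℝ) {d : ℕ} (x y : Vec d) : ℝ :=
  ∑ i, eig a i * x i * y i

/-- The teacher `w⋆ = g / ‖Q^{1/2} g‖` built from the vector `g`. -/
noncomputable def teacher (a : ℝ) {d : ℕ} (g : Vec d) : Vec d :=
  (Real.sqrt (qInner a g g))⁻¹ • g

/-- The mean squared error `(1/d) ∑ (wᵢ - vᵢ)²`. -/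
noncomputable def mse {d : ℕ} (w v : Vec d) : ℝ :=
  (1 / (d : ℝ)) * ∑ i, (w i - v i) ^ 2

/-- The mean squared error up to the global sign of the teacher. -/
noncomputable def mseUpToSign {d : ℕ} (w v : Vec d) : ℝ :=
  (1 / (d : ℝ)) * min (‖w - v‖ ^ 2) (‖w + v‖ ^ 2)

/-- `σ⋆² = (1/d) ∑ vᵢ²`. -/
noncomputable def teacherPower {d : ℕ} (v : Vec d) : ℝ :=
  (1 / (d : ℝ)) * ∑ i, (v i) ^ 2

/-- Laplace transform at a real argument. -/
noncomputable def laplace (f : ℝ → ℝ) (p : ℝ) : ℝ :=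
  ∫ t in Ioi (0 : ℝ), Real.exp (-p * t) * f t

/-- Source term of the linear Volterra equation for the correlation near the origin. -/
noncomputable def source (a : ℝ) {d : ℕ} (v w₀ : Vec d) (t : ℝ) : ℝ :=
  ∑ i, w₀ i * v i * eig a i * Real.exp (4 * eig a i * t)

/-- Kernel of the linear Volterra equation for the correlation near the origin. -/
noncomputable def kernel (a : ℝ) {d : ℕ} (v : Vec d) (t : ℝ) : ℝ :=
  ∑ i, (v i) ^ 2 * (eig a i) ^ 2 * Real.exp (4 * eig a i * t)

/-- `ρ` is the exponential growth rate of the correlation: the zero of `1 - 8 K̂` beyond `4 λ₁`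
(it is unique, because `K̂` is strictly decreasing there). -/
def IsGrowthRate (a : ℝ) {d : ℕ} (v : Vec d) (ρ : ℝ) : Prop :=
  (∀ i : Fin d, 4 * eig a i < ρ) ∧ 1 - 8 * laplace (kernel a v) ρ = 0

/-- `|x| ≍ d^{-1/2}` with constants `c` and `C`. -/
def OfOrderInvSqrt (c C : ℝ) (d : ℕ) (x : ℝ) : Prop :=
  c * (d : ℝ) ^ (-(1 / 2 : ℝ)) ≤ |x| ∧ |x| ≤ C * (d : ℝ) ^ (-(1 / 2 : ℝ))

/-- The initialization assumption with constants `c` and `C`: the initial correlation and the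
Laplace transform of the source at the growth rate have order `d^{-1/2}`, and the first
coordinate of the teacher has constant order. -/
def GoodInit (a c C : ℝ) {d : ℕ} (v w₀ : Vec d) : Prop :=
  OfOrderInvSqrt c C d (qInner a w₀ v) ∧
    (∃ ρ, IsGrowthRate a v ρ ∧ OfOrderInvSqrt c C d (laplace (source a v w₀) ρ)) ∧
    ∀ i : Fin d, (i : ℕ) = 0 → c ≤ |v i| ∧ |v i| ≤ C

/-- The set of times at which both `|u|` and `s` lie in `[1 - ε, 1]`, for the trajectory `w` and
the teacher `v`. -/
def accurateTimes (a ε : ℝ) {d : ℕ} (v : Vec d) (w : ℝ → Vec d) : Set ℝ :=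
  {t | 0 ≤ t ∧ |qInner a (w t) v| ∈ Icc (1 - ε) 1 ∧ qInner a (w t) (w t) ∈ Icc (1 - ε) 1}

/-- The uniform probability measure on the unit sphere (normalised surface measure). -/
noncomputable def uniformSphere (d : ℕ) : Measure (Metric.sphere (0 : Vec d) 1) :=
  ((volume : Measure (Vec d)).toSphere univ)⁻¹ • (volume : Measure (Vec d)).toSphere

/-- Joint law of the Gaussian vector that generates the teacher and of the initial weights:
they are independent, standard Gaussian and uniform on the unit sphere respectively. -/
noncomputable def setupLaw (d : ℕ) : Measure (Vec d × Metric.sphere (0 : Vec d) 1) :=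
  (stdGaussian (Vec d)).prod (uniformSphere d)

/-- The plateau rate `(ε^{-a}/d)^{1/3} + (log d / d)^{1/3}`. -/
noncomputable def plateauRate (a ε : ℝ) (d : ℕ) : ℝ :=
  (ε ^ (-a) / (d : ℝ)) ^ (1 / 3 : ℝ) + (Real.log d / (d : ℝ)) ^ (1 / 3 : ℝ)

/-- The plateau estimate with constant `K` for one teacher `v` and one initial point `w₀`, at every
accuracy `ε ∈ [c₀ d^{-(a-1)/2}, 1)`. -/
def PlateauHolds (a c₀ K : ℝ) {d : ℕ} (v w₀ : Vec d) : Prop :=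
  ∀ ε : ℝ, c₀ * (d : ℝ) ^ (-((a - 1) / 2)) ≤ ε → ε < 1 →
    ∀ w : ℝ → Vec d, IsGradientFlow a v w₀ w →
      ∃ T₂ : ℝ, IsLeast (accurateTimes a ε v w) T₂ ∧
        T₂ ≤ K * (Real.log d + ε ^ (-(2 * a / (a - 1))) * Real.log (1 / ε)) ∧
        |mse (w T₂) v - teacherPower v| ≤ K * plateauRate a ε d ∧
        |mseUpToSign (w T₂) v - teacherPower v| ≤ K * plateauRate a ε d

end PhaseRetrieval

/-!
By Wick's formula the population loss is a function of `u = ⟨w, v⟩_Q` and `s = ⟨w, w⟩_Q` only,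
namely `3 s² - 2 s - 4 u² + 3` for a teacher `v` with `⟨v, v⟩_Q = 1` (`populationLoss_eq`), and
the gradient flow reads `wᵢ' = λᵢ ((4 - 12 s) wᵢ + 8 u vᵢ)` (`IsGradientFlow.isFlow`). The plateau
estimate rests on two facts. First, accuracy `ε` is reached once about `k = ε ^ (-1 / (a - 1))`
coordinates have been learned, which is at most of order `√d`. Secondly, by then `‖w‖²` and
`⟨w, v⟩` are of the order of `k` up to a power of `d` lost at the start, so that
`‖w - v‖² - ‖v‖² = ‖w‖² - 2 ⟨w, v⟩` is small compared with `d ^ (2 / 3)`.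

*Escape from the origin.* The linearisation at the origin has a single eigenvalue `ρ` above
`4 λ₁`, the zero of `1 - 8 K̂`, and the Laplace transform of the source at `ρ` is the coordinate of
`w₀` along its eigenvector (`IsGrowthRate.laplace_source`). The gap `ρ - 4 λ₁` is bounded below
through the first coordinate of the teacher. During a time `log d / 96` the quantity `s` is so
small that the flow is nearly linear, and the unstable component wins over its orthogonal
complement by a power of `d` (`IsFlow.exists_isEscape`). From then on the student is a positive
multiple of the eigenvector, whose coordinates have the signs of the teacher, plus a negligible
remainder; these signs persist, the correlation grows, and `s` reaches `1 / 3` with `u` of constant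
order (`IsEscape.exists_qnorm_eq`). As `3 s² - 2 s` is minimal at `s = 1 / 3` and the loss
decreases, `u` is bounded below from then on (`IsFlow.corr_ge_of_qnorm_eq`).

*Descent.* As long as the loss exceeds `1 / 12`, the velocity has a component of definite size
towards a suitable multiple of a truncated teacher, whose norm is bounded. As the norm of the
student grows at most like the square root of time, the loss `L` satisfies `L' ≤ - const / (1 +
t)`, and it falls below `1 / 12` after a time independent of `d` (`IsFlow.lossUS_le_of_corr_ge`,
`exists_isLate`).

*Late phase.* There the squared distance to the teacher truncated to `k` coordinates decreases at
least at the rate of the loss, up to the `Q`-mass of the tail, of order `k ^ (1 - a)`. Hence the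
loss at time `k ^ a` is of order `k ^ (1 - a)`, and `‖w‖²` and `⟨w, v⟩` are of order `k`
(`IsLate.loss_le_rpow`, `IsLate.norm_sq_le_mul`, `IsLate.abs_wdot_one_le`). The correlation is
accurate when `s` is, so it remains to see that `s` enters `[1 - ε, 1]` by a time of order `k ^ a`.
Otherwise `s` would stay below `1 - ε` or above `1`. In the first case `⟨w, v⟩` restricted to the
first `k` coordinates would grow too fast (`IsLate.not_forall_qnorm_lt`); in the second it would
not grow on a longer range of coordinates, although `w` gets close to the teacher on these
(`IsLate.not_forall_lt_qnorm`).

*Uniformity.* What is used of the teacher is that its partial sums of squares have linear order, and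
of the initial point that `s ≤ M / d` (`IsRegular`, `IsInitial`). This holds with a probability as
close to `1` as desired for `M` large, by Chebyshev's inequality at dyadic scales and Markov's
inequality on the sphere (`exists_measure_not_regular_le`). The constant of the plateau estimate
must not depend on `M`: the time to reach the basin has a factor of `log d` independent of `M`, and
all other constants are absorbed, for `d` large, by the slack between `ε ^ (-a / (a - 1))` and
`log d + ε ^ (-2 a / (a - 1)) log (1 / ε)` (`eventually_mul_rpow_le`) and by the slack in the power
of `d` for the mean squared error (`exists_accurate_time`).
-/

namespace PhaseRetrieval

/-! ### Differential inequalities -/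

lemma le_of_hasDerivAt_nonneg {f f' : ℝ → ℝ} {a b : ℝ} (hab : a ≤ b) (hf : Continuous f)
    (hd : ∀ t ∈ Ioo a b, HasDerivAt f (f' t) t) (h : ∀ t ∈ Ioo a b, 0 ≤ f' t) : f a ≤ f b := by
  have : MonotoneOn f (Icc a b) := by
    refine monotoneOn_of_deriv_nonneg (convex_Icc a b) hf.continuousOn ?_ ?_
    · intro t ht
      rw [interior_Icc] at ht
      exact (hd t ht).differentiableAt.differentiableWithinAt
    · intro t ht
      rw [interior_Icc] at ht
      rw [(hd t ht).deriv]
      exact h t ht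
  exact this (left_mem_Icc.2 hab) (right_mem_Icc.2 hab) hab

/-- A solution of the linear differential inequality `f' ≥ g f` that starts nonnegative stays
nonnegative. -/
lemma nonneg_of_hasDerivAt_ge {f f' g : ℝ → ℝ} {a b : ℝ} (hab : a ≤ b) (hf : Continuous f)
    (hg : Continuous g) (hd : ∀ t ∈ Ioo a b, HasDerivAt f (f' t) t)
    (h : ∀ t ∈ Ioo a b, g t * f t ≤ f' t) (ha : 0 ≤ f a) : 0 ≤ f b := by
  set G : ℝ → ℝ := fun t => ∫ τ in a..t, g τ with hG
  have hGd : ∀ t, HasDerivAt G (g t) t := fun t =>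
    intervalIntegral.integral_hasDerivAt_right (hg.intervalIntegrable _ _)
      (hg.stronglyMeasurableAtFilter _ _) hg.continuousAt
  have hGc : Continuous G := continuous_iff_continuousAt.2 fun t => (hGd t).continuousAt
  have key : f a * Real.exp (-G a) ≤ f b * Real.exp (-G b) := by
    refine le_of_hasDerivAt_nonneg (f := fun t => f t * Real.exp (-G t))
      (f' := fun t => f' t * Real.exp (-G t) + f t * (Real.exp (-G t) * (-g t))) hab
      (by fun_prop) ?_ ?_
    · intro t ht
      exact (hd t ht).mul ((hGd t).neg.exp)
    · intro t ht
      have := h t ht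
      have he := Real.exp_pos (-G t)
      nlinarith [mul_nonneg he.le (sub_nonneg.2 this)]
  have h1 : 0 ≤ f b * Real.exp (-G b) := le_trans (mul_nonneg ha (Real.exp_pos _).le) key
  exact nonneg_of_mul_nonneg_left h1 (Real.exp_pos _)

lemma exp_mul_le_of_hasDerivAt_ge {f f' : ℝ → ℝ} {κ a b : ℝ} (hab : a ≤ b) (hf : Continuous f)
    (hd : ∀ t ∈ Ioo a b, HasDerivAt f (f' t) t)
    (h : ∀ t ∈ Ioo a b, κ * f t ≤ f' t) : f a * Real.exp (κ * (b - a)) ≤ f b := by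
  have := nonneg_of_hasDerivAt_ge (f := fun t => f t - f a * Real.exp (κ * (t - a)))
    (f' := fun t => f' t - f a * (Real.exp (κ * (t - a)) * κ)) (g := fun _ => κ) hab
    (by fun_prop) continuous_const ?_ ?_ (by simp)
  · simpa using this
  · intro t ht
    have h1 : HasDerivAt (fun t => κ * (t - a)) κ t := by
      simpa using ((hasDerivAt_id t).sub_const a).const_mul κ
    exact (hd t ht).sub (h1.exp.const_mul _)
  · intro t ht
    have := h t ht
    nlinarith

/-- The first-exit principle: a continuous function that starts positive stays positive on
`[a, b]` as soon as nonnegativity up to a time forces strict positivity at that time. -/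
lemma pos_of_nonneg_imp_pos {f : ℝ → ℝ} {a b : ℝ} (hf : Continuous f) (ha : 0 < f a)
    (h : ∀ t ∈ Icc a b, (∀ τ ∈ Icc a t, 0 ≤ f τ) → 0 < f t) : ∀ t ∈ Icc a b, 0 < f t := by
  by_contra! hcon
  obtain ⟨t₁, ht₁, hft₁⟩ := hcon
  have hS : IsCompact (Icc a b ∩ {t | f t ≤ 0}) :=
    isCompact_Icc.inter_right (isClosed_le hf continuous_const)
  obtain ⟨t, ⟨ht, hft⟩, hmin⟩ := hS.exists_isLeast ⟨t₁, ht₁, hft₁⟩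
  have hpos : ∀ τ ∈ Ico a t, 0 < f τ := by
    intro τ hτ
    by_contra! hc
    exact absurd (hmin ⟨⟨hτ.1, hτ.2.le.trans ht.2⟩, hc⟩) (not_le.2 hτ.2)
  have hft0 : f t = 0 := by
    obtain ⟨τ, hτ, hfτ⟩ := intermediate_value_Icc' ht.1 hf.continuousOn ⟨hft, ha.le⟩
    rcases eq_or_lt_of_le hτ.2 with h1 | h1
    · rwa [h1] at hfτ
    · exact absurd hfτ (hpos τ ⟨hτ.1, h1⟩).ne'
  have := h t ht fun τ hτ => by
    rcases eq_or_lt_of_le hτ.2 with h1 | h1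
    · rw [h1, hft0]
    · exact (hpos τ ⟨hτ.1, h1⟩).le
  exact absurd this (by rw [hft0]; exact lt_irrefl 0)

/-- First hitting time of the level `c`. -/
lemma exists_first_hit {f : ℝ → ℝ} {a b c : ℝ} (hab : a ≤ b) (hf : Continuous f) (ha : f a ≤ c)
    (hb : c ≤ f b) : ∃ t ∈ Icc a b, f t = c ∧ ∀ τ ∈ Icc a t, f τ ≤ c := by
  have hS : IsCompact (Icc a b ∩ {t | f t = c}) :=
    isCompact_Icc.inter_right (isClosed_eq hf continuous_const)
  obtain ⟨t₀, ht₀, hft₀⟩ := intermediate_value_Icc hab hf.continuousOn ⟨ha, hb⟩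
  obtain ⟨t, ⟨ht, hft⟩, hmin⟩ := hS.exists_isLeast ⟨t₀, ht₀, hft₀⟩
  refine ⟨t, ht, hft, fun τ hτ => ?_⟩
  by_contra! hc
  obtain ⟨r, hr, hfr⟩ := intermediate_value_Icc hτ.1 hf.continuousOn ⟨ha, hc.le⟩
  have h1 : t ≤ r := hmin ⟨⟨hr.1, hr.2.trans (hτ.2.trans ht.2)⟩, hfr⟩
  have h2 : τ = t := le_antisymm hτ.2 (h1.trans hr.2)
  rw [h2] at hc
  exact absurd hft hc.ne'

/-! ### The gradient flow in coordinates -/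

/-- The bilinear form `∑ ψᵢ xᵢ yᵢ` with weights `ψ`. -/
noncomputable def wdot {d : ℕ} (ψ x y : Fin d → ℝ) : ℝ := ∑ i, ψ i * x i * y i

section wdot
variable {d : ℕ} {ψ : Fin d → ℝ}

lemma wdot_comm (ψ x y : Fin d → ℝ) : wdot ψ x y = wdot ψ y x :=
  Finset.sum_congr rfl fun _ _ => by ring

lemma wdot_self_nonneg (hψ : ∀ i, 0 ≤ ψ i) (x : Fin d → ℝ) : 0 ≤ wdot ψ x x :=
  Finset.sum_nonneg fun i _ => by
    rw [mul_assoc]; exact mul_nonneg (hψ i) (mul_self_nonneg _)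

lemma wdot_sq_le (hψ : ∀ i, 0 ≤ ψ i) (x y : Fin d → ℝ) :
    wdot ψ x y ^ 2 ≤ wdot ψ x x * wdot ψ y y := by
  refine Finset.sum_sq_le_sum_mul_sum_of_sq_le_mul _ (fun i _ => ?_) (fun i _ => ?_)
    fun i _ => le_of_eq ?_
  · rw [mul_assoc]; exact mul_nonneg (hψ i) (mul_self_nonneg _)
  · rw [mul_assoc]; exact mul_nonneg (hψ i) (mul_self_nonneg _)
  · ring

lemma abs_wdot_le (hψ : ∀ i, 0 ≤ ψ i) {x y : Fin d → ℝ} {X Y : ℝ} (hX : 0 ≤ X) (hY : 0 ≤ Y)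
    (hx : wdot ψ x x ≤ X ^ 2) (hy : wdot ψ y y ≤ Y ^ 2) : |wdot ψ x y| ≤ X * Y := by
  refine abs_le_of_sq_le_sq ?_ (mul_nonneg hX hY)
  calc wdot ψ x y ^ 2 ≤ wdot ψ x x * wdot ψ y y := wdot_sq_le hψ x y
    _ ≤ X ^ 2 * Y ^ 2 := mul_le_mul hx hy (wdot_self_nonneg hψ y) (sq_nonneg _)
    _ = (X * Y) ^ 2 := by ring

lemma wdot_self_mono {φ : Fin d → ℝ} (h : ∀ i, ψ i ≤ φ i) (x : Fin d → ℝ) :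
    wdot ψ x x ≤ wdot φ x x :=
  Finset.sum_le_sum fun i _ => by
    rw [mul_assoc, mul_assoc]; exact mul_le_mul_of_nonneg_right (h i) (mul_self_nonneg _)

lemma wdot_add_left (ψ x y z : Fin d → ℝ) : wdot ψ (x + y) z = wdot ψ x z + wdot ψ y z := by
  simp only [wdot, ← Finset.sum_add_distrib, Pi.add_apply]
  exact Finset.sum_congr rfl fun _ _ => by ring

lemma wdot_sub_left (ψ x y z : Fin d → ℝ) : wdot ψ (x - y) z = wdot ψ x z - wdot ψ y z := by
  simp only [wdot, ← Finset.sum_sub_distrib, Pi.sub_apply]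
  exact Finset.sum_congr rfl fun _ _ => by ring

lemma wdot_smul_left (ψ x z : Fin d → ℝ) (c : ℝ) : wdot ψ (c • x) z = c * wdot ψ x z := by
  simp only [wdot, Finset.mul_sum, Pi.smul_apply, smul_eq_mul]
  exact Finset.sum_congr rfl fun _ _ => by ring

lemma wdot_add_right (ψ x y z : Fin d → ℝ) : wdot ψ z (x + y) = wdot ψ z x + wdot ψ z y := by
  rw [wdot_comm, wdot_add_left, wdot_comm ψ x, wdot_comm ψ y]

lemma wdot_sub_right (ψ x y z : Fin d → ℝ) : wdot ψ z (x - y) = wdot ψ z x - wdot ψ z y := by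
  rw [wdot_comm, wdot_sub_left, wdot_comm ψ x, wdot_comm ψ y]

lemma wdot_smul_right (ψ x z : Fin d → ℝ) (c : ℝ) : wdot ψ z (c • x) = c * wdot ψ z x := by
  rw [wdot_comm, wdot_smul_left, wdot_comm]

lemma wdot_add_weight (ψ φ x z : Fin d → ℝ) : wdot (ψ + φ) x z = wdot ψ x z + wdot φ x z := by
  simp only [wdot, ← Finset.sum_add_distrib, Pi.add_apply]
  exact Finset.sum_congr rfl fun _ _ => by ring

lemma wdot_add_self_le (hψ : ∀ i, 0 ≤ ψ i) (x y : Fin d → ℝ) :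
    wdot ψ (x + y) (x + y) ≤ 2 * wdot ψ x x + 2 * wdot ψ y y := by
  have := wdot_self_nonneg hψ (x - y)
  simp only [wdot_add_left, wdot_sub_left, wdot_add_right, wdot_sub_right] at *
  linarith

end wdot

/-- Spectrum `lam` and teacher `v` with `0 < lam ≤ 1` and `⟨v, v⟩_Q = 1`. -/
structure IsNormalized {d : ℕ} (lam v : Fin d → ℝ) : Prop where
  pos : ∀ i, 0 < lam i
  le_one : ∀ i, lam i ≤ 1
  norm : wdot lam v v = 1

/-- The correlation `u` of a student `x` with the teacher. -/
noncomputable def corr {d : ℕ} (lam v x : Fin d → ℝ) : ℝ := wdot lam x v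

/-- The squared `Q`-norm `s` of a student `x`. -/
noncomputable def qnorm {d : ℕ} (lam x : Fin d → ℝ) : ℝ := wdot lam x x

/-- The population loss as a function of `u` and `s`. -/
noncomputable def lossUS {d : ℕ} (lam v x : Fin d → ℝ) : ℝ :=
  3 * qnorm lam x ^ 2 - 2 * qnorm lam x - 4 * corr lam v x ^ 2 + 3

/-- The squared `Q`-distance of a student `x` to the teacher, `s - 2u + 1`. -/
noncomputable def qdist {d : ℕ} (lam v x : Fin d → ℝ) : ℝ :=
  qnorm lam x - 2 * corr lam v x + 1

/-- The gradient flow in coordinates, for times `t > 0`; the trajectory is continuous on the whole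
line, so that one-sided derivatives at the initial time never have to be considered. -/
structure IsFlow {d : ℕ} (lam v : Fin d → ℝ) (w : ℝ → Fin d → ℝ) : Prop where
  cont : Continuous w
  deriv : ∀ t, 0 < t → ∀ i, HasDerivAt (fun t => w t i)
    (lam i * ((4 - 12 * qnorm lam (w t)) * w t i + 8 * corr lam v (w t) * v i)) t

lemma IsFlow.shift {d : ℕ} {lam v : Fin d → ℝ} {w : ℝ → Fin d → ℝ} (h : IsFlow lam v w) {t₀ : ℝ}
    (ht₀ : 0 ≤ t₀) : IsFlow lam v (fun t => w (t₀ + t)) := by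
  refine ⟨h.cont.comp (by fun_prop), fun t ht i => ?_⟩
  exact (h.deriv (t₀ + t) (by linarith) i).comp_const_add t₀ t

@[fun_prop]
lemma continuous_wdot {d : ℕ} (ψ : Fin d → ℝ) {x y : ℝ → Fin d → ℝ} (hx : Continuous x)
    (hy : Continuous y) : Continuous fun t => wdot ψ (x t) (y t) := by
  unfold wdot
  fun_prop

section flow
variable {d : ℕ} {lam v : Fin d → ℝ} {w : ℝ → Fin d → ℝ}

lemma IsFlow.hasDerivAt_wdot (h : IsFlow lam v w) {t : ℝ} (ht : 0 < t) (ψ z : Fin d → ℝ) :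
    HasDerivAt (fun t => wdot ψ (w t) z)
      ((4 - 12 * qnorm lam (w t)) * wdot (ψ * lam) (w t) z
        + 8 * corr lam v (w t) * wdot (ψ * lam) v z) t := by
  have h1 : HasDerivAt (fun t => ∑ i, ψ i * w t i * z i) (∑ i, ψ i *
      (lam i * ((4 - 12 * qnorm lam (w t)) * w t i + 8 * corr lam v (w t) * v i)) * z i) t :=
    HasDerivAt.fun_sum fun i _ => ((h.deriv t ht i).const_mul (ψ i)).mul_const (z i)
  refine h1.congr_deriv ?_
  simp only [wdot, Finset.mul_sum, ← Finset.sum_add_distrib, Pi.mul_apply]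
  exact Finset.sum_congr rfl fun _ _ => by ring

lemma IsFlow.hasDerivAt_wdot_self (h : IsFlow lam v w) {t : ℝ} (ht : 0 < t) (ψ : Fin d → ℝ) :
    HasDerivAt (fun t => wdot ψ (w t) (w t))
      (2 * ((4 - 12 * qnorm lam (w t)) * wdot (ψ * lam) (w t) (w t)
        + 8 * corr lam v (w t) * wdot (ψ * lam) (w t) v)) t := by
  have h1 : HasDerivAt (fun t => ∑ i, ψ i * w t i * w t i) (∑ i, (ψ i *
      (lam i * ((4 - 12 * qnorm lam (w t)) * w t i + 8 * corr lam v (w t) * v i)) * w t i +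
      ψ i * w t i *
      (lam i * ((4 - 12 * qnorm lam (w t)) * w t i + 8 * corr lam v (w t) * v i)))) t :=
    HasDerivAt.fun_sum fun i _ =>
      ((h.deriv t ht i).const_mul (ψ i)).mul (h.deriv t ht i)
  refine h1.congr_deriv ?_
  simp only [wdot, Finset.mul_sum, ← Finset.sum_add_distrib, Pi.mul_apply]
  exact Finset.sum_congr rfl fun _ _ => by ring

lemma IsFlow.hasDerivAt_norm_sq (h : IsFlow lam v w) {t : ℝ} (ht : 0 < t) :
    HasDerivAt (fun t => wdot 1 (w t) (w t))
      (8 * qnorm lam (w t) - 24 * qnorm lam (w t) ^ 2 + 16 * corr lam v (w t) ^ 2) t := by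
  refine (h.hasDerivAt_wdot_self ht 1).congr_deriv ?_
  simp only [one_mul, qnorm, corr]
  ring

lemma IsFlow.hasDerivAt_corr (h : IsFlow lam v w) {t : ℝ} (ht : 0 < t) :
    HasDerivAt (fun t => corr lam v (w t))
      ((4 - 12 * qnorm lam (w t)) * wdot (lam * lam) (w t) v
        + 8 * corr lam v (w t) * wdot (lam * lam) v v) t := h.hasDerivAt_wdot ht lam v

lemma IsFlow.hasDerivAt_qnorm (h : IsFlow lam v w) {t : ℝ} (ht : 0 < t) :
    HasDerivAt (fun t => qnorm lam (w t))
      (2 * ((4 - 12 * qnorm lam (w t)) * wdot (lam * lam) (w t) (w t)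
        + 8 * corr lam v (w t) * wdot (lam * lam) (w t) v)) t := h.hasDerivAt_wdot_self ht lam

/-- The velocity of the flow. -/
noncomputable def velocity (lam v x : Fin d → ℝ) : Fin d → ℝ :=
  fun i => lam i * ((4 - 12 * qnorm lam x) * x i + 8 * corr lam v x * v i)

/-- The loss decreases along the flow at the rate of the squared velocity. -/
lemma IsFlow.hasDerivAt_lossUS (h : IsFlow lam v w) {t : ℝ} (ht : 0 < t) :
    HasDerivAt (fun t => lossUS lam v (w t))
      (-wdot 1 (velocity lam v (w t)) (velocity lam v (w t))) t := by
  have hs := h.hasDerivAt_qnorm ht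
  have hu := h.hasDerivAt_corr ht
  have h1 := ((((hs.pow 2).const_mul 3).sub (hs.const_mul 2)).sub
    ((hu.pow 2).const_mul 4)).add_const 3
  refine h1.congr_deriv ?_
  have h2 : wdot 1 (velocity lam v (w t)) (velocity lam v (w t)) =
      (4 - 12 * qnorm lam (w t)) ^ 2 * wdot (lam * lam) (w t) (w t)
      + 16 * (4 - 12 * qnorm lam (w t)) * corr lam v (w t) * wdot (lam * lam) (w t) v
      + 64 * corr lam v (w t) ^ 2 * wdot (lam * lam) v v := by
    unfold velocity
    generalize qnorm lam (w t) = s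
    generalize corr lam v (w t) = u
    simp only [wdot, Finset.mul_sum, ← Finset.sum_add_distrib, Pi.mul_apply, Pi.one_apply]
    exact Finset.sum_congr rfl fun _ _ => by ring
  rw [h2]
  push_cast
  ring

lemma corr_sq_le_qnorm (hn : IsNormalized lam v) (x : Fin d → ℝ) :
    corr lam v x ^ 2 ≤ qnorm lam x := by
  have := wdot_sq_le (fun i => (hn.pos i).le) x v
  rwa [hn.norm, mul_one] at this

lemma qnorm_nonneg (hn : IsNormalized lam v) (x : Fin d → ℝ) : 0 ≤ qnorm lam x :=
  wdot_self_nonneg (fun i => (hn.pos i).le) x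

lemma qdist_eq (hn : IsNormalized lam v) (x : Fin d → ℝ) :
    qdist lam v x = wdot lam (x - v) (x - v) := by
  have := hn.norm
  simp only [wdot_sub_left, wdot_sub_right, qdist, qnorm, corr, wdot_comm lam v x]
  linarith

lemma qdist_nonneg (hn : IsNormalized lam v) (x : Fin d → ℝ) : 0 ≤ qdist lam v x := by
  rw [qdist_eq hn]
  exact wdot_self_nonneg (fun i => (hn.pos i).le) _

/-- The loss splits into a multiple of `(1 - s)²` and a multiple of the `Q`-distance to the
teacher. -/
lemma lossUS_eq (x : Fin d → ℝ) : lossUS lam v x = 2 * (1 - qnorm lam x) ^ 2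
    + qdist lam v x * (1 + qnorm lam x + 2 * corr lam v x) := by
  simp only [lossUS, qdist]; ring

lemma sq_le_lossUS (hn : IsNormalized lam v) (x : Fin d → ℝ) :
    3 * (1 - qnorm lam x) ^ 2 ≤ lossUS lam v x := by
  have := corr_sq_le_qnorm hn x
  simp only [lossUS]; nlinarith

lemma lossUS_nonneg (hn : IsNormalized lam v) (x : Fin d → ℝ) : 0 ≤ lossUS lam v x :=
  le_trans (by positivity) (sq_le_lossUS hn x)

@[fun_prop]
lemma continuous_qnorm {x : ℝ → Fin d → ℝ} (hx : Continuous x) :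
    Continuous fun t => qnorm lam (x t) := continuous_wdot lam hx hx

@[fun_prop]
lemma continuous_corr {x : ℝ → Fin d → ℝ} (hx : Continuous x) :
    Continuous fun t => corr lam v (x t) := continuous_wdot lam hx continuous_const

@[fun_prop]
lemma continuous_lossUS {x : ℝ → Fin d → ℝ} (hx : Continuous x) :
    Continuous fun t => lossUS lam v (x t) := by unfold lossUS; fun_prop

lemma IsFlow.lossUS_antitone (h : IsFlow lam v w) {t₁ t₂ : ℝ} (h1 : 0 ≤ t₁) (h12 : t₁ ≤ t₂) :
    lossUS lam v (w t₂) ≤ lossUS lam v (w t₁) := by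
  have hc := h.cont
  have := le_of_hasDerivAt_nonneg (f := fun t => -lossUS lam v (w t)) (f' := fun t =>
    - -wdot 1 (velocity lam v (w t)) (velocity lam v (w t))) h12 (by fun_prop)
    (fun t ht => (h.hasDerivAt_lossUS (h1.trans_lt ht.1)).neg)
    (fun t _ => by rw [neg_neg]; exact wdot_self_nonneg (fun _ => zero_le_one) _)
  simpa using this

/-- A student with loss at most `3`, the loss at the origin, has squared `Q`-norm at most `2`. -/
lemma qnorm_le_two (hn : IsNormalized lam v) {x : Fin d → ℝ} (hx : lossUS lam v x ≤ 3) :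
    qnorm lam x ≤ 2 := by
  have := corr_sq_le_qnorm hn x
  have h0 := qnorm_nonneg hn x
  simp only [lossUS] at hx
  nlinarith

/-- The Euclidean squared norm grows at most linearly: its derivative `8 s - 24 s² + 16 u²` is at
most `6`, because `u² ≤ s`. -/
lemma IsFlow.norm_sq_le (h : IsFlow lam v w) (hn : IsNormalized lam v) {t₁ t₂ : ℝ} (h1 : 0 ≤ t₁)
    (h12 : t₁ ≤ t₂) :
    wdot 1 (w t₂) (w t₂) ≤ wdot 1 (w t₁) (w t₁) + 6 * (t₂ - t₁) := by
  have hc := h.cont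
  have := le_of_hasDerivAt_nonneg (f := fun t => 6 * t - wdot 1 (w t) (w t)) (f' := fun t => 6 * 1 -
    (8 * qnorm lam (w t) - 24 * qnorm lam (w t) ^ 2 + 16 * corr lam v (w t) ^ 2)) h12
    (by fun_prop)
    (fun t ht => ((hasDerivAt_id t).const_mul 6).sub (h.hasDerivAt_norm_sq (h1.trans_lt ht.1)))
    (fun t _ => by
      have := corr_sq_le_qnorm hn (w t)
      nlinarith [sq_nonneg (2 * qnorm lam (w t) - 1)])
  linarith

end flow

/-! ### Truncations of the teacher -/

/-- Indicator weight of the first `k` coordinates. -/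
noncomputable def headW {d : ℕ} (k : ℕ) : Fin d → ℝ := fun i => if (i : ℕ) < k then 1 else 0

/-- Indicator weight of the coordinates from position `k` on. -/
noncomputable def tailW {d : ℕ} (k : ℕ) : Fin d → ℝ := fun i => if (i : ℕ) < k then 0 else 1

/-- The part of `⟨v, v⟩_Q` carried by the coordinates from position `k` on. -/
noncomputable def tailMass {d : ℕ} (lam v : Fin d → ℝ) (k : ℕ) : ℝ := wdot (tailW k * lam) v v

/-- Euclidean squared distance of `x` to `α` times the teacher truncated to its first `k`
coordinates. -/
noncomputable def headDist {d : ℕ} (v : Fin d → ℝ) (k : ℕ) (α : ℝ) (x : Fin d → ℝ) : ℝ :=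
  wdot 1 (x - α • (headW k * v)) (x - α • (headW k * v))

/-- Contribution of the coordinates from position `k` on to the derivative of `⟨w, v⟩`. -/
noncomputable def tailDrift {d : ℕ} (lam v : Fin d → ℝ) (k : ℕ) (x : Fin d → ℝ) : ℝ :=
  (4 - 12 * qnorm lam x) * wdot (tailW k * lam) x v + 8 * corr lam v x * tailMass lam v k

section trunc
variable {d : ℕ} {lam v : Fin d → ℝ} {w : ℝ → Fin d → ℝ} {k : ℕ}

lemma headW_nonneg (i : Fin d) : 0 ≤ headW k i := by unfold headW; split_ifs <;> simp

lemma tailW_nonneg (i : Fin d) : 0 ≤ tailW k i := by unfold tailW; split_ifs <;> simp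

lemma headW_le_one (i : Fin d) : headW k i ≤ 1 := by unfold headW; split_ifs <;> simp

lemma tailW_le_one (i : Fin d) : tailW k i ≤ 1 := by unfold tailW; split_ifs <;> simp

lemma headW_add_tailW : (headW k + tailW k : Fin d → ℝ) = 1 := by
  ext i; simp only [Pi.add_apply, headW, tailW, Pi.one_apply]; split_ifs <;> simp

lemma tailW_mul_nonneg (hn : IsNormalized lam v) (i : Fin d) : 0 ≤ (tailW k * lam : Fin d → ℝ) i :=
  mul_nonneg (tailW_nonneg i) (hn.pos i).le

lemma tailW_mul_le (hn : IsNormalized lam v) (i : Fin d) : (tailW k * lam : Fin d → ℝ) i ≤ lam i :=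
  mul_le_of_le_one_left (hn.pos i).le (tailW_le_one i)

lemma tailMass_nonneg (hn : IsNormalized lam v) : 0 ≤ tailMass lam v k :=
  wdot_self_nonneg (tailW_mul_nonneg hn) v

lemma wdot_head_mul (x y : Fin d → ℝ) : wdot (headW k * lam) x y =
    wdot lam x y - wdot (tailW k * lam) x y := by
  have : lam = headW k * lam + tailW k * lam := by rw [← add_mul, headW_add_tailW, one_mul]
  conv_rhs => rw [this]
  rw [wdot_add_weight, ← this]; ring

lemma wdot_velocity (ψ x z : Fin d → ℝ) : wdot ψ (velocity lam v x) z =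
    (4 - 12 * qnorm lam x) * wdot (ψ * lam) x z + 8 * corr lam v x * wdot (ψ * lam) v z := by
  unfold velocity
  generalize qnorm lam x = s
  generalize corr lam v x = u
  simp only [wdot, Finset.mul_sum, ← Finset.sum_add_distrib, Pi.mul_apply]
  exact Finset.sum_congr rfl fun _ _ => by ring

lemma wdot_head_velocity (hn : IsNormalized lam v) (x : Fin d → ℝ) :
    wdot (headW k) (velocity lam v x) v =
      12 * corr lam v x * (1 - qnorm lam x) - tailDrift lam v k x := by
  have := hn.norm
  simp only [wdot_velocity, wdot_head_mul, tailDrift, tailMass, this, corr]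
  ring

lemma IsFlow.hasDerivAt_head (h : IsFlow lam v w) (hn : IsNormalized lam v) {t : ℝ} (ht : 0 < t) :
    HasDerivAt (fun t => wdot (headW k) (w t) v)
      (12 * corr lam v (w t) * (1 - qnorm lam (w t)) - tailDrift lam v k (w t)) t := by
  refine (h.hasDerivAt_wdot ht _ _).congr_deriv ?_
  rw [← wdot_head_velocity hn, wdot_velocity]

lemma IsFlow.hasDerivAt_tail (h : IsFlow lam v w) {t : ℝ} (ht : 0 < t) :
    HasDerivAt (fun t => wdot (tailW k) (w t) v) (tailDrift lam v k (w t)) t :=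
  h.hasDerivAt_wdot ht _ _

lemma wdot_one_head (x y : Fin d → ℝ) : wdot 1 x (headW k * y) = wdot (headW k) x y := by
  simp only [wdot, Pi.one_apply, Pi.mul_apply]
  exact Finset.sum_congr rfl fun _ _ => by ring

lemma wdot_head_head (v : Fin d → ℝ) : wdot (headW k) (headW k * v) v = wdot (headW k) v v := by
  simp only [wdot, Pi.mul_apply, headW]
  exact Finset.sum_congr rfl fun _ _ => by split_ifs <;> simp

lemma headDist_eq (x : Fin d → ℝ) (α : ℝ) : headDist v k α x =
    wdot 1 x x - 2 * α * wdot (headW k) x v + α ^ 2 * wdot (headW k) v v := by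
  simp only [headDist, wdot_sub_left, wdot_sub_right, wdot_smul_left, wdot_smul_right,
    wdot_one_head, wdot_head_head, wdot_comm 1 (headW k * v) x]
  ring

lemma headDist_nonneg (x : Fin d → ℝ) (α : ℝ) : 0 ≤ headDist v k α x :=
  wdot_self_nonneg (fun _ => zero_le_one) _

lemma headDist_le (x : Fin d → ℝ) (α : ℝ) :
    headDist v k α x ≤ 2 * wdot 1 x x + 2 * α ^ 2 * wdot (headW k) v v := by
  have h := wdot_self_nonneg (ψ := (1 : Fin d → ℝ)) (fun _ => zero_le_one)
    (x + α • (headW k * v))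
  rw [headDist_eq]
  simp only [wdot_add_left, wdot_add_right, wdot_smul_left, wdot_smul_right,
    wdot_one_head, wdot_head_head, wdot_comm 1 (headW k * v) x] at h
  linarith

lemma norm_sq_le_headDist (x : Fin d → ℝ) :
    wdot 1 x x ≤ 2 * headDist v k 1 x + 2 * wdot (headW k) v v := by
  have h := wdot_add_self_le (ψ := (1 : Fin d → ℝ)) (fun _ => zero_le_one)
    (x - (1 : ℝ) • (headW k * v)) ((1 : ℝ) • (headW k * v))
  rw [sub_add_cancel] at h
  have h2 : wdot 1 ((1 : ℝ) • (headW k * v)) ((1 : ℝ) • (headW k * v)) = wdot (headW k) v v := by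
    rw [one_smul, wdot_one_head, wdot_head_head]
  rw [h2] at h
  exact h

lemma abs_tail_le (hn : IsNormalized lam v) {x : Fin d → ℝ} {X τ : ℝ} (hX : 0 ≤ X) (hτ : 0 ≤ τ)
    (hx : qnorm lam x ≤ X ^ 2) (hk : tailMass lam v k ≤ τ ^ 2) :
    |wdot (tailW k * lam) x v| ≤ X * τ :=
  abs_wdot_le (tailW_mul_nonneg hn) hX hτ ((wdot_self_mono (tailW_mul_le hn) x).trans hx) hk

lemma abs_tail_le' (hn : IsNormalized lam v) {x : Fin d → ℝ} {Δ τ : ℝ} (hΔ : 0 ≤ Δ) (hτ : 0 ≤ τ)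
    (hx : qdist lam v x ≤ Δ ^ 2) (hk : tailMass lam v k ≤ τ ^ 2) :
    |wdot (tailW k * lam) x v| ≤ Δ * τ + τ ^ 2 := by
  have h1 : |wdot (tailW k * lam) (x - v) v| ≤ Δ * τ := by
    refine abs_wdot_le (tailW_mul_nonneg hn) hΔ hτ ?_ hk
    rw [qdist_eq hn] at hx
    exact (wdot_self_mono (tailW_mul_le hn) _).trans hx
  have h2 : wdot (tailW k * lam) x v = wdot (tailW k * lam) (x - v) v + tailMass lam v k := by
    rw [wdot_sub_left, tailMass]; ring
  have h3 := tailMass_nonneg hn (k := k)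
  rw [h2]
  refine (abs_add_le _ _).trans ?_
  rw [abs_of_nonneg h3]
  exact add_le_add h1 hk

end trunc

/-! ### Descent towards the teacher -/

section descent
variable {d : ℕ} {lam v : Fin d → ℝ} {w : ℝ → Fin d → ℝ} {k : ℕ}

lemma corr_le_of_qnorm_le (hn : IsNormalized lam v) {x : Fin d → ℝ} (hx : qnorm lam x ≤ 2) :
    corr lam v x ≤ 3 / 2 := by
  have := corr_sq_le_qnorm hn x
  nlinarith

/-- Pointwise form of the descent towards a multiple `α` of the teacher, in terms of `s` and `u`. -/
lemma exists_descent_multiple {s u cu : ℝ} (hcu : 0 < cu) (hu : cu ≤ u)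
    (hs2 : s ≤ 2) (hu2 : u ≤ 3 / 2) (hus : u ^ 2 ≤ s)
    (hL : 1 / 12 ≤ 2 * (1 - s) ^ 2 + (s - 2 * u + 1) * (1 + s + 2 * u)) :
    ∃ α, (α = 1 ∨ α = 2 / cu) ∧ (0 < α ∧ α * cu ≤ 2) ∧
      8 * s - 24 * s ^ 2 + 16 * u ^ 2 - 24 * α * u * (1 - s) ≤ -(cu / 12) := by
  rcases le_or_gt (1 / 2) s with h | h
  · refine ⟨1, Or.inl rfl, ⟨by norm_num, by linarith⟩, ?_⟩
    have hq : 0 ≤ s - 2 * u + 1 := by nlinarith [sq_nonneg (1 - u)]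
    have e4 : 1 / 12 ≤ 2 * (1 - s) ^ 2 + 6 * (s - 2 * u + 1) := by
      have : (s - 2 * u + 1) * (1 + s + 2 * u) ≤ (s - 2 * u + 1) * 6 :=
        mul_le_mul_of_nonneg_left (by linarith) hq
      linarith
    have e5 : 8 * s - 24 * s ^ 2 + 16 * u ^ 2 - 24 * 1 * u * (1 - s) =
        -(8 * (1 - s) ^ 2 + 8 * ((s - 2 * u + 1) * (2 * s + u - 1))) := by ring
    have e6 : (s - 2 * u + 1) * cu ≤ (s - 2 * u + 1) * (2 * s + u - 1) :=
      mul_le_mul_of_nonneg_left (by linarith) hq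
    have e7 : cu * (1 / 12) ≤ cu * (2 * (1 - s) ^ 2 + 6 * (s - 2 * u + 1)) :=
      mul_le_mul_of_nonneg_left e4 hcu.le
    have e8 : cu * (2 * (1 - s) ^ 2) ≤ 3 / 2 * (2 * (1 - s) ^ 2) :=
      mul_le_mul_of_nonneg_right (by linarith) (by positivity)
    have e9 : 0 ≤ (s - 2 * u + 1) * cu := mul_nonneg hq hcu.le
    rw [e5]
    linarith [sq_nonneg (1 - s)]
  · refine ⟨2 / cu, Or.inr rfl, ⟨by positivity, by rw [div_mul_cancel₀ _ hcu.ne']⟩, ?_⟩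
    have e1 : 2 ≤ 2 / cu * u := by
      rw [div_mul_eq_mul_div, le_div_iff₀ hcu]; linarith
    have e2 : 2 * (1 / 2) ≤ 2 / cu * u * (1 - s) :=
      mul_le_mul e1 (by linarith) (by norm_num) (by positivity)
    have e3 : 24 * (2 / cu) * u * (1 - s) = 24 * (2 / cu * u * (1 - s)) := by ring
    rw [e3]
    nlinarith

/-- Outside the sublevel set `{loss ≤ 1/12}` and as long as the correlation is bounded below, the
velocity has a component of definite size towards `α` times a long truncation of the teacher,
where `α` is `1` or large according to the size of `s`. -/
lemma velocity_sq_ge (hn : IsNormalized lam v) {x : Fin d → ℝ} {cu τ B : ℝ} (hcu : 0 < cu)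
    (hu : cu ≤ corr lam v x) (h3 : lossUS lam v x ≤ 3) (hL : 1 / 12 ≤ lossUS lam v x)
    (hτ : 0 ≤ τ) (hk : tailMass lam v k ≤ τ ^ 2) (hτ' : 4032 * τ ≤ cu ^ 2)
    (hB : ∀ α, α = 1 ∨ α = 2 / cu → headDist v k α x ≤ B) :
    (cu / 48) ^ 2 ≤ wdot 1 (velocity lam v x) (velocity lam v x) * B := by
  set s := qnorm lam x with hs
  set u := corr lam v x with hu'
  have hs2 : s ≤ 2 := qnorm_le_two hn h3
  have hs0 : 0 ≤ s := qnorm_nonneg hn x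
  have hu2 : u ≤ 3 / 2 := corr_le_of_qnorm_le hn hs2
  have hus : u ^ 2 ≤ s := corr_sq_le_qnorm hn x
  have hcu2 : cu ≤ 3 / 2 := hu.trans hu2
  have hR : |tailDrift lam v k x| ≤ 42 * τ := by
    have h1 : |wdot (tailW k * lam) x v| ≤ 3 / 2 * τ :=
      abs_tail_le hn (by norm_num) hτ (by rw [← hs]; linarith) hk
    have h2 : |4 - 12 * s| ≤ 20 := abs_le.2 ⟨by linarith, by linarith⟩
    have h4 := tailMass_nonneg hn (k := k)
    have hτ1 : τ ≤ 1 := by nlinarith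
    have h5 : |(4 - 12 * s) * wdot (tailW k * lam) x v| ≤ 20 * (3 / 2 * τ) := by
      rw [abs_mul]; exact mul_le_mul h2 h1 (abs_nonneg _) (by norm_num)
    have h6 : |8 * u * tailMass lam v k| ≤ 12 * τ := by
      have hu0 : 0 < u := hcu.trans_le hu
      rw [abs_of_nonneg (by positivity)]
      have : tailMass lam v k ≤ τ := hk.trans (by nlinarith)
      have : u * tailMass lam v k ≤ 3 / 2 * τ := mul_le_mul hu2 this h4 (by norm_num)
      linarith
    unfold tailDrift
    exact (abs_add_le _ _).trans (by linarith)
  obtain ⟨hR1, hR2⟩ := abs_le.1 hR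
  obtain ⟨α, hα, hα0, hJ⟩ := exists_descent_multiple hcu hu hs2 hu2 hus
    (by have := lossUS_eq (lam := lam) (v := v) x
        rw [this] at hL; exact hL)
  set z : Fin d → ℝ := x - α • (headW k * v) with hz
  have hcs := wdot_sq_le (ψ := (1 : Fin d → ℝ)) (fun _ => zero_le_one) (velocity lam v x) z
  have hval : wdot 1 (velocity lam v x) z = 4 * s - 12 * s ^ 2 + 8 * u ^ 2
      - α * (12 * u * (1 - s) - tailDrift lam v k x) := by
    rw [hz, wdot_sub_right, wdot_smul_right, wdot_one_head, wdot_head_velocity hn, wdot_velocity]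
    simp only [one_mul, wdot_comm lam v x]
    rw [← hs, ← hu', show wdot lam x x = s from rfl, show wdot lam x v = u from rfl]
    ring
  have hle : wdot 1 (velocity lam v x) z ≤ -(cu / 48) := by
    have : α * (42 * τ) ≤ cu / 48 := by
      have h1 : α * (4032 * τ) ≤ α * cu ^ 2 := mul_le_mul_of_nonneg_left hτ' hα0.1.le
      nlinarith [hα0.2]
    have h2 : α * tailDrift lam v k x ≤ α * (42 * τ) := mul_le_mul_of_nonneg_left hR2 hα0.1.le
    rw [hval]
    nlinarith
  calc (cu / 48) ^ 2 ≤ wdot 1 (velocity lam v x) z ^ 2 := by nlinarith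
    _ ≤ _ := hcs
    _ ≤ _ := mul_le_mul_of_nonneg_left (hB α hα) (wdot_self_nonneg (fun _ => zero_le_one) _)

/-- Once the correlation is bounded below, the loss is at most `1/12` after a time which depends
only on the lower bound, on the norm of the initial point and on the norm of a truncation of the
teacher. The loss decays at rate at least `const / (1 + t)`, whose integral diverges. -/
lemma IsFlow.lossUS_le_of_corr_ge (h : IsFlow lam v w) (hn : IsNormalized lam v) {cu τ B : ℝ}
    (hcu : 0 < cu) (hu : ∀ t, 0 ≤ t → cu ≤ corr lam v (w t)) (h3 : lossUS lam v (w 0) ≤ 3)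
    (hτ : 0 ≤ τ) (hk : tailMass lam v k ≤ τ ^ 2) (hτ' : 4032 * τ ≤ cu ^ 2) (hB0 : 0 < B)
    (hB : ∀ α, α = 1 ∨ α = 2 / cu →
      2 * wdot 1 (w 0) (w 0) + 2 * α ^ 2 * wdot (headW k) v v ≤ B) :
    lossUS lam v (w (B * Real.exp (36 / (cu / 48) ^ 2) / 12)) ≤ 1 / 12 := by
  set T := B * Real.exp (36 / (cu / 48) ^ 2) / 12 with hT
  have hT0 : 0 ≤ T := by positivity
  set κ := (cu / 48) ^ 2 with hκ
  have hκ0 : 0 < κ := by positivity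
  by_contra! hcon
  have hc := h.cont
  have hBt : ∀ t, 0 ≤ t → 0 < B + 12 * t := fun t ht => by positivity
  have key := le_of_hasDerivAt_nonneg
    (f := fun t => -lossUS lam v (w t) - κ / 12 * Real.log (B + 12 * max t 0))
    (f' := fun t => - -wdot 1 (velocity lam v (w t)) (velocity lam v (w t))
      - κ / 12 * ((12 * 1) / (B + 12 * t))) hT0 ?_ ?_ ?_
  · simp only [max_self, max_eq_left hT0, mul_zero, add_zero] at key
    have h1 : B + 12 * T ≥ B * Real.exp (36 / κ) := by rw [hT]; linarith
    have h2 : Real.log B + 36 / κ ≤ Real.log (B + 12 * T) := by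
      rw [← Real.log_exp (36 / κ), ← Real.log_mul hB0.ne' (Real.exp_pos _).ne']
      exact Real.log_le_log (by positivity) h1
    have h4 : κ / 12 * (Real.log B + 36 / κ) ≤ κ / 12 * Real.log (B + 12 * T) :=
      mul_le_mul_of_nonneg_left h2 (by positivity)
    have h5 : κ / 12 * (36 / κ) = 3 := by field_simp; norm_num
    nlinarith
  · have : Continuous fun t => Real.log (B + 12 * max t 0) :=
      Continuous.log (by fun_prop) fun t => (hBt _ (le_max_right _ _)).ne'
    fun_prop
  · intro t ht
    have hl : HasDerivAt (fun t => Real.log (B + 12 * max t 0)) ((12 * 1) / (B + 12 * t)) t := by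
      have h1 : HasDerivAt (fun t => Real.log (B + 12 * t)) ((12 * 1) / (B + 12 * t)) t :=
        (((hasDerivAt_id t).const_mul 12).const_add B).log (hBt t ht.1.le).ne'
      refine h1.congr_of_eventuallyEq ?_
      filter_upwards [lt_mem_nhds ht.1] with τ hτ
      rw [max_eq_left hτ.le]
    exact (h.hasDerivAt_lossUS ht.1).neg.sub (hl.const_mul _)
  · intro t ht
    have hLt : 1 / 12 ≤ lossUS lam v (w t) := hcon.le.trans (h.lossUS_antitone ht.1.le ht.2.le)
    have h3t : lossUS lam v (w t) ≤ 3 := (h.lossUS_antitone le_rfl ht.1.le).trans h3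
    have hv := velocity_sq_ge hn hcu (hu t ht.1.le) h3t hLt hτ hk hτ' (B := B + 12 * t)
      (fun α hα => (headDist_le _ _).trans (by
        have := h.norm_sq_le hn le_rfl ht.1.le
        have := hB α hα
        linarith))
    have hp := hBt t ht.1.le
    have : κ / 12 * ((12 * 1) / (B + 12 * t)) = κ / (B + 12 * t) := by field_simp
    rw [this, neg_neg, sub_nonneg, div_le_iff₀ hp]
    exact hv

/-- The sign of the correlation persists where it is bounded away from zero. -/
lemma IsFlow.corr_ge_of_sq_ge (h : IsFlow lam v w) {cu t₁ : ℝ} (hcu : 0 < cu)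
    (h0 : 0 < corr lam v (w t₁)) (hsq : ∀ t, t₁ ≤ t → cu ^ 2 ≤ corr lam v (w t) ^ 2) :
    ∀ t, t₁ ≤ t → cu ≤ corr lam v (w t) := by
  intro t ht
  have hc := h.cont
  have := pos_of_nonneg_imp_pos (f := fun t => corr lam v (w t)) (a := t₁) (b := t) (by fun_prop)
    h0 (fun t' ht' hnn => by
      have h1 := hnn t' (right_mem_Icc.2 ht'.1)
      have h2 := hsq t' ht'.1
      rcases eq_or_lt_of_le h1 with h3 | h3
      · rw [← h3] at h2; nlinarith
      · exact h3) t (right_mem_Icc.2 ht)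
  exact le_of_sq_le_sq (hsq t ht) this.le

/-- What a small loss and a positive correlation say about `s`, `u` and the distance. -/
lemma bounds_of_lossUS_le (hn : IsNormalized lam v) {x : Fin d → ℝ}
    (hL : lossUS lam v x ≤ 1 / 12) (hu : 0 < corr lam v x) :
    5 / 6 ≤ qnorm lam x ∧ qnorm lam x ≤ 7 / 6 ∧ 7 / 8 ≤ corr lam v x ∧ corr lam v x ≤ 109 / 100 ∧
      qdist lam v x ≤ lossUS lam v x ∧
      lossUS lam v x ≤ 2 * (1 - qnorm lam x) ^ 2 + 6 * qdist lam v x := by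
  have h1 := sq_le_lossUS hn x
  have h2 := corr_sq_le_qnorm hn x
  have h3 := lossUS_eq (lam := lam) (v := v) x
  have h4 := qdist_nonneg hn x
  have h5 : qdist lam v x = qnorm lam x - 2 * corr lam v x + 1 := rfl
  set s := qnorm lam x
  set u := corr lam v x
  have hs1 : 5 / 6 ≤ s := by nlinarith
  have hs2 : s ≤ 7 / 6 := by nlinarith
  have hu2 : u ≤ 109 / 100 := by nlinarith
  have hd : qdist lam v x ≤ lossUS lam v x := by rw [h3]; nlinarith [sq_nonneg (1 - s)]
  refine ⟨hs1, hs2, by linarith, hu2, hd, ?_⟩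
  rw [h3]; nlinarith

lemma IsFlow.corr_pos_of_lossUS_le (h : IsFlow lam v w) (hn : IsNormalized lam v)
    (hL : lossUS lam v (w 0) ≤ 1 / 12) (hu : 0 < corr lam v (w 0)) :
    ∀ t, 0 ≤ t → 0 < corr lam v (w t) := by
  intro t ht
  refine lt_of_lt_of_le (by norm_num : (0 : ℝ) < 1 / 2)
    (h.corr_ge_of_sq_ge (t₁ := 0) (by norm_num) hu ?_ t ht)
  intro t ht
  have h1 := (h.lossUS_antitone le_rfl ht).trans hL
  have h2 := sq_le_lossUS hn (w t)
  simp only [lossUS] at h1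
  have : 3 * (1 - qnorm lam (w t)) ^ 2 ≤ 1 / 12 := by simp only [lossUS] at h2; linarith
  nlinarith

/-- Near the optimum the truncated tail contributes to the drift at most a fraction of the distance
and a multiple of the tail mass. -/
lemma abs_tailDrift_le (hn : IsNormalized lam v) {x : Fin d → ℝ}
    (hL : lossUS lam v x ≤ 1 / 12) (hu : 0 < corr lam v x) :
    2 * |tailDrift lam v k x| ≤ 4 * qdist lam v x + 63 * tailMass lam v k := by
  obtain ⟨h1, h2, h3, h4, h5, h6⟩ := bounds_of_lossUS_le hn hL hu
  have hm := tailMass_nonneg hn (k := k)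
  have hq := qdist_nonneg hn x
  have hΔ := Real.sqrt_nonneg (qdist lam v x)
  have hτ := Real.sqrt_nonneg (tailMass lam v k)
  have e1 := Real.sq_sqrt hq
  have e2 := Real.sq_sqrt hm
  have ht := abs_tail_le' hn hΔ hτ (x := x) (k := k) e1.symm.le e2.symm.le
  have h7 : |4 - 12 * qnorm lam x| ≤ 10 := abs_le.2 ⟨by linarith, by linarith⟩
  have h8 : |tailDrift lam v k x| ≤ 10 * |wdot (tailW k * lam) x v| +
      8 * corr lam v x * tailMass lam v k := by
    unfold tailDrift
    refine (abs_add_le _ _).trans (add_le_add ?_ ?_)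
    · rw [abs_mul]; exact mul_le_mul_of_nonneg_right h7 (abs_nonneg _)
    · rw [abs_of_nonneg (by positivity)]
  nlinarith [sq_nonneg (2 * √(qdist lam v x) - 5 * √(tailMass lam v k))]

lemma IsFlow.hasDerivAt_headDist (h : IsFlow lam v w) (hn : IsNormalized lam v) {t : ℝ}
    (ht : 0 < t) : HasDerivAt (fun t => headDist v k 1 (w t))
      (-8 * (1 - qnorm lam (w t)) ^ 2
        - 8 * qdist lam v (w t) * (2 * qnorm lam (w t) + corr lam v (w t) - 1)
        + 2 * tailDrift lam v k (w t)) t := by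
  simp only [headDist_eq]
  refine (((h.hasDerivAt_norm_sq ht).sub ((h.hasDerivAt_head hn ht).const_mul (2 * 1))).add_const
    (1 ^ 2 * wdot (headW k) v v)).congr_deriv ?_
  simp only [qdist]
  ring

/-- The derivative of the distance to a truncated teacher is at most minus the loss (and minus
twice the distance to the full teacher) up to the tail mass. -/
lemma headDist_drift_le (hn : IsNormalized lam v) {x : Fin d → ℝ}
    (hL : lossUS lam v x ≤ 1 / 12) (hu : 0 < corr lam v x) :
    -8 * (1 - qnorm lam x) ^ 2 - 8 * qdist lam v x * (2 * qnorm lam x + corr lam v x - 1)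
        + 2 * tailDrift lam v k x ≤
      -lossUS lam v x - 2 * qdist lam v x + 63 * tailMass lam v k := by
  have h0 := abs_tailDrift_le hn hL hu (k := k)
  obtain ⟨h1, h2, h3, h4, h5, h6⟩ := bounds_of_lossUS_le hn hL hu
  have hq := qdist_nonneg hn x
  have := le_abs_self (tailDrift lam v k x)
  nlinarith [sq_nonneg (1 - qnorm lam x)]

@[fun_prop]
lemma continuous_headDist {x : ℝ → Fin d → ℝ} {α : ℝ} (hx : Continuous x) :
    Continuous fun t => headDist v k α (x t) := by simp only [headDist_eq]; fun_prop

/-- Regret bound for the late phase: comparison of the student with a truncated teacher. -/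
lemma IsFlow.mul_lossUS_add_headDist_le (h : IsFlow lam v w) (hn : IsNormalized lam v)
    (hL : lossUS lam v (w 0) ≤ 1 / 12) (hu : 0 < corr lam v (w 0)) {t : ℝ} (ht : 0 ≤ t) :
    t * lossUS lam v (w t) + headDist v k 1 (w t) ≤
      headDist v k 1 (w 0) + 63 * tailMass lam v k * t := by
  have hc := h.cont
  have key := le_of_hasDerivAt_nonneg (f := fun t => 63 * tailMass lam v k * t
      - (t * lossUS lam v (w t) + headDist v k 1 (w t)))
    (f' := fun t => 63 * tailMass lam v k * 1 - ((1 * lossUS lam v (w t)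
      + t * (-wdot 1 (velocity lam v (w t)) (velocity lam v (w t))))
      + (-8 * (1 - qnorm lam (w t)) ^ 2
        - 8 * qdist lam v (w t) * (2 * qnorm lam (w t) + corr lam v (w t) - 1)
        + 2 * tailDrift lam v k (w t)))) ht (by fun_prop) ?_ ?_
  · simp only [mul_zero, zero_mul, zero_sub, zero_add] at key
    linarith
  · intro t ht
    exact ((hasDerivAt_id t).const_mul _).sub
      (((hasDerivAt_id t).mul (h.hasDerivAt_lossUS ht.1)).add (h.hasDerivAt_headDist hn ht.1))
  · intro t ht
    have h1 := headDist_drift_le hn ((h.lossUS_antitone le_rfl ht.1.le).trans hL)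
      (h.corr_pos_of_lossUS_le hn hL hu t ht.1.le) (k := k)
    have h2 := wdot_self_nonneg (ψ := (1 : Fin d → ℝ)) (fun _ => zero_le_one)
      (velocity lam v (w t))
    have h3 := qdist_nonneg hn (w t)
    nlinarith [mul_nonneg ht.1.le h2]

/-- The part of `⟨w, v⟩` from position `k` on stays bounded by what is paid in distance. -/
lemma IsFlow.abs_tail_add_headDist_le (h : IsFlow lam v w) (hn : IsNormalized lam v)
    (hL : lossUS lam v (w 0) ≤ 1 / 12) (hu : 0 < corr lam v (w 0)) {t : ℝ} (ht : 0 ≤ t) :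
    |wdot (tailW k) (w t) v - wdot (tailW k) (w 0) v| ≤
      headDist v k 1 (w 0) + 100 * tailMass lam v k * t := by
  have hc := h.cont
  have main : ∀ σ : ℝ, |σ| ≤ 1 → σ * wdot (tailW k) (w t) v - σ * wdot (tailW k) (w 0) v ≤
      headDist v k 1 (w 0) + 100 * tailMass lam v k * t := by
    intro σ hσ
    have key := le_of_hasDerivAt_nonneg (f := fun t => 100 * tailMass lam v k * t
        - (σ * wdot (tailW k) (w t) v + headDist v k 1 (w t)))
      (f' := fun t => 100 * tailMass lam v k * 1 - (σ * tailDrift lam v k (w t)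
        + (-8 * (1 - qnorm lam (w t)) ^ 2
          - 8 * qdist lam v (w t) * (2 * qnorm lam (w t) + corr lam v (w t) - 1)
          + 2 * tailDrift lam v k (w t)))) ht (by fun_prop) ?_ ?_
    · simp only [mul_zero, zero_sub] at key
      have := headDist_nonneg (v := v) (k := k) (w t) 1
      linarith
    · intro t ht
      exact ((hasDerivAt_id t).const_mul _).sub
        (((h.hasDerivAt_tail ht.1).const_mul _).add (h.hasDerivAt_headDist hn ht.1))
    · intro t ht
      have hLt := (h.lossUS_antitone le_rfl ht.1.le).trans hL
      have hut := h.corr_pos_of_lossUS_le hn hL hu t ht.1.le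
      have h1 := headDist_drift_le hn hLt hut (k := k)
      have h2 := abs_tailDrift_le hn hLt hut (k := k)
      have h3 := qdist_nonneg hn (w t)
      have h4 := lossUS_nonneg hn (w t)
      have h5 := tailMass_nonneg hn (k := k)
      have h6 : σ * tailDrift lam v k (w t) ≤ |tailDrift lam v k (w t)| := by
        refine (le_abs_self _).trans ?_
        rw [abs_mul]
        exact mul_le_of_le_one_left (abs_nonneg _) hσ
      nlinarith
  refine abs_le.2 ⟨?_, ?_⟩
  · have := main (-1) (by norm_num); linarith
  · have := main 1 (by norm_num); linarith

end descent

/-! ### The late phase -/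

/-- Power-law spectrum, and a teacher whose squared coordinates have partial sums of linear order;
`M` quantifies the regularity of the teacher, being also the position from which the lower bound on
its partial sums is required, and `l₀` is the normalisation of the spectrum. -/
structure IsRegular {d : ℕ} (a M l₀ : ℝ) (lam v : Fin d → ℝ) : Prop extends
    IsNormalized lam v where
  lam_le : ∀ i : Fin d, lam i ≤ (((i : ℕ) : ℝ) + 1) ^ (-a)
  le_lam : ∀ i : Fin d, l₀ * (((i : ℕ) : ℝ) + 1) ^ (-a) ≤ lam i
  head_le : ∀ k : ℕ, 1 ≤ k → wdot (headW k) v v ≤ M * k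
  le_head : ∀ k : ℕ, M ≤ k → k ≤ d → k / M ≤ wdot (headW k) v v
  tail_le : ∀ k : ℕ, 1 ≤ k → tailMass lam v k ≤ M * (k : ℝ) ^ (1 - a)

section late
variable {d : ℕ} {lam v : Fin d → ℝ} {w : ℝ → Fin d → ℝ} {a M l₀ N : ℝ}

lemma sqrt_mul_sqrt_le {X Y : ℝ} (hX : 0 ≤ X) (hY : 0 ≤ Y) : √X * √Y ≤ X + Y := by
  nlinarith [Real.sq_sqrt hX, Real.sq_sqrt hY, sq_nonneg (√X - √Y), Real.sqrt_nonneg X,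
    Real.sqrt_nonneg Y]

lemma rpow_one_sub_mul_rpow {x : ℝ} (hx : 0 < x) (a : ℝ) : x ^ (1 - a) * x ^ a = x := by
  rw [← Real.rpow_add hx, sub_add_cancel, Real.rpow_one]

/-- A trajectory in the basin of the teacher, with bounded initial norm. -/
structure IsLate (N : ℝ) (lam v : Fin d → ℝ) (w : ℝ → Fin d → ℝ) : Prop extends
    IsFlow lam v w where
  loss_le : lossUS lam v (w 0) ≤ 1 / 12
  corr_pos : 0 < corr lam v (w 0)
  norm_le : wdot 1 (w 0) (w 0) ≤ N

lemma IsLate.loss (h : IsLate N lam v w) {t : ℝ} (ht : 0 ≤ t) : lossUS lam v (w t) ≤ 1 / 12 :=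
  (h.lossUS_antitone le_rfl ht).trans h.loss_le

lemma IsLate.corr (h : IsLate N lam v w) (hn : IsNormalized lam v) {t : ℝ} (ht : 0 ≤ t) :
    0 < corr lam v (w t) := h.corr_pos_of_lossUS_le hn h.loss_le h.corr_pos t ht

lemma IsLate.headDist_zero_le (h : IsLate N lam v w) (hr : IsRegular a M l₀ lam v) (hN : 0 ≤ N)
    {j : ℕ} (hj : 1 ≤ j) : headDist v j 1 (w 0) ≤ (2 * N + 2 * M) * j := by
  have h1 := headDist_le (v := v) (k := j) (w 0) 1
  have h2 := hr.head_le j hj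
  have h3 := h.norm_le
  have hj' : (1 : ℝ) ≤ j := by exact_mod_cast hj
  nlinarith

/-- Regret bound with respect to a regular teacher truncated to its first `j` coordinates. -/
lemma IsLate.regret (h : IsLate N lam v w) (hr : IsRegular a M l₀ lam v) (hN : 0 ≤ N)
    {j : ℕ} (hj : 1 ≤ j) {t : ℝ} (ht : 0 ≤ t) :
    t * lossUS lam v (w t) + headDist v j 1 (w t) ≤
      (2 * N + 2 * M) * j + 63 * (M * (j : ℝ) ^ (1 - a)) * t := by
  have h1 := h.mul_lossUS_add_headDist_le hr.toIsNormalized h.loss_le h.corr_pos ht (k := j)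
  have h2 := h.headDist_zero_le hr hN hj
  have h3 := mul_le_mul_of_nonneg_right (hr.tail_le j hj) ht
  linarith

/-- From time `j ^ a` on, the loss is of the order of the `Q`-mass of the teacher from
position `j` on. -/
lemma IsLate.loss_le_rpow (h : IsLate N lam v w) (hr : IsRegular a M l₀ lam v) (hN : 0 ≤ N)
    {j : ℕ} (hj : 1 ≤ j) {t : ℝ} (ht : (j : ℝ) ^ a ≤ t) :
    lossUS lam v (w t) ≤ (2 * N + 65 * M) * (j : ℝ) ^ (1 - a) := by
  have hj' : (0 : ℝ) < j := by exact_mod_cast hj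
  have hja := Real.rpow_pos_of_pos hj' a
  refine (h.lossUS_antitone hja.le ht).trans ?_
  have h1 := h.regret hr hN hj hja.le
  have h2 := headDist_nonneg (v := v) (k := j) (w ((j : ℝ) ^ a)) 1
  have h3 := rpow_one_sub_mul_rpow hj' a
  refine le_of_mul_le_mul_left ?_ hja
  have h4 : 63 * (M * (j : ℝ) ^ (1 - a)) * (j : ℝ) ^ a
      = 63 * M * ((j : ℝ) ^ (1 - a) * (j : ℝ) ^ a) := by ring
  have h5 : (j : ℝ) ^ a * ((2 * N + 65 * M) * (j : ℝ) ^ (1 - a))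
      = (2 * N + 65 * M) * ((j : ℝ) ^ (1 - a) * (j : ℝ) ^ a) := by ring
  rw [h5, h3]
  rw [h4, h3] at h1
  linarith

/-- Until time `j ^ a` only the first `j` coordinates have been learned: the squared norm is of
order `j`. -/
lemma IsLate.norm_sq_le_mul (h : IsLate N lam v w) (hr : IsRegular a M l₀ lam v) (hN : 0 ≤ N)
    (hM : 0 ≤ M) {j : ℕ} (hj : 1 ≤ j) {t : ℝ} (ht0 : 0 ≤ t) (ht : t ≤ (j : ℝ) ^ a) :
    wdot 1 (w t) (w t) ≤ (4 * N + 132 * M) * j := by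
  have hj' : (0 : ℝ) < j := by exact_mod_cast hj
  have h1 := h.regret hr hN hj ht0
  have h2 := norm_sq_le_headDist (v := v) (k := j) (w t)
  have h3 := rpow_one_sub_mul_rpow hj' a
  have h4 := hr.head_le j hj
  have h5 := mul_nonneg ht0 (lossUS_nonneg hr.toIsNormalized (w t))
  have h6 : M * (j : ℝ) ^ (1 - a) * t ≤ M * j := by
    rw [← h3, ← mul_assoc, h3]
    exact mul_le_mul_of_nonneg_left ht (mul_nonneg hM (Real.rpow_nonneg hj'.le _))
  linarith

lemma abs_head_le (hr : IsRegular a M l₀ lam v) (hM : 0 ≤ M) {j : ℕ} (hj : 1 ≤ j)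
    {x : Fin d → ℝ} {X : ℝ} (hX : 0 ≤ X) (hx : wdot 1 x x ≤ X) :
    |wdot (headW j) x v| ≤ √X * √(M * j) := by
  refine abs_wdot_le headW_nonneg (Real.sqrt_nonneg _) (Real.sqrt_nonneg _) ?_ ?_
  · rw [Real.sq_sqrt hX]; exact (wdot_self_mono headW_le_one x).trans hx
  · rw [Real.sq_sqrt (by positivity)]; exact hr.head_le j hj

/-- Bound on `⟨w, v⟩` through the late phase. -/
lemma IsLate.abs_wdot_one_le (h : IsLate N lam v w) (hr : IsRegular a M l₀ lam v) (hN : 0 ≤ N)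
    (hM : 0 ≤ M) {j : ℕ} (hj : 1 ≤ j) {t : ℝ} (ht0 : 0 ≤ t) (ht : t ≤ (j : ℝ) ^ a) :
    |wdot 1 (w t) v| ≤ |wdot 1 (w 0) v| + (12 * N + 400 * M) * j := by
  have hj' : (0 : ℝ) < j := by exact_mod_cast hj
  have hj1 : (1 : ℝ) ≤ j := by exact_mod_cast hj
  have hsplit : ∀ x : Fin d → ℝ, wdot 1 x v = wdot (headW j) x v + wdot (tailW j) x v :=
    fun x => by rw [← wdot_add_weight, headW_add_tailW]
  have h1 := (abs_head_le hr hM hj (by positivity) (h.norm_sq_le_mul hr hN hM hj ht0 ht)).trans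
    (sqrt_mul_sqrt_le (by positivity) (by positivity))
  have h2 := (abs_head_le hr hM hj hN h.norm_le).trans
    (sqrt_mul_sqrt_le (by positivity) (by positivity))
  have h3 := h.abs_tail_add_headDist_le hr.toIsNormalized h.loss_le h.corr_pos ht0 (k := j)
  have h4 := h.headDist_zero_le hr hN hj
  have h6 : tailMass lam v j * t ≤ M * j := by
    have h5 := rpow_one_sub_mul_rpow hj' a
    calc tailMass lam v j * t ≤ M * (j : ℝ) ^ (1 - a) * (j : ℝ) ^ a :=
          mul_le_mul (hr.tail_le j hj) ht ht0 (mul_nonneg hM (Real.rpow_nonneg hj'.le _))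
      _ = M * j := by rw [mul_assoc, h5]
  have h7 : N ≤ N * j := by nlinarith
  rw [hsplit (w t), hsplit (w 0)]
  have e1 := abs_le.1 h1
  have e2 := abs_le.1 h2
  have e3 := abs_le.1 h3
  rcases abs_cases (wdot (headW j) (w 0) v + wdot (tailW j) (w 0) v) with ⟨e4, _⟩ | ⟨e4, _⟩ <;>
  rw [e4] <;> refine abs_le.2 ⟨?_, ?_⟩ <;> nlinarith

/-- In the basin, each coordinate of the student stays below its initial size plus what the
teacher can have contributed. -/
lemma IsLate.abs_coord_le (h : IsLate N lam v w) (hn : IsNormalized lam v) (i : Fin d) {t : ℝ}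
    (ht : 0 ≤ t) : |w t i| ≤ |w 0 i| + 9 * lam i * |v i| * t := by
  have hc := h.cont
  have main : ∀ σ : ℝ, σ = 1 ∨ σ = -1 → σ * w t i ≤ |w 0 i| + 9 * lam i * |v i| * t := by
    intro σ hσ
    have key := nonneg_of_hasDerivAt_ge (f := fun t => |w 0 i| + 9 * lam i * |v i| * t - σ * w t i)
      (f' := fun t => 9 * lam i * |v i| * 1 - σ *
        (lam i * ((4 - 12 * qnorm lam (w t)) * w t i + 8 * PhaseRetrieval.corr lam v (w t) * v i)))
      (g := fun t => lam i * (4 - 12 * qnorm lam (w t))) ht (by fun_prop) (by fun_prop) ?_ ?_ ?_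
    · linarith
    · intro t ht
      exact (((hasDerivAt_id t).const_mul _).const_add _).sub ((h.deriv t ht.1 i).const_mul σ)
    · intro t ht
      obtain ⟨h1, h2, h3, h4, -, -⟩ := bounds_of_lossUS_le hn (h.loss ht.1.le)
        (h.corr hn ht.1.le)
      have hl := hn.pos i
      have e1 : σ * v i ≤ |v i| := by
        rcases hσ with rfl | rfl
        · simpa using le_abs_self (v i)
        · simpa using neg_le_abs (v i)
      have e2 : 8 * PhaseRetrieval.corr lam v (w t) * (σ * v i) ≤ 9 * |v i| :=
        (mul_le_mul_of_nonneg_left e1 (by linarith)).trans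
          (mul_le_mul_of_nonneg_right (by linarith) (abs_nonneg _))
      have e3 : (4 - 12 * qnorm lam (w t)) * (|w 0 i| + 9 * lam i * |v i| * t) ≤ 0 :=
        mul_nonpos_of_nonpos_of_nonneg (by linarith)
          (by have := ht.1; positivity)
      nlinarith
    · rcases hσ with rfl | rfl
      · simpa using le_abs_self (w 0 i)
      · have := neg_abs_le (w 0 i)
        simp only [mul_zero, add_zero]
        linarith
  exact abs_le.2 ⟨by have := main (-1) (Or.inr rfl); linarith,
    by have := main 1 (Or.inl rfl); linarith⟩

/-- In the basin, a coordinate of the student opposes the teacher by at most its initial size. -/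
lemma IsLate.neg_le_coord (h : IsLate N lam v w) (hn : IsNormalized lam v) (i : Fin d) {t : ℝ}
    (ht : 0 ≤ t) : -|w 0 i * v i| ≤ w t i * v i := by
  have hc := h.cont
  have key := nonneg_of_hasDerivAt_ge (f := fun t => w t i * v i + |w 0 i * v i|)
    (f' := fun t => (lam i * ((4 - 12 * qnorm lam (w t)) * w t i
      + 8 * PhaseRetrieval.corr lam v (w t) * v i)) * v i)
    (g := fun t => lam i * (4 - 12 * qnorm lam (w t))) ht (by fun_prop) (by fun_prop) ?_ ?_ ?_
  · linarith
  · intro t ht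
    exact ((h.deriv t ht.1 i).mul_const _).add_const _
  · intro t ht
    obtain ⟨h1, h2, h3, h4, -, -⟩ := bounds_of_lossUS_le hn (h.loss ht.1.le)
      (h.corr hn ht.1.le)
    have hl := hn.pos i
    have e1 : lam i * (4 - 12 * qnorm lam (w t)) * |w 0 i * v i| ≤ 0 :=
      mul_nonpos_of_nonpos_of_nonneg (mul_nonpos_of_nonneg_of_nonpos hl.le (by linarith))
        (abs_nonneg _)
    have e2 : 0 ≤ lam i * (8 * PhaseRetrieval.corr lam v (w t) * v i) * v i := by
      have : lam i * (8 * PhaseRetrieval.corr lam v (w t) * v i) * v i =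
        lam i * (8 * PhaseRetrieval.corr lam v (w t)) * v i ^ 2 := by ring
      rw [this]
      have : 0 < PhaseRetrieval.corr lam v (w t) := by linarith
      positivity
    nlinarith
  · have := neg_abs_le (w 0 i * v i); linarith

end late

/-! ### Reaching a prescribed accuracy -/

section accurate
variable {d : ℕ} {lam v : Fin d → ℝ} {w : ℝ → Fin d → ℝ} {a M l₀ N : ℝ}

/-- Both the correlation and the squared `Q`-norm lie in `[1 - ε, 1]`. -/
def IsAccurate (ε : ℝ) (lam v x : Fin d → ℝ) : Prop :=
  corr lam v x ∈ Icc (1 - ε) 1 ∧ qnorm lam x ∈ Icc (1 - ε) 1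

/-- For a student with loss at most `ε`, only `s` has to be checked: `u` is within half the
`Q`-distance of `(1 + s) / 2`, and `u² ≤ s`. -/
lemma isAccurate_of_qnorm_mem (hn : IsNormalized lam v) {x : Fin d → ℝ} {ε : ℝ}
    (hL : lossUS lam v x ≤ 1 / 12) (hu : 0 < corr lam v x) (hLε : lossUS lam v x ≤ ε)
    (hs : qnorm lam x ∈ Icc (1 - ε) 1) : IsAccurate ε lam v x := by
  obtain ⟨h1, h2, h3, h4, h5, -⟩ := bounds_of_lossUS_le hn hL hu
  have h6 := corr_sq_le_qnorm hn x
  have h7 : qdist lam v x = qnorm lam x - 2 * corr lam v x + 1 := rfl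
  refine ⟨⟨by linarith [hs.1], ?_⟩, hs⟩
  nlinarith [hs.2]

lemma rpow_mul_nat (a : ℝ) (A k : ℕ) :
    ((A * k : ℕ) : ℝ) ^ a = (A : ℝ) ^ a * (k : ℝ) ^ a := by
  rw [Nat.cast_mul, Real.mul_rpow (Nat.cast_nonneg _) (Nat.cast_nonneg _)]

lemma mul_rpow_le_rpow {a : ℝ} (ha : 1 < a) {A k : ℕ} (hA : 1 ≤ A) :
    A * (k : ℝ) ^ a ≤ ((A * k : ℕ) : ℝ) ^ a := by
  rw [rpow_mul_nat]
  refine mul_le_mul_of_nonneg_right ?_ (Real.rpow_nonneg (Nat.cast_nonneg _) _)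
  exact Real.self_le_rpow_of_one_le (by exact_mod_cast hA) ha.le

/-- The squared norm cannot stay below `1` by more than the accuracy for a long time: meanwhile
`⟨w, v⟩` restricted to the first coordinates would outgrow what the norms allow. -/
lemma IsLate.not_forall_qnorm_lt (h : IsLate N lam v w) (hr : IsRegular a M l₀ lam v) (ha : 1 < a)
    (hN : 0 ≤ N) (hM : 0 < M) {k A : ℕ} (hk : 1 ≤ k) (hA : 2 ≤ A) :
    ¬ ∀ t ∈ Icc ((k : ℝ) ^ a) (((A * k : ℕ) : ℝ) ^ a),
      qnorm lam (w t) < 1 - 100 * (2 * N + 65 * M) * (k : ℝ) ^ (1 - a) := by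
  intro hs
  set C := 2 * N + 65 * M with hC
  have hC0 : 0 < C := by positivity
  have hk0 : (0 : ℝ) < k := by exact_mod_cast hk
  have hAr : (2 : ℝ) ≤ A := by exact_mod_cast hA
  set η := C * (k : ℝ) ^ (1 - a) with hη
  have hη0 : 0 < η := mul_pos hC0 (Real.rpow_pos_of_pos hk0 _)
  have hka := Real.rpow_pos_of_pos hk0 a
  have hAk := mul_rpow_le_rpow ha (A := A) (k := k) (by omega)
  have hle : (k : ℝ) ^ a ≤ ((A * k : ℕ) : ℝ) ^ a := by nlinarith
  have hηk : η * (k : ℝ) ^ a = C * k := by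
    rw [hη, mul_assoc, rpow_one_sub_mul_rpow hk0]
  have hc := h.cont
  have hn := hr.toIsNormalized
  have key := le_of_hasDerivAt_nonneg (f := fun t => wdot (headW k) (w t) v - 990 * η * t)
    (f' := fun t => (12 * PhaseRetrieval.corr lam v (w t) * (1 - qnorm lam (w t))
      - tailDrift lam v k (w t)) - 990 * η * 1) hle (by fun_prop) ?_ ?_
  · have hjA : 1 ≤ A * k := Nat.mul_pos (by omega) hk
    have hb : ∀ t, 0 ≤ t → t ≤ ((A * k : ℕ) : ℝ) ^ a →
        |wdot (headW k) (w t) v| ≤ 3 * C * A * k := by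
      intro t ht0 ht
      have h1 := h.norm_sq_le_mul hr hN hM.le hjA ht0 ht
      have h2 := abs_head_le hr hM.le hk (by positivity) h1
      refine h2.trans ((sqrt_mul_sqrt_le (by positivity) (by positivity)).trans ?_)
      push_cast
      have : M * k ≤ M * k * A := le_mul_of_one_le_right (by positivity) (by linarith)
      have e0 : 0 ≤ N * A * k := by positivity
      rw [hC]
      nlinarith
    have h1 := abs_le.1 (hb _ hka.le hle)
    have h2 := abs_le.1 (hb _ (hka.le.trans hle) le_rfl)
    have h3 : η * (A * (k : ℝ) ^ a) ≤ η * ((A * k : ℕ) : ℝ) ^ a :=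
      mul_le_mul_of_nonneg_left hAk hη0.le
    have h4 : η * (A * (k : ℝ) ^ a) = C * k * A := by rw [← hηk]; ring
    have h5 : 2 * (C * k) ≤ C * k * A := by nlinarith [mul_pos hC0 hk0]
    have h6 := mul_pos hC0 hk0
    have e1 : 3 * C * A * k = 3 * (C * k * A) := by ring
    rw [e1] at h1 h2
    rw [h4] at h3
    linarith [h1.1, h2.2]
  · intro t ht
    have ht0 : 0 < t := hka.trans ht.1
    exact (h.hasDerivAt_head hn ht0).sub ((hasDerivAt_id t).const_mul _)
  · intro t ht
    have ht0 : 0 ≤ t := hka.le.trans ht.1.le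
    have hL := h.loss_le_rpow hr hN hk ht.1.le
    have hL' := h.loss ht0
    have hu := h.corr hn ht0
    have hR := abs_tailDrift_le hn hL' hu (k := k)
    obtain ⟨h1, h2, h3, h4, h5, -⟩ := bounds_of_lossUS_le hn hL' hu
    have hτ := hr.tail_le k hk
    have hst := hs t ⟨ht.1.le, ht.2.le⟩
    have e1 : 63 * (M * (k : ℝ) ^ (1 - a)) ≤ η := by
      have := Real.rpow_pos_of_pos hk0 (1 - a)
      rw [hη, hC]; nlinarith
    have e2 : 100 * η ≤ 1 - qnorm lam (w t) := by
      rw [hη]; linarith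
    have e3 : 12 * (7 / 8) * (100 * η) ≤
        12 * PhaseRetrieval.corr lam v (w t) * (1 - qnorm lam (w t)) :=
      mul_le_mul (by linarith) e2 (by positivity) (by linarith)
    have e4 := le_abs_self (tailDrift lam v k (w t))
    linarith

/-- Coordinates with `λᵢ t` small are hardly learned at time `t`. -/
lemma IsLate.tail_corr_le (h : IsLate N lam v w) (hr : IsRegular a M l₀ lam v) (ha : 1 < a)
    (hN : 0 ≤ N) (hM : 0 ≤ M) {j : ℕ} (hj : 1 ≤ j) {t : ℝ} (ht0 : 0 ≤ t) (ht : t ≤ (j : ℝ) ^ a) :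
    wdot (tailW (27 * j) * lam) (w t) v ≤
      √(N * ((27 * j : ℕ) : ℝ) ^ (-a)) * √(M * ((27 * j : ℕ) : ℝ) ^ (1 - a))
        + tailMass lam v (27 * j) / 3 := by
  set m := 27 * j with hm
  have hn := hr.toIsNormalized
  have hj0 : (0 : ℝ) < j := by exact_mod_cast hj
  have hm0 : (0 : ℝ) < m := by rw [hm]; push_cast; positivity
  have hlam : ∀ i : Fin d, m ≤ (i : ℕ) → lam i ≤ (m : ℝ) ^ (-a) := fun i hi =>
    (hr.lam_le i).trans (Real.rpow_le_rpow_of_nonpos hm0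
      (by have : (m : ℝ) ≤ (i : ℕ) := by exact_mod_cast hi
          linarith) (by linarith))
  have hsmall : ∀ i : Fin d, m ≤ (i : ℕ) → 9 * lam i * t ≤ 1 / 3 := by
    intro i hi
    have h1 : lam i * t ≤ (m : ℝ) ^ (-a) * (j : ℝ) ^ a :=
      mul_le_mul (hlam i hi) ht ht0 (Real.rpow_nonneg hm0.le _)
    have h2 : (m : ℝ) ^ (-a) * (j : ℝ) ^ a ≤ 1 / 27 := by
      rw [hm, rpow_mul_nat, mul_assoc, ← Real.rpow_add hj0, neg_add_cancel, Real.rpow_zero,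
        mul_one, Real.rpow_neg (by positivity), ← one_div]
      refine one_div_le_one_div_of_le (by norm_num) ?_
      have := Real.self_le_rpow_of_one_le (x := ((27 : ℕ) : ℝ)) (by norm_num) ha.le
      exact_mod_cast this
    linarith
  have h1 : wdot (tailW m * lam) (w t) v ≤
      wdot (tailW m * lam) (fun i => |w 0 i|) (fun i => |v i|) + tailMass lam v m / 3 := by
    have e : tailMass lam v m / 3 = ∑ i, (tailW m * lam : Fin d → ℝ) i * v i * v i * (1 / 3) := by
      rw [tailMass, wdot, ← Finset.sum_mul]; ring
    rw [e, wdot, wdot, ← Finset.sum_add_distrib]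
    refine Finset.sum_le_sum fun i _ => ?_
    by_cases hi : (i : ℕ) < m
    · simp [tailW, hi]
    · have e1 : (tailW m * lam : Fin d → ℝ) i = lam i := by simp [tailW, hi]
      rw [e1]
      have e2 : w t i * v i ≤ (|w 0 i| + 1 / 3 * |v i|) * |v i| := by
        refine (le_abs_self _).trans ?_
        rw [abs_mul]
        refine mul_le_mul_of_nonneg_right ((h.abs_coord_le hn i ht0).trans ?_) (abs_nonneg _)
        have := mul_le_mul_of_nonneg_right (hsmall i (not_lt.1 hi)) (abs_nonneg (v i))
        linarith
      have e3 : |v i| * |v i| = v i * v i := abs_mul_abs_self _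
      have e4 := mul_le_mul_of_nonneg_left e2 (hn.pos i).le
      calc lam i * w t i * v i = lam i * (w t i * v i) := by ring
        _ ≤ lam i * ((|w 0 i| + 1 / 3 * |v i|) * |v i|) := e4
        _ = lam i * |w 0 i| * |v i| + lam i * (|v i| * |v i|) * (1 / 3) := by ring
        _ = _ := by rw [e3]; ring
  refine h1.trans (add_le_add ?_ le_rfl)
  refine (le_abs_self _).trans (abs_wdot_le (tailW_mul_nonneg hn) (Real.sqrt_nonneg _)
    (Real.sqrt_nonneg _) ?_ ?_)
  · rw [Real.sq_sqrt (by positivity)]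
    have hw := h.norm_le
    refine le_trans ?_ (mul_le_mul_of_nonneg_right hw (Real.rpow_nonneg hm0.le _))
    rw [wdot, wdot, Finset.sum_mul]
    refine Finset.sum_le_sum fun i _ => ?_
    rw [mul_assoc, abs_mul_abs_self]
    by_cases hi : (i : ℕ) < m
    · have : (tailW m * lam : Fin d → ℝ) i = 0 := by simp [tailW, hi]
      rw [this, zero_mul]
      simp only [Pi.one_apply, one_mul]
      exact mul_nonneg (mul_self_nonneg _) (Real.rpow_nonneg hm0.le _)
    · have e1 : (tailW m * lam : Fin d → ℝ) i = lam i := by simp [tailW, hi]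
      rw [e1]
      simp only [Pi.one_apply, one_mul]
      rw [mul_comm]
      exact mul_le_mul_of_nonneg_left (hlam i (not_lt.1 hi)) (mul_self_nonneg _)
  · rw [Real.sq_sqrt (by positivity)]
    have : wdot (tailW m * lam) (fun i => |v i|) (fun i => |v i|) = tailMass lam v m := by
      simp only [tailMass, wdot, mul_assoc, abs_mul_abs_self]
    rw [this]
    exact hr.tail_le m (by omega)

/-- A student which is close to the teacher has a large overlap with it on the leading coordinates,
since there the `Q`-distance controls the Euclidean one. -/
lemma IsLate.le_wdot_head (h : IsLate N lam v w) (hr : IsRegular a M l₀ lam v) (ha : 1 < a)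
    (hN : 0 ≤ N) (hM : 0 < M) (hl₀ : 0 < l₀) {q n : ℕ} (hq : 1 ≤ q) (hn1 : 1 ≤ n)
    (hq' : (2 * N + 65 * M) / l₀ * (q : ℝ) ^ (1 - a) ≤ 1 / (2 * M))
    (hMn : M ≤ n) (hnd : n ≤ d) {m : ℕ} (hm1 : 1 ≤ m) (hnm : n ≤ m) {t : ℝ}
    (ht : ((q * n : ℕ) : ℝ) ^ a ≤ t) :
    n / (4 * M) - √N * √(M * m) ≤ wdot (headW m) (w t) v := by
  have hnn := hr.toIsNormalized
  have hn0 : (0 : ℝ) < n := by exact_mod_cast hn1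
  have hq0 : (0 : ℝ) < q := by exact_mod_cast hq
  have ht0 : 0 ≤ t := le_trans (Real.rpow_nonneg (Nat.cast_nonneg _) _) ht
  have hL := h.loss_le_rpow hr hN (Nat.mul_pos hq hn1) ht
  obtain ⟨-, -, -, -, hd, -⟩ := bounds_of_lossUS_le hnn (h.loss ht0) (h.corr hnn ht0)
  have hna := Real.rpow_pos_of_pos hn0 a
  have h1 : wdot (headW n) (w t - v) (w t - v) ≤ (n : ℝ) ^ a / l₀ * qdist lam v (w t) := by
    rw [qdist_eq hnn, wdot, wdot, Finset.mul_sum]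
    refine Finset.sum_le_sum fun i _ => ?_
    have e0 := mul_self_nonneg ((w t - v) i)
    rw [mul_assoc, mul_assoc (lam i), ← mul_assoc _ (lam i)]
    refine mul_le_mul_of_nonneg_right ?_ e0
    by_cases hi : (i : ℕ) < n
    · have e1 : (headW n : Fin d → ℝ) i = 1 := by simp [headW, hi]
      have e2 := hr.le_lam i
      have e3 : (n : ℝ) ^ (-a) ≤ (((i : ℕ) : ℝ) + 1) ^ (-a) :=
        Real.rpow_le_rpow_of_nonpos (by positivity) (by exact_mod_cast hi) (by linarith)
      have e4 : l₀ * (n : ℝ) ^ (-a) ≤ lam i := (mul_le_mul_of_nonneg_left e3 hl₀.le).trans e2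
      rw [e1, div_mul_eq_mul_div, le_div_iff₀ hl₀, one_mul]
      calc l₀ = (n : ℝ) ^ a * (l₀ * (n : ℝ) ^ (-a)) := by
            rw [Real.rpow_neg hn0.le]; field_simp
        _ ≤ _ := mul_le_mul_of_nonneg_left e4 hna.le
    · have e1 : (headW n : Fin d → ℝ) i = 0 := by simp [headW, hi]
      rw [e1]
      have := hnn.pos i
      positivity
  have h2 : (n : ℝ) ^ a / l₀ * qdist lam v (w t) ≤ n / (2 * M) := by
    calc (n : ℝ) ^ a / l₀ * qdist lam v (w t)
        ≤ (n : ℝ) ^ a / l₀ * ((2 * N + 65 * M) * ((q * n : ℕ) : ℝ) ^ (1 - a)) :=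
          mul_le_mul_of_nonneg_left (hd.trans hL) (by positivity)
      _ = (2 * N + 65 * M) / l₀ * (q : ℝ) ^ (1 - a) * ((n : ℝ) ^ (1 - a) * (n : ℝ) ^ a) := by
          rw [rpow_mul_nat]; ring
      _ ≤ 1 / (2 * M) * n := by
          rw [rpow_one_sub_mul_rpow hn0]
          exact mul_le_mul_of_nonneg_right hq' hn0.le
      _ = _ := by ring
  have h3 := hr.le_head n hMn hnd
  have h4 : wdot (headW n) v v / 2 - wdot (headW n) (w t - v) (w t - v) / 2 ≤
      wdot (headW n) (w t) v := by
    have := wdot_self_nonneg (ψ := (headW n : Fin d → ℝ)) headW_nonneg (w t)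
    simp only [wdot_sub_left, wdot_sub_right, wdot_comm (headW n) v (w t)] at *
    linarith
  have h5 : wdot (headW n) (w t) v - wdot (headW m) (fun i => |w 0 i|) (fun i => |v i|) ≤
      wdot (headW m) (w t) v := by
    rw [wdot, wdot, wdot, ← Finset.sum_sub_distrib]
    refine Finset.sum_le_sum fun i _ => ?_
    have e1 := h.neg_le_coord hnn i ht0
    rw [abs_mul] at e1
    by_cases hi : (i : ℕ) < n
    · have hi' : (i : ℕ) < m := hi.trans_le hnm
      simp only [headW, hi, hi', if_true, one_mul]
      have := mul_nonneg (abs_nonneg (w 0 i)) (abs_nonneg (v i))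
      linarith
    · by_cases hi' : (i : ℕ) < m
      · simp only [headW, hi, hi', if_true, if_false, one_mul, zero_mul]
        linarith
      · simp [headW, hi, hi']
  have h6 : wdot (headW m) (fun i => |w 0 i|) (fun i => |v i|) ≤ √N * √(M * m) := by
    refine (le_abs_self _).trans (abs_wdot_le headW_nonneg (Real.sqrt_nonneg _)
      (Real.sqrt_nonneg _) ?_ ?_)
    · rw [Real.sq_sqrt hN]
      refine le_trans ?_ h.norm_le
      refine (wdot_self_mono headW_le_one _).trans (le_of_eq ?_)
      simp only [wdot, mul_assoc, abs_mul_abs_self, Pi.one_apply]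
    · rw [Real.sq_sqrt (by positivity)]
      refine le_trans (le_of_eq ?_) (hr.head_le m hm1)
      simp only [wdot, mul_assoc, abs_mul_abs_self]
  have e : (n : ℝ) / (4 * M) = (n / M) / 2 - n / (2 * M) / 2 := by field_simp; norm_num
  rw [e]
  linarith

/-- The squared norm cannot stay above `1` for a long time: this would make `⟨w, v⟩` decrease on the
first coordinates, whereas learning further coordinates of the teacher makes it large. -/
lemma IsLate.not_forall_lt_qnorm (h : IsLate N lam v w) (hr : IsRegular a M l₀ lam v) (ha : 1 < a)
    (hN : 0 ≤ N) (hM : 0 < M) (hl₀ : 0 < l₀) {q B k : ℕ} (hq : 1 ≤ q) (hB1 : 1 ≤ B) (hk : 1 ≤ k)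
    (hq' : (2 * N + 65 * M) / l₀ * (q : ℝ) ^ (1 - a) ≤ 1 / (2 * M)) (hMB : M ≤ B)
    (hB : 4 * M * ((11 * √N + √(4 * N + 132 * M)) * √(27 * M * q)) < √B)
    (hd : B * k ≤ d) :
    ¬ ∀ t ∈ Icc ((k : ℝ) ^ a) (((q * B * k : ℕ) : ℝ) ^ a), 1 < qnorm lam (w t) := by
  intro hs
  have hn := hr.toIsNormalized
  have hk0 : (0 : ℝ) < k := by exact_mod_cast hk
  have hk1 : (1 : ℝ) ≤ k := by exact_mod_cast hk
  have hB0 : (0 : ℝ) < B := by exact_mod_cast hB1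
  have hq0 : (0 : ℝ) < q := by exact_mod_cast hq
  have hqB : 1 ≤ q * B := Nat.mul_pos hq hB1
  set j := q * B * k with hj
  have hj1 : 1 ≤ j := Nat.mul_pos hqB hk
  have hkj : k ≤ j := Nat.le_mul_of_pos_left k hqB
  have hj0 : (0 : ℝ) < j := by exact_mod_cast hj1
  set m := 27 * j with hm
  have hm1 : 1 ≤ m := by omega
  have hm0 : (0 : ℝ) < m := by exact_mod_cast hm1
  have hka := Real.rpow_pos_of_pos hk0 a
  have hle : (k : ℝ) ^ a ≤ (j : ℝ) ^ a :=
    Real.rpow_le_rpow hk0.le (by exact_mod_cast hkj) (by linarith)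
  set e := √(N * (m : ℝ) ^ (-a)) * √(M * (m : ℝ) ^ (1 - a)) with he
  have he0 : 0 ≤ e := by positivity
  have hem : e * (j : ℝ) ^ a ≤ √N * √(M * m) := by
    have h1 : (j : ℝ) ^ a ≤ (m : ℝ) ^ a :=
      Real.rpow_le_rpow hj0.le (by rw [hm]; push_cast; linarith) (by linarith)
    refine (mul_le_mul_of_nonneg_left h1 he0).trans ?_
    rw [← Real.sqrt_mul hN]
    refine Real.le_sqrt_of_sq_le (le_of_eq ?_)
    have e1 : (m : ℝ) ^ (-a) * (m : ℝ) ^ a = 1 := by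
      rw [← Real.rpow_add hm0, neg_add_cancel, Real.rpow_zero]
    have e2 := rpow_one_sub_mul_rpow hm0 a
    rw [he, mul_pow, mul_pow, Real.sq_sqrt (by positivity), Real.sq_sqrt (by positivity)]
    calc N * (m : ℝ) ^ (-a) * (M * (m : ℝ) ^ (1 - a)) * ((m : ℝ) ^ a) ^ 2
        = N * M * ((m : ℝ) ^ (-a) * (m : ℝ) ^ a) * ((m : ℝ) ^ (1 - a) * (m : ℝ) ^ a) := by ring
      _ = N * (M * m) := by rw [e1, e2]; ring
  have hc := h.cont
  have key := le_of_hasDerivAt_nonneg (f := fun t => 10 * e * t - wdot (headW m) (w t) v)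
    (f' := fun t => 10 * e * 1 - (12 * PhaseRetrieval.corr lam v (w t) * (1 - qnorm lam (w t))
      - tailDrift lam v m (w t))) hle (by fun_prop) ?_ ?_
  · have h1 := h.le_wdot_head hr ha hN hM hl₀ hq (n := B * k) (Nat.mul_pos hB1 hk) hq'
      (by push_cast; nlinarith) hd hm1 (m := m) (by
        rw [hm, hj, mul_assoc q]
        exact (Nat.le_mul_of_pos_left _ hq).trans (Nat.le_mul_of_pos_left _ (by norm_num)))
      (t := (j : ℝ) ^ a) (by rw [← mul_assoc])
    have h2 := (abs_le.1 (abs_head_le hr hM.le hm1 (by positivity)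
      (h.norm_sq_le_mul hr hN hM.le hk hka.le le_rfl))).2
    have h3 : √(M * m) = √(27 * M * q) * √B * √k := by
      rw [← Real.sqrt_mul (by positivity), ← Real.sqrt_mul (by positivity)]
      congr 1
      rw [hm, hj]; push_cast; ring
    have h4 : √((4 * N + 132 * M) * k) = √(4 * N + 132 * M) * √k :=
      Real.sqrt_mul (by positivity) _
    have h5 : √(k : ℝ) * √k = k := Real.mul_self_sqrt hk0.le
    have h6 : √(B : ℝ) * √B = B := Real.mul_self_sqrt hB0.le
    have h7 : 1 ≤ √(k : ℝ) := Real.one_le_sqrt.2 hk1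
    have h8 : 0 < √(B : ℝ) := Real.sqrt_pos.2 hB0
    rw [h4] at h2
    have h9 : 10 * e * (j : ℝ) ^ a ≤ 10 * (√N * √(M * m)) := by linarith
    have h10 : 0 ≤ 10 * e * (k : ℝ) ^ a := by positivity
    have h11 : ((B * k : ℕ) : ℝ) / (4 * M) ≤ 11 * √N * √(M * m)
        + √(4 * N + 132 * M) * √k * √(M * m) := by linarith
    have h12 : 11 * √N * √(M * m) ≤ 11 * √N * √(M * m) * √k :=
      le_mul_of_one_le_right (by positivity) h7
    have h13 : ((B * k : ℕ) : ℝ) / (4 * M) ≤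
        (11 * √N + √(4 * N + 132 * M)) * √(27 * M * q) * √B * k := by
      refine h11.trans ((add_le_add h12 le_rfl).trans (le_of_eq ?_))
      rw [h3]
      calc _ = (11 * √N + √(4 * N + 132 * M)) * √(27 * M * q) * √B * (√(k : ℝ) * √k) := by ring
        _ = _ := by rw [h5]
    rw [div_le_iff₀ (by positivity)] at h13
    push_cast at h13
    have h14 : (B : ℝ) * k = √B * √B * k := by rw [h6]
    rw [h14] at h13
    have h15 := mul_lt_mul_of_pos_right hB (mul_pos h8 hk0)
    linarith
  · intro t ht
    have ht0 : 0 < t := hka.trans ht.1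
    exact ((hasDerivAt_id t).const_mul _).sub (h.hasDerivAt_head hn ht0)
  · intro t ht
    have ht0 : 0 ≤ t := hka.le.trans ht.1.le
    have hst := hs t ⟨ht.1.le, ht.2.le⟩
    obtain ⟨h1, h2, h3, h4, -, -⟩ := bounds_of_lossUS_le hn (h.loss ht0) (h.corr hn ht0)
    have h5 := h.tail_corr_le hr ha hN hM.le hj1 ht0 ht.2.le
    rw [← hm, ← he] at h5
    have hτ := tailMass_nonneg hn (k := m)
    have h6 : 12 * PhaseRetrieval.corr lam v (w t) * (1 - qnorm lam (w t)) ≤ 0 :=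
      mul_nonpos_of_nonneg_of_nonpos (by linarith) (by linarith)
    have h7 : (12 * qnorm lam (w t) - 4) * wdot (tailW m * lam) (w t) v ≤
        (12 * qnorm lam (w t) - 4) * (e + tailMass lam v m / 3) :=
      mul_le_mul_of_nonneg_left h5 (by linarith)
    have h8 : (12 * qnorm lam (w t) - 4) * (e + tailMass lam v m / 3) ≤
        10 * (e + tailMass lam v m / 3) :=
      mul_le_mul_of_nonneg_right (by linarith) (by positivity)
    have h9 : 8 * (7 / 8) * tailMass lam v m ≤
        8 * PhaseRetrieval.corr lam v (w t) * tailMass lam v m :=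
      mul_le_mul_of_nonneg_right (by linarith) hτ
    unfold tailDrift
    linarith

/-- In the basin, accuracy of order `k^{1-a}` is reached by a time of order `k^a`. -/
theorem IsLate.exists_isAccurate (h : IsLate N lam v w) (hr : IsRegular a M l₀ lam v) (ha : 1 < a)
    (hN : 0 ≤ N) (hM : 0 < M) (hl₀ : 0 < l₀) {q B k : ℕ} (hq : 1 ≤ q) (hB1 : 2 ≤ B) (hk : 1 ≤ k)
    (hq' : (2 * N + 65 * M) / l₀ * (q : ℝ) ^ (1 - a) ≤ 1 / (2 * M)) (hMB : M ≤ B)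
    (hB : 4 * M * ((11 * √N + √(4 * N + 132 * M)) * √(27 * M * q)) < √B)
    (hd : B * k ≤ d) :
    ∃ t ∈ Icc (0 : ℝ) (((q * B * k : ℕ) : ℝ) ^ a),
      IsAccurate (100 * (2 * N + 65 * M) * (k : ℝ) ^ (1 - a)) lam v (w t) := by
  have hn := hr.toIsNormalized
  set ε := 100 * (2 * N + 65 * M) * (k : ℝ) ^ (1 - a) with hε
  have hk0 : (0 : ℝ) < k := by exact_mod_cast hk
  have hka := Real.rpow_pos_of_pos hk0 a
  have hk1a := Real.rpow_pos_of_pos hk0 (1 - a)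
  have hε0 : 0 ≤ ε := by positivity
  have hqB : 2 ≤ q * B := hB1.trans (Nat.le_mul_of_pos_left _ hq)
  have hle : (k : ℝ) ^ a ≤ ((q * B * k : ℕ) : ℝ) ^ a :=
    Real.rpow_le_rpow hk0.le
      (by exact_mod_cast Nat.le_mul_of_pos_left k (by omega)) (by linarith)
  have hc := h.cont
  by_contra! hcon
  have hno : ∀ t ∈ Icc ((k : ℝ) ^ a) (((q * B * k : ℕ) : ℝ) ^ a),
      ¬ qnorm lam (w t) ∈ Icc (1 - ε) 1 := by
    intro t ht hs
    have ht0 : 0 ≤ t := hka.le.trans ht.1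
    refine hcon t ⟨ht0, ht.2⟩ (isAccurate_of_qnorm_mem hn (h.loss ht0) (h.corr hn ht0) ?_ hs)
    refine (h.loss_le_rpow hr hN hk ht.1).trans ?_
    rw [hε]
    exact mul_le_mul_of_nonneg_right (by linarith) hk1a.le
  -- In particular `s ≠ 1` throughout, so that `s` stays on one side of `1`.
  have hne : ∀ t ∈ Icc ((k : ℝ) ^ a) (((q * B * k : ℕ) : ℝ) ^ a), qnorm lam (w t) ≠ 1 :=
    fun t ht hs => hno t ht (by rw [hs]; exact ⟨by linarith, le_rfl⟩)
  have hcs : ContinuousOn (fun t => qnorm lam (w t))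
      (Icc ((k : ℝ) ^ a) (((q * B * k : ℕ) : ℝ) ^ a)) := (continuous_qnorm hc).continuousOn
  rcases lt_or_gt_of_ne (hne _ (left_mem_Icc.2 hle)) with h0 | h0
  · refine h.not_forall_qnorm_lt hr ha hN hM hk hqB fun t ht => ?_
    have h1 : qnorm lam (w t) < 1 := by
      by_contra! hge
      obtain ⟨r, hr', hr1⟩ := intermediate_value_Icc ht.1
        (hcs.mono (Icc_subset_Icc le_rfl ht.2)) ⟨h0.le, hge⟩
      exact hne r ⟨hr'.1, hr'.2.trans ht.2⟩ hr1
    by_contra! hge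
    exact hno t ht ⟨hge, h1.le⟩
  · refine h.not_forall_lt_qnorm hr ha hN hM hl₀ hq (by omega) hk hq' hMB hB hd fun t ht => ?_
    by_contra! hge
    obtain ⟨r, hr', hr1⟩ := intermediate_value_Icc' ht.1
      (hcs.mono (Icc_subset_Icc le_rfl ht.2)) ⟨hge, h0.le⟩
    exact hne r ⟨hr'.1, hr'.2.trans ht.2⟩ hr1

end accurate

/-! ### The unstable mode at the origin -/

/-- Weights `λᵢ / (ρ - 4 λᵢ)`; the vector with coordinates `λᵢ vᵢ / (ρ - 4 λᵢ)` is the eigenvector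
for the eigenvalue `ρ` of the linearisation at the origin. -/
noncomputable def modeW {d : ℕ} (ρ : ℝ) (lam : Fin d → ℝ) : Fin d → ℝ :=
  fun i => lam i / (ρ - 4 * lam i)

/-- `ρ` is the eigenvalue beyond `4 λ₁` of the linearisation `4 Q + 8 Q v vᵀ Q` of the flow at the
origin, and `i₀` is a coordinate of maximal `λ`. -/
structure IsMode {d : ℕ} (lam v : Fin d → ℝ) (i₀ : Fin d) (ρ : ℝ) : Prop where
  top : ∀ i, lam i ≤ lam i₀
  lt : 4 * lam i₀ < ρ
  eqn : wdot (modeW ρ lam * lam) v v = 1 / 8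

/-- The linearisation of the flow at the origin. -/
noncomputable def linPart {d : ℕ} (lam v x : Fin d → ℝ) : Fin d → ℝ :=
  fun i => lam i * (4 * x i + 8 * corr lam v x * v i)

/-- The quadratic form of the linearisation at the origin. -/
noncomputable def linForm {d : ℕ} (lam v x : Fin d → ℝ) : ℝ :=
  4 * qnorm lam x + 8 * corr lam v x ^ 2

/-- The component of `x` along the unstable eigenvector, up to normalisation. -/
noncomputable def modeCoord {d : ℕ} (ρ : ℝ) (lam v x : Fin d → ℝ) : ℝ := wdot (modeW ρ lam) x v

/-- The squared norm of the unstable eigenvector. -/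
noncomputable def modeNorm {d : ℕ} (ρ : ℝ) (lam v : Fin d → ℝ) : ℝ :=
  wdot 1 (modeW ρ lam * v) (modeW ρ lam * v)

/-- The part of `x` orthogonal to the unstable eigenvector. -/
noncomputable def modeResidual {d : ℕ} (ρ : ℝ) (lam v x : Fin d → ℝ) : Fin d → ℝ :=
  x - (modeCoord ρ lam v x / modeNorm ρ lam v) • (modeW ρ lam * v)

section mode
variable {d : ℕ} {lam v : Fin d → ℝ} {w : ℝ → Fin d → ℝ} {i₀ : Fin d} {ρ : ℝ}

lemma IsMode.sub_pos (hm : IsMode lam v i₀ ρ) (i : Fin d) : 0 < ρ - 4 * lam i := by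
  have := hm.top i; have := hm.lt; linarith

lemma IsMode.gap_le (hm : IsMode lam v i₀ ρ) (i : Fin d) : ρ - 4 * lam i₀ ≤ ρ - 4 * lam i := by
  have := hm.top i; linarith

lemma IsMode.modeW_mul (hm : IsMode lam v i₀ ρ) (i : Fin d) :
    modeW ρ lam i * (ρ - 4 * lam i) = lam i := div_mul_cancel₀ _ (hm.sub_pos i).ne'

lemma IsMode.modeW_pos (hm : IsMode lam v i₀ ρ) (hn : IsNormalized lam v) (i : Fin d) :
    0 < modeW ρ lam i := div_pos (hn.pos i) (hm.sub_pos i)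

lemma IsMode.four_mul_wdot (hm : IsMode lam v i₀ ρ) (x y : Fin d → ℝ) :
    4 * wdot (modeW ρ lam * lam) x y = ρ * wdot (modeW ρ lam) x y - wdot lam x y := by
  simp only [wdot, Finset.mul_sum, ← Finset.sum_sub_distrib, Pi.mul_apply]
  refine Finset.sum_congr rfl fun i _ => ?_
  have := hm.modeW_mul i
  linear_combination (-x i * y i) * this

lemma IsMode.rho_pos (hm : IsMode lam v i₀ ρ) (hn : IsNormalized lam v) : 0 < ρ := by
  have := hn.pos i₀; have := hm.lt; linarith

/-- The gap is bounded below by the contribution of the coordinate `i₀` to the secular equation. -/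
lemma IsMode.gap_ge (hm : IsMode lam v i₀ ρ) (hn : IsNormalized lam v) :
    8 * (lam i₀ ^ 2 * v i₀ ^ 2) ≤ ρ - 4 * lam i₀ := by
  have h1 : (modeW ρ lam * lam) i₀ * v i₀ * v i₀ ≤ 1 / 8 := by
    rw [← hm.eqn]
    refine Finset.single_le_sum (f := fun i => (modeW ρ lam * lam) i * v i * v i)
      (fun i _ => ?_) (Finset.mem_univ i₀)
    rw [mul_assoc]
    exact mul_nonneg (mul_nonneg (hm.modeW_pos hn i).le (hn.pos i).le) (mul_self_nonneg _)
  have h2 := hm.modeW_mul i₀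
  have h3 := hm.sub_pos i₀
  have h4 := mul_le_mul_of_nonneg_right h1 h3.le
  have h5 : (modeW ρ lam * lam) i₀ * v i₀ * v i₀ * (ρ - 4 * lam i₀) =
      modeW ρ lam i₀ * (ρ - 4 * lam i₀) * lam i₀ * v i₀ ^ 2 := by
    simp only [Pi.mul_apply]; ring
  rw [h5, h2] at h4
  nlinarith

lemma IsMode.gap_le_eight (hm : IsMode lam v i₀ ρ) (hn : IsNormalized lam v) :
    ρ - 4 * lam i₀ ≤ 8 * lam i₀ := by
  have h1 : (ρ - 4 * lam i₀) * wdot (modeW ρ lam * lam) v v ≤ lam i₀ * wdot lam v v := by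
    simp only [wdot, Finset.mul_sum, Pi.mul_apply]
    refine Finset.sum_le_sum fun i _ => ?_
    have e1 := hm.modeW_mul i
    have e2 := hm.modeW_pos hn i
    have e3 := mul_le_mul_of_nonneg_left (hm.gap_le i) e2.le
    have e4 : (ρ - 4 * lam i₀) * modeW ρ lam i ≤ lam i := by linarith
    have e5 : (ρ - 4 * lam i₀) * modeW ρ lam i * lam i ≤ lam i * lam i₀ :=
      mul_le_mul e4 (hm.top i) (hn.pos i).le (hn.pos i).le
    have e6 := mul_le_mul_of_nonneg_right e5 (mul_self_nonneg (v i))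
    calc _ = (ρ - 4 * lam i₀) * modeW ρ lam i * lam i * (v i * v i) := by ring
      _ ≤ _ := e6
      _ = _ := by ring
  rw [hm.eqn, hn.norm] at h1
  linarith

lemma IsMode.rho_le (hm : IsMode lam v i₀ ρ) (hn : IsNormalized lam v) : ρ ≤ 12 := by
  have := hm.gap_le_eight hn; have := hn.le_one i₀; linarith

lemma wdot_one_mode (ψ x y : Fin d → ℝ) : wdot 1 x (ψ * y) = wdot ψ x y := by
  simp only [wdot, Pi.one_apply, Pi.mul_apply]
  exact Finset.sum_congr rfl fun _ _ => by ring

lemma IsMode.modeNorm_ge (hm : IsMode lam v i₀ ρ) (hn : IsNormalized lam v) :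
    1 / 96 ≤ modeNorm ρ lam v := by
  have h1 : wdot (modeW ρ lam * lam) v v ≤ 12 * modeNorm ρ lam v := by
    simp only [modeNorm, wdot, Finset.mul_sum, Pi.mul_apply, Pi.one_apply]
    refine Finset.sum_le_sum fun i _ => ?_
    have e1 := hm.modeW_mul i
    have e2 := hm.modeW_pos hn i
    have e3 := hm.rho_le hn
    have e4 := hn.pos i
    have e5 : lam i ≤ 12 * modeW ρ lam i := by nlinarith
    have e6 := mul_le_mul_of_nonneg_left e5 (mul_nonneg e2.le (mul_self_nonneg (v i)))
    calc _ = modeW ρ lam i * (v i * v i) * lam i := by ring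
      _ ≤ _ := e6
      _ = _ := by ring
  rw [hm.eqn] at h1
  linarith

lemma wdot_mul_self_sq_le (hn : IsNormalized lam v) (x y : Fin d → ℝ) :
    wdot (lam * lam) x y ^ 2 ≤ qnorm lam x * qnorm lam y := by
  refine (wdot_sq_le (fun i => mul_self_nonneg (lam i)) x y).trans ?_
  have h : ∀ i, (lam * lam) i ≤ lam i := fun i =>
    mul_le_of_le_one_right (hn.pos i).le (hn.le_one i)
  exact mul_le_mul (wdot_self_mono h x) (wdot_self_mono h y)
    (wdot_self_nonneg (fun i => mul_self_nonneg (lam i)) y) (qnorm_nonneg hn x)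

lemma wdot_linPart (ψ x y : Fin d → ℝ) : wdot ψ (linPart lam v x) y =
    4 * wdot (ψ * lam) x y + 8 * corr lam v x * wdot (ψ * lam) v y := by
  unfold linPart
  generalize corr lam v x = u
  simp only [wdot, Finset.mul_sum, ← Finset.sum_add_distrib, Pi.mul_apply]
  exact Finset.sum_congr rfl fun _ _ => by ring

lemma IsMode.modeCoord_linPart (hm : IsMode lam v i₀ ρ) (x : Fin d → ℝ) :
    modeCoord ρ lam v (linPart lam v x) = ρ * modeCoord ρ lam v x := by
  rw [modeCoord, wdot_linPart, hm.four_mul_wdot, hm.eqn, corr, modeCoord]; ring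

/-- On the orthogonal complement of the unstable eigenvector the quadratic form of the
linearisation is at most `4 λ₁`. -/
lemma IsMode.linForm_le (hm : IsMode lam v i₀ ρ) (hn : IsNormalized lam v) {x : Fin d → ℝ}
    (hx : modeCoord ρ lam v x = 0) : linForm lam v x ≤ 4 * lam i₀ * wdot 1 x x := by
  have hu : corr lam v x = ∑ i, 4 * (modeW ρ lam i * (lam i₀ - lam i)) * x i * v i := by
    have h1 : corr lam v x = corr lam v x - (ρ - 4 * lam i₀) * modeCoord ρ lam v x := by
      rw [hx]; ring
    rw [h1]
    simp only [corr, modeCoord, wdot, Finset.mul_sum, ← Finset.sum_sub_distrib]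
    refine Finset.sum_congr rfl fun i _ => ?_
    linear_combination (-x i * v i) * hm.modeW_mul i
  have hcs : corr lam v x ^ 2 ≤ (∑ i, (lam i₀ - lam i) * x i ^ 2) *
      ∑ i, 16 * modeW ρ lam i ^ 2 * (lam i₀ - lam i) * v i ^ 2 := by
    rw [hu]
    refine Finset.sum_sq_le_sum_mul_sum_of_sq_le_mul _ (fun i _ => ?_) (fun i _ => ?_)
      fun i _ => le_of_eq (by ring)
    · have := hm.top i; exact mul_nonneg (by linarith) (sq_nonneg _)
    · have := hm.top i
      exact mul_nonneg (mul_nonneg (by positivity) (by linarith)) (sq_nonneg _)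
  have h2 : ∑ i, 16 * modeW ρ lam i ^ 2 * (lam i₀ - lam i) * v i ^ 2 ≤ 1 / 2 := by
    have : (1 : ℝ) / 2 = ∑ i, 4 * ((modeW ρ lam * lam) i * v i * v i) := by
      rw [← Finset.mul_sum]
      have := hm.eqn
      rw [wdot] at this
      rw [this]; norm_num
    rw [this]
    refine Finset.sum_le_sum fun i _ => ?_
    have e1 := hm.modeW_mul i
    have e2 := hm.modeW_pos hn i
    have e3 : modeW ρ lam i * (4 * (lam i₀ - lam i)) ≤ lam i := by
      rw [← e1]; exact mul_le_mul_of_nonneg_left (by have := hm.lt; linarith) e2.le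
    have e4 := mul_le_mul_of_nonneg_left e3 (mul_nonneg e2.le (sq_nonneg (v i)))
    simp only [Pi.mul_apply]
    nlinarith
  have h3 : 0 ≤ ∑ i, (lam i₀ - lam i) * x i ^ 2 :=
    Finset.sum_nonneg fun i _ => mul_nonneg (by have := hm.top i; linarith) (sq_nonneg _)
  have h4 : ∑ i, (lam i₀ - lam i) * x i ^ 2 = lam i₀ * wdot 1 x x - qnorm lam x := by
    simp only [qnorm, wdot, Finset.mul_sum, ← Finset.sum_sub_distrib, Pi.one_apply]
    exact Finset.sum_congr rfl fun _ _ => by ring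
  have h5 : corr lam v x ^ 2 ≤ (∑ i, (lam i₀ - lam i) * x i ^ 2) * (1 / 2) :=
    hcs.trans (mul_le_mul_of_nonneg_left h2 h3)
  rw [linForm]
  linarith

/-- On the orthogonal complement of the unstable eigenvector the linearisation is at most `4 λ₁`,
in the form in which it enters the evolution of its quadratic form. -/
lemma IsMode.linPart_sq_le (hm : IsMode lam v i₀ ρ) (hn : IsNormalized lam v) {x : Fin d → ℝ}
    (hx : modeCoord ρ lam v x = 0) :
    wdot 1 (linPart lam v x) (linPart lam v x) ≤ 4 * lam i₀ * linForm lam v x := by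
  have hl := hn.pos i₀
  set y := linPart lam v x with hy
  have h1 := hm.linForm_le hn (x := y) (by rw [hy, hm.modeCoord_linPart, hx, mul_zero])
  -- Nonnegativity of the form at `4 λ₁ x - H x`.
  have h2 : 0 ≤ linForm lam v ((4 * lam i₀) • x - y) := by
    rw [linForm]
    have := qnorm_nonneg hn ((4 * lam i₀) • x - y)
    positivity
  have h3 : linForm lam v ((4 * lam i₀) • x - y) = (4 * lam i₀) ^ 2 * linForm lam v x
      - 2 * (4 * lam i₀) * wdot 1 y y + linForm lam v y := by
    have e : wdot 1 y y = 4 * wdot lam x y + 8 * corr lam v x * wdot lam v y := by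
      conv_lhs => rw [hy]
      rw [wdot_linPart, one_mul, ← hy]
    rw [e]
    simp only [linForm, qnorm, corr, wdot_sub_left, wdot_sub_right, wdot_smul_left,
      wdot_smul_right, wdot_comm lam y x, wdot_comm lam v y]
    ring
  rw [h3] at h2
  refine le_of_mul_le_mul_left ?_ hl
  nlinarith

lemma IsMode.modeCoord_residual (hm : IsMode lam v i₀ ρ) (hn : IsNormalized lam v)
    (x : Fin d → ℝ) : modeCoord ρ lam v (modeResidual ρ lam v x) = 0 := by
  have h := hm.modeNorm_ge hn
  have e : wdot (modeW ρ lam) (modeW ρ lam * v) v = modeNorm ρ lam v := by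
    rw [modeNorm, wdot_one_mode]
  rw [modeResidual, modeCoord, wdot_sub_left, wdot_smul_left, e, modeCoord,
    div_mul_cancel₀ _ (by linarith), sub_self]

lemma IsMode.linForm_residual (hm : IsMode lam v i₀ ρ) (hn : IsNormalized lam v)
    (x : Fin d → ℝ) : linForm lam v (modeResidual ρ lam v x) =
      linForm lam v x - ρ * modeCoord ρ lam v x ^ 2 / modeNorm ρ lam v := by
  have h := hm.modeNorm_ge hn
  have hpos : modeNorm ρ lam v ≠ 0 := by linarith
  have e1 : ∀ y, 4 * wdot lam y (modeW ρ lam * v) = ρ * wdot (modeW ρ lam) y v - wdot lam y v := by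
    intro y
    rw [← hm.four_mul_wdot]
    simp only [wdot, Finset.mul_sum, Pi.mul_apply]
    exact Finset.sum_congr rfl fun _ _ => by ring
  have e2 : wdot lam (modeW ρ lam * v) v = 1 / 8 := by
    rw [← hm.eqn]
    simp only [wdot, Pi.mul_apply]
    exact Finset.sum_congr rfl fun _ _ => by ring
  have e3 : wdot (modeW ρ lam) (modeW ρ lam * v) v = modeNorm ρ lam v := by
    rw [modeNorm, wdot_one_mode]
  have e4 := e1 x
  have e5 := e1 (modeW ρ lam * v)
  rw [e2, e3] at e5
  simp only [linForm, qnorm, corr, modeResidual, wdot_sub_left, wdot_sub_right, wdot_smul_left,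
    wdot_smul_right, wdot_comm lam (modeW ρ lam * v) x, e2]
  set κ := modeCoord ρ lam v x / modeNorm ρ lam v with hκ
  have e6 : ρ * modeCoord ρ lam v x ^ 2 / modeNorm ρ lam v =
      ρ * modeCoord ρ lam v x * κ := by rw [hκ]; ring
  have e7 : κ * modeNorm ρ lam v = modeCoord ρ lam v x := div_mul_cancel₀ _ hpos
  have e8 : wdot (modeW ρ lam) x v = modeCoord ρ lam v x := rfl
  rw [e6]
  rw [e8] at e4
  linear_combination (-2 * κ) * e4 + κ ^ 2 * e5 + (ρ * κ) * e7

lemma IsMode.linPart_residual_sq (hm : IsMode lam v i₀ ρ) (hn : IsNormalized lam v)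
    (x : Fin d → ℝ) :
    wdot 1 (linPart lam v (modeResidual ρ lam v x)) (linPart lam v (modeResidual ρ lam v x)) =
      wdot 1 (linPart lam v x) (linPart lam v x)
        - ρ ^ 2 * modeCoord ρ lam v x ^ 2 / modeNorm ρ lam v := by
  have h := hm.modeNorm_ge hn
  have hpos : modeNorm ρ lam v ≠ 0 := by linarith
  set κ := modeCoord ρ lam v x / modeNorm ρ lam v with hκ
  have e2 : corr lam v (modeW ρ lam * v) = 1 / 8 := by
    rw [← hm.eqn]
    simp only [corr, wdot, Pi.mul_apply]
    exact Finset.sum_congr rfl fun _ _ => by ring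
  have e1 : linPart lam v (modeResidual ρ lam v x) =
      linPart lam v x - (κ * ρ) • (modeW ρ lam * v) := by
    ext i
    have h2 : corr lam v (modeResidual ρ lam v x) = corr lam v x - κ * (1 / 8) := by
      rw [← e2, modeResidual, corr, wdot_sub_left, wdot_smul_left]; rfl
    have h3 : modeResidual ρ lam v x i = x i - κ * (modeW ρ lam i * v i) := rfl
    change lam i * (4 * modeResidual ρ lam v x i + 8 * corr lam v (modeResidual ρ lam v x) * v i) =
      lam i * (4 * x i + 8 * corr lam v x * v i) - κ * ρ * (modeW ρ lam i * v i)
    rw [h2, h3]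
    linear_combination (κ * v i) * hm.modeW_mul i
  have e3 : wdot 1 (linPart lam v x) (modeW ρ lam * v) = ρ * modeCoord ρ lam v x := by
    rw [wdot_one_mode, ← hm.modeCoord_linPart]; rfl
  have e7 : κ * modeNorm ρ lam v = modeCoord ρ lam v x := div_mul_cancel₀ _ hpos
  have e6 : ρ ^ 2 * modeCoord ρ lam v x ^ 2 / modeNorm ρ lam v =
      ρ ^ 2 * modeCoord ρ lam v x * κ := by rw [hκ]; ring
  rw [e1, e6]
  simp only [wdot_sub_left, wdot_sub_right, wdot_smul_left, wdot_smul_right,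
    wdot_comm 1 (modeW ρ lam * v), e3]
  rw [show wdot 1 (modeW ρ lam * v) (modeW ρ lam * v) = modeNorm ρ lam v from rfl]
  linear_combination (ρ ^ 2 * κ) * e7

lemma linPart_sq (x : Fin d → ℝ) : wdot 1 (linPart lam v x) (linPart lam v x) =
    16 * wdot (lam * lam) x x + 64 * corr lam v x * wdot (lam * lam) x v
      + 64 * corr lam v x ^ 2 * wdot (lam * lam) v v := by
  unfold linPart
  generalize corr lam v x = u
  simp only [wdot, Finset.mul_sum, ← Finset.sum_add_distrib, Pi.mul_apply, Pi.one_apply]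
  exact Finset.sum_congr rfl fun _ _ => by ring

end mode

/-! ### The linear phase -/

section linear
variable {d : ℕ} {lam v : Fin d → ℝ} {w : ℝ → Fin d → ℝ} {i₀ : Fin d} {ρ : ℝ}

/-- The factor of the nonlinear correction in the evolution of the unstable coordinate is of the
order of `√s`. -/
lemma IsMode.modeCoord_sub_sq_le (hm : IsMode lam v i₀ ρ) (hn : IsNormalized lam v)
    (x : Fin d → ℝ) : (ρ * modeCoord ρ lam v x - corr lam v x) ^ 2 ≤
      2 * (qnorm lam x / (ρ - 4 * lam i₀)) := by
  have hγ := hm.sub_pos i₀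
  have e := hm.four_mul_wdot x v
  have h0 : ∀ i, 0 ≤ (modeW ρ lam * lam) i := fun i =>
    mul_nonneg (hm.modeW_pos hn i).le (hn.pos i).le
  have h1 := wdot_sq_le h0 x v
  rw [hm.eqn] at h1
  have h2 : wdot (modeW ρ lam * lam) x x ≤ qnorm lam x / (ρ - 4 * lam i₀) := by
    rw [le_div_iff₀ hγ, qnorm, wdot, wdot, Finset.sum_mul]
    refine Finset.sum_le_sum fun i _ => ?_
    have e1 := hm.modeW_mul i
    have e2 := hm.modeW_pos hn i
    have e3 := mul_le_mul_of_nonneg_left (hm.gap_le i) e2.le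
    have e4 : modeW ρ lam i * (ρ - 4 * lam i₀) ≤ 1 := by linarith [hn.le_one i]
    have e5 := mul_le_mul_of_nonneg_right e4
      (mul_nonneg (hn.pos i).le (mul_self_nonneg (x i)))
    simp only [Pi.mul_apply]
    nlinarith
  have e6 : ρ * modeCoord ρ lam v x - corr lam v x = 4 * wdot (modeW ρ lam * lam) x v := by
    rw [e]; rfl
  rw [e6]
  nlinarith

lemma IsFlow.hasDerivAt_modeCoord (h : IsFlow lam v w) (hm : IsMode lam v i₀ ρ) {t : ℝ}
    (ht : 0 < t) : HasDerivAt (fun t => modeCoord ρ lam v (w t))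
      (ρ * modeCoord ρ lam v (w t) - 3 * qnorm lam (w t) *
        (ρ * modeCoord ρ lam v (w t) - corr lam v (w t))) t := by
  refine (h.hasDerivAt_wdot ht _ _).congr_deriv ?_
  have e := hm.four_mul_wdot (w t) v
  have e2 : wdot (modeW ρ lam * lam) (w t) v =
      (ρ * modeCoord ρ lam v (w t) - corr lam v (w t)) / 4 := by
    rw [modeCoord, corr, ← e]; ring
  rw [hm.eqn, e2]
  ring

@[fun_prop]
lemma continuous_modeCoord {x : ℝ → Fin d → ℝ} (hx : Continuous x) :
    Continuous fun t => modeCoord ρ lam v (x t) := continuous_wdot _ hx continuous_const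

lemma IsFlow.qnorm_le_exp (h : IsFlow lam v w) (hn : IsNormalized lam v) {t : ℝ} (ht : 0 ≤ t) :
    qnorm lam (w t) ≤ qnorm lam (w 0) * Real.exp (24 * t) := by
  have hc := h.cont
  have key := exp_mul_le_of_hasDerivAt_ge (f := fun t => -qnorm lam (w t)) (κ := 24) ht
    (by fun_prop) (fun t ht => (h.hasDerivAt_qnorm ht.1).neg) ?_
  · rw [sub_zero] at key; linarith
  · intro t ht
    have h1 := corr_sq_le_qnorm hn (w t)
    have h2 := qnorm_nonneg hn (w t)
    have h3 := wdot_mul_self_sq_le hn (w t) v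
    rw [show qnorm lam v = 1 from hn.norm, mul_one] at h3
    have h4 : wdot (lam * lam) (w t) (w t) ≤ qnorm lam (w t) :=
      wdot_self_mono (fun i => mul_le_of_le_one_right (hn.pos i).le (hn.le_one i)) (w t)
    have h5 := wdot_self_nonneg (ψ := lam * lam) (fun i => mul_self_nonneg (lam i)) (w t)
    nlinarith [sq_nonneg (corr lam v (w t) - wdot (lam * lam) (w t) v), mul_nonneg h2 h5]

/-- While `s` is small, the unstable coordinate grows like `e^{ρ t}`. -/
lemma IsFlow.modeCoord_ge (h : IsFlow lam v w) (hn : IsNormalized lam v) (hm : IsMode lam v i₀ ρ)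
    {S t₀ : ℝ} (ht₀ : 0 ≤ t₀) (hS : ∀ t ∈ Icc 0 t₀, qnorm lam (w t) ≤ S) :
    (modeCoord ρ lam v (w 0) - 3 * S * √(2 * (S / (ρ - 4 * lam i₀))) * t₀) * Real.exp (ρ * t₀) ≤
      modeCoord ρ lam v (w t₀) := by
  have hc := h.cont
  have hγ := hm.sub_pos i₀
  have hρ := hm.rho_pos hn
  have hS0 : 0 ≤ S := (qnorm_nonneg hn _).trans (hS 0 ⟨le_rfl, ht₀⟩)
  set D := 3 * S * √(2 * (S / (ρ - 4 * lam i₀))) with hD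
  have hD0 : 0 ≤ D := by positivity
  have key := nonneg_of_hasDerivAt_ge (f := fun t => modeCoord ρ lam v (w t)
      - (modeCoord ρ lam v (w 0) - D * t) * Real.exp (ρ * t))
    (f' := fun t => (ρ * modeCoord ρ lam v (w t) - 3 * qnorm lam (w t) *
        (ρ * modeCoord ρ lam v (w t) - corr lam v (w t)))
      - ((-(D * 1)) * Real.exp (ρ * t) + (modeCoord ρ lam v (w 0) - D * t) *
        (Real.exp (ρ * t) * (ρ * 1)))) (g := fun _ => ρ) ht₀ (by fun_prop) continuous_const
    ?_ ?_ (by simp)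
  · linarith
  · intro t ht
    exact (h.hasDerivAt_modeCoord hm ht.1).sub
      ((((hasDerivAt_id t).const_mul D).const_sub _).mul (((hasDerivAt_id t).const_mul ρ).exp))
  · intro t ht
    have h1 := hS t ⟨ht.1.le, ht.2.le⟩
    have h0 := qnorm_nonneg hn (w t)
    have h2 := hm.modeCoord_sub_sq_le hn (w t)
    have h3 : |ρ * modeCoord ρ lam v (w t) - corr lam v (w t)| ≤
        √(2 * (S / (ρ - 4 * lam i₀))) := by
      refine Real.abs_le_sqrt (h2.trans ?_)
      have := div_le_div_of_nonneg_right h1 hγ.le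
      linarith
    have h4 : 3 * qnorm lam (w t) * (ρ * modeCoord ρ lam v (w t) - corr lam v (w t)) ≤ D := by
      refine (mul_le_mul_of_nonneg_left (le_abs_self _) (by positivity)).trans ?_
      exact mul_le_mul (by linarith) h3 (abs_nonneg _) (by positivity)
    have h5 : 1 ≤ Real.exp (ρ * t) := Real.one_le_exp (mul_nonneg hρ.le ht.1.le)
    have h6 := mul_le_mul_of_nonneg_left h5 hD0
    linarith

/-- While `s` is small, the part of the student orthogonal to the unstable eigenvector grows at
most like `e^{4 λ₁ t}`. -/
lemma IsFlow.linForm_residual_le (h : IsFlow lam v w) (hn : IsNormalized lam v)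
    (hm : IsMode lam v i₀ ρ) {S t₀ : ℝ} (ht₀ : 0 ≤ t₀)
    (hS : ∀ t ∈ Icc 0 t₀, qnorm lam (w t) ≤ S) :
    linForm lam v (modeResidual ρ lam v (w t₀)) ≤
      (12 * qnorm lam (w 0) + (480 + 1728 / (ρ - 4 * lam i₀)) * S ^ 2 * t₀) *
        Real.exp (8 * lam i₀ * t₀) := by
  have hc := h.cont
  have hγ := hm.sub_pos i₀
  have hρ := hm.rho_pos hn
  have hl := hn.pos i₀
  have hΦ := hm.modeNorm_ge hn
  have hΦ0 : 0 < modeNorm ρ lam v := by linarith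
  set γ := ρ - 4 * lam i₀ with hγdef
  set C := 480 + 1728 / γ with hC
  have hC0 : 0 ≤ C := by positivity
  simp only [hm.linForm_residual hn]
  set F₀ := 12 * qnorm lam (w 0) with hF₀
  have key := nonneg_of_hasDerivAt_ge (f := fun t => (F₀ + C * S ^ 2 * t) *
      Real.exp (8 * lam i₀ * t) - (linForm lam v (w t)
        - ρ * modeCoord ρ lam v (w t) ^ 2 / modeNorm ρ lam v))
    (f' := fun t => ((C * S ^ 2 * 1) * Real.exp (8 * lam i₀ * t) + (F₀ + C * S ^ 2 * t) *
        (Real.exp (8 * lam i₀ * t) * (8 * lam i₀ * 1))) -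
      ((4 * (2 * ((4 - 12 * qnorm lam (w t)) * wdot (lam * lam) (w t) (w t)
        + 8 * corr lam v (w t) * wdot (lam * lam) (w t) v))
        + 8 * (2 * corr lam v (w t) ^ (2 - 1) *
          ((4 - 12 * qnorm lam (w t)) * wdot (lam * lam) (w t) v
            + 8 * corr lam v (w t) * wdot (lam * lam) v v)))
        - (ρ * (2 * modeCoord ρ lam v (w t) ^ (2 - 1) *
          (ρ * modeCoord ρ lam v (w t) - 3 * qnorm lam (w t) *
            (ρ * modeCoord ρ lam v (w t) - corr lam v (w t))))) / modeNorm ρ lam v))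
    (g := fun _ => 8 * lam i₀) ht₀ (by unfold linForm; fun_prop) continuous_const ?_ ?_ ?_
  · linarith
  · intro t ht
    refine ((((hasDerivAt_id t).const_mul (C * S ^ 2)).const_add F₀).mul
      (((hasDerivAt_id t).const_mul (8 * lam i₀)).exp)).sub ?_
    refine HasDerivAt.sub ?_ ?_
    · exact ((h.hasDerivAt_qnorm ht.1).const_mul 4).add
        (by simpa using ((h.hasDerivAt_corr ht.1).pow 2).const_mul 8)
    · have := (((h.hasDerivAt_modeCoord hm ht.1).pow 2).const_mul ρ).div_const (modeNorm ρ lam v)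
      simpa using this
  · intro t ht
    have hst := hS t ⟨ht.1.le, ht.2.le⟩
    have h0 := qnorm_nonneg hn (w t)
    have h1 := corr_sq_le_qnorm hn (w t)
    have h3 := wdot_mul_self_sq_le hn (w t) v
    rw [show qnorm lam v = 1 from hn.norm, mul_one] at h3
    have h4 := wdot_self_nonneg (ψ := lam * lam) (fun i => mul_self_nonneg (lam i)) (w t)
    have h5 := hm.linPart_sq_le hn (hm.modeCoord_residual hn (w t))
    rw [hm.linPart_residual_sq hn, hm.linForm_residual hn, linPart_sq] at h5
    have h6 := hm.modeCoord_sub_sq_le hn (w t)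
    rw [← hγdef] at h6
    have h7 : 1 ≤ Real.exp (8 * lam i₀ * t) :=
      Real.one_le_exp (mul_nonneg (by positivity) ht.1.le)
    have h8 := mul_le_mul_of_nonneg_left h7 (mul_nonneg hC0 (sq_nonneg S))
    set s := qnorm lam (w t)
    set u := corr lam v (w t)
    set l := modeCoord ρ lam v (w t)
    set Φ := modeNorm ρ lam v
    set m₂ := wdot (lam * lam) (w t) (w t)
    set c₂ := wdot (lam * lam) (w t) v
    set n₂ := wdot (lam * lam) v v
    set e := ρ * l - u with he
    have h9 : -(192 * (s * (u * c₂))) ≤ 192 * s ^ 2 := by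
      have : -(u * c₂) ≤ s := by nlinarith [sq_nonneg (u + c₂)]
      nlinarith
    have h10 : 6 * s * (ρ * l * e) / Φ ≤ (288 + 1728 / γ) * s ^ 2 := by
      have e1 : ρ * l * e ≤ s * (1 / 2 + 3 / γ) := by
        have : ρ * l = u + e := by rw [he]; ring
        rw [this]
        have e2 : s * (1 / 2 + 3 / γ) = s / 2 + 3 / 2 * (2 * (s / γ)) := by ring
        rw [e2]
        nlinarith [sq_nonneg (u - e)]
      rw [div_le_iff₀ hΦ0]
      have e3 : 6 * s * (ρ * l * e) ≤ 6 * s * (s * (1 / 2 + 3 / γ)) :=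
        mul_le_mul_of_nonneg_left e1 (by positivity)
      have e4 : 0 ≤ (288 + 1728 / γ) * s ^ 2 := by positivity
      have e5 := mul_le_mul_of_nonneg_left hΦ e4
      refine e3.trans (le_trans (le_of_eq ?_) e5)
      ring
    have h11 : (192 + (288 + 1728 / γ)) * s ^ 2 ≤ C * S ^ 2 := by
      have e1 : s ^ 2 ≤ S ^ 2 := by nlinarith
      have e2 : 192 + (288 + 1728 / γ) = C := by rw [hC]; ring
      rw [e2]; exact mul_le_mul_of_nonneg_left e1 hC0
    have h12 : linForm lam v (w t) = 4 * s + 8 * u ^ 2 := rfl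
    rw [h12] at h5 ⊢
    have h13 : ρ * (2 * l ^ (2 - 1) * (ρ * l - 3 * s * e)) / Φ =
        2 * (ρ ^ 2 * l ^ 2 / Φ) - 6 * s * (ρ * l * e) / Φ := by
      simp only [Nat.add_one_sub_one, pow_one]; ring
    rw [h13]
    simp only [Nat.add_one_sub_one, pow_one]
    nlinarith [mul_nonneg h0 h4]
  · have h1 := corr_sq_le_qnorm hn (w 0)
    have h2 : 0 ≤ ρ * modeCoord ρ lam v (w 0) ^ 2 / modeNorm ρ lam v := by positivity
    simp only [mul_zero, add_zero, Real.exp_zero, mul_one, linForm, hF₀]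
    linarith

lemma qnorm_le_linForm (x : Fin d → ℝ) : 4 * qnorm lam x ≤ linForm lam v x := by
  unfold linForm; nlinarith [sq_nonneg (corr lam v x)]

end linear

/-! ### Escape from the origin -/

/-- A trajectory near the origin whose initial point is, up to a small remainder `n 0`, a positive
multiple of the unstable eigenvector. The remainder is carried along by the part of the flow which
does not involve the correlation; `g` is a lower bound for the spectral gap and `θ` bounds the
relative size of the remainder. -/
structure IsEscape {d : ℕ} (lam v : Fin d → ℝ) (w : ℝ → Fin d → ℝ) (i₀ : Fin d) (ρ g θ : ℝ)
    (n : ℝ → Fin d → ℝ) : Prop extends IsFlow lam v w, IsNormalized lam v, IsMode lam v i₀ ρ where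
  g_pos : 0 < g
  g_le_gap : g ≤ ρ - 4 * lam i₀
  g_le : g / 8 ≤ wdot (lam * lam) v v
  n_cont : Continuous n
  n_deriv : ∀ t i, HasDerivAt (fun t => n t i)
    (lam i * (4 - 12 * qnorm lam (w t)) * n t i) t
  n_small : ∀ t, 0 ≤ t →
    qnorm lam (n t) ≤ (θ * modeCoord ρ lam v (w 0) * Real.exp (4 * lam i₀ * t)) ^ 2
  init : w 0 - n 0 = (modeCoord ρ lam v (w 0) / modeNorm ρ lam v) • (modeW ρ lam * v)
  coord_pos : 0 < modeCoord ρ lam v (w 0)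
  small : qnorm lam (w 0) ≤ g / 72
  θ_pos : 0 < θ
  θ_le : θ ≤ g / 8

/-- The remainder, seen as a solution of the flow equation without the correlation term. -/
lemma exists_remainder {d : ℕ} {lam v : Fin d → ℝ} {w : ℝ → Fin d → ℝ} {i₀ : Fin d}
    (hw : Continuous w) (hn : IsNormalized lam v) (htop : ∀ i, lam i ≤ lam i₀) (r : Fin d → ℝ) :
    ∃ n : ℝ → Fin d → ℝ, Continuous n ∧ n 0 = r ∧
      (∀ t i, HasDerivAt (fun t => n t i) (lam i * (4 - 12 * qnorm lam (w t)) * n t i) t) ∧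
      ∀ t, 0 ≤ t → qnorm lam (n t) ≤ qnorm lam r * Real.exp (4 * lam i₀ * t) ^ 2 := by
  set P : ℝ → ℝ := fun t => ∫ τ in (0 : ℝ)..t, (4 - 12 * qnorm lam (w τ)) with hP
  have hcont : Continuous fun τ => 4 - 12 * qnorm lam (w τ) := by fun_prop
  have hPd : ∀ t, HasDerivAt P (4 - 12 * qnorm lam (w t)) t := fun t =>
    intervalIntegral.integral_hasDerivAt_right (hcont.intervalIntegrable _ _)
      (hcont.stronglyMeasurableAtFilter _ _) hcont.continuousAt
  have hPc : Continuous P := continuous_iff_continuousAt.2 fun t => (hPd t).continuousAt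
  have hP0 : P 0 = 0 := by simp [hP]
  have hPle : ∀ t, 0 ≤ t → P t ≤ 4 * t := fun t ht => by
    have := le_of_hasDerivAt_nonneg (f := fun t => 4 * t - P t)
      (f' := fun t => 4 * 1 - (4 - 12 * qnorm lam (w t))) ht (by fun_prop)
      (fun t _ => ((hasDerivAt_id t).const_mul 4).sub (hPd t))
      (fun t _ => by have := qnorm_nonneg hn (w t); linarith)
    simp only [hP0] at this
    linarith
  refine ⟨fun t i => r i * Real.exp (lam i * P t), by fun_prop, ?_, fun t i => ?_, fun t ht => ?_⟩
  · ext i; simp [hP0]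
  · exact ((((hPd t).const_mul (lam i)).exp).const_mul (r i)).congr_deriv (by ring)
  · rw [qnorm, qnorm, wdot, wdot, Finset.sum_mul]
    refine Finset.sum_le_sum fun i _ => ?_
    have h1 : Real.exp (lam i * P t) ≤ Real.exp (4 * lam i₀ * t) := by
      refine Real.exp_le_exp.2 ?_
      have h2 := mul_le_mul_of_nonneg_left (hPle t ht) (hn.pos i).le
      have h3 := mul_le_mul_of_nonneg_right (htop i) (mul_nonneg (by norm_num : (0 : ℝ) ≤ 4) ht)
      linarith
    have h2 := pow_le_pow_left₀ (Real.exp_pos _).le h1 2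
    have h3 := mul_le_mul_of_nonneg_left h2 (mul_nonneg (hn.pos i).le (mul_self_nonneg (r i)))
    calc _ = lam i * (r i * r i) * Real.exp (lam i * P t) ^ 2 := by ring
      _ ≤ _ := h3
      _ = _ := by ring

namespace IsEscape
variable {d : ℕ} {lam v : Fin d → ℝ} {w n : ℝ → Fin d → ℝ} {i₀ : Fin d} {ρ g θ : ℝ}

lemma g_le_eight (h : IsEscape lam v w i₀ ρ g θ n) : g ≤ 8 := by
  have h1 := h.gap_le_eight h.toIsNormalized
  have h2 := h.le_one i₀
  have h3 := h.g_le_gap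
  linarith

lemma abs_noise_le (h : IsEscape lam v w i₀ ρ g θ n) {t : ℝ} (ht : 0 ≤ t) :
    |corr lam v (n t)| ≤ θ * modeCoord ρ lam v (w 0) * Real.exp (4 * lam i₀ * t) := by
  have h1 := (corr_sq_le_qnorm h.toIsNormalized (n t)).trans (h.n_small t ht)
  have := h.θ_pos
  have := h.coord_pos
  exact abs_le_of_sq_le_sq h1 (by positivity)

lemma corr_eq (w n : ℝ → Fin d → ℝ) (t : ℝ) :
    corr lam v (w t) = corr lam v ((w - n) t) + corr lam v (n t) := by
  rw [corr, corr, corr, ← wdot_add_left]; simp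

lemma continuous_sub (h : IsEscape lam v w i₀ ρ g θ n) : Continuous (w - n) := h.cont.sub h.n_cont

lemma hasDerivAt_sub (h : IsEscape lam v w i₀ ρ g θ n) {t : ℝ} (ht : 0 < t) (i : Fin d) :
    HasDerivAt (fun t => (w - n) t i) (lam i * ((4 - 12 * qnorm lam (w t)) * (w - n) t i
      + 8 * corr lam v (w t) * v i)) t := by
  refine ((h.deriv t ht i).sub (h.n_deriv t i)).congr_deriv ?_
  simp only [Pi.sub_apply]; ring

lemma hasDerivAt_wdot_sub (h : IsEscape lam v w i₀ ρ g θ n) {t : ℝ} (ht : 0 < t)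
    (ψ z : Fin d → ℝ) : HasDerivAt (fun t => wdot ψ ((w - n) t) z)
      ((4 - 12 * qnorm lam (w t)) * wdot (ψ * lam) ((w - n) t) z
        + 8 * corr lam v (w t) * wdot (ψ * lam) v z) t := by
  have h1 : HasDerivAt (fun t => ∑ i, ψ i * (w - n) t i * z i) (∑ i, ψ i *
      (lam i * ((4 - 12 * qnorm lam (w t)) * (w - n) t i + 8 * corr lam v (w t) * v i)) * z i) t :=
    HasDerivAt.fun_sum fun i _ => ((h.hasDerivAt_sub ht i).const_mul (ψ i)).mul_const (z i)
  refine h1.congr_deriv ?_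
  simp only [wdot, Finset.mul_sum, ← Finset.sum_add_distrib, Pi.mul_apply]
  exact Finset.sum_congr rfl fun _ _ => by ring

lemma hasDerivAt_qnorm_sub (h : IsEscape lam v w i₀ ρ g θ n) {t : ℝ} (ht : 0 < t) :
    HasDerivAt (fun t => qnorm lam ((w - n) t))
      (2 * ((4 - 12 * qnorm lam (w t)) * wdot (lam * lam) ((w - n) t) ((w - n) t)
        + 8 * corr lam v (w t) * wdot (lam * lam) ((w - n) t) v)) t := by
  have h1 : HasDerivAt (fun t => ∑ i, lam i * (w - n) t i * (w - n) t i) (∑ i, (lam i *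
      (lam i * ((4 - 12 * qnorm lam (w t)) * (w - n) t i + 8 * corr lam v (w t) * v i)) *
        (w - n) t i + lam i * (w - n) t i *
      (lam i * ((4 - 12 * qnorm lam (w t)) * (w - n) t i + 8 * corr lam v (w t) * v i)))) t :=
    HasDerivAt.fun_sum fun i _ =>
      ((h.hasDerivAt_sub ht i).const_mul (lam i)).mul (h.hasDerivAt_sub ht i)
  refine h1.congr_deriv ?_
  simp only [wdot, Finset.mul_sum, ← Finset.sum_add_distrib, Pi.mul_apply]
  exact Finset.sum_congr rfl fun _ _ => by ring

/-- The unperturbed initial point has the signs of the teacher, being a positive multiple of the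
unstable eigenvector. -/
lemma coord_zero_nonneg (h : IsEscape lam v w i₀ ρ g θ n) (i : Fin d) :
    0 ≤ (w - n) 0 i * v i := by
  have h1 : (w - n) 0 i = (modeCoord ρ lam v (w 0) / modeNorm ρ lam v) * (modeW ρ lam i * v i) :=
    congr_fun h.init i
  have h2 := h.modeNorm_ge h.toIsNormalized
  have h3 := h.modeW_pos h.toIsNormalized i
  have h4 := h.coord_pos
  have h5 : 0 < modeNorm ρ lam v := by linarith
  rw [h1, mul_assoc, mul_assoc, ← sq]
  positivity

/-- Without the remainder, every coordinate keeps the sign of the teacher as long as the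
correlation is nonnegative. -/
lemma coord_nonneg (h : IsEscape lam v w i₀ ρ g θ n) {t : ℝ} (ht : 0 ≤ t)
    (hu : ∀ τ ∈ Icc 0 t, 0 ≤ corr lam v (w τ)) (i : Fin d) : 0 ≤ (w - n) t i * v i := by
  have hc := h.cont
  have hc' := h.continuous_sub
  refine nonneg_of_hasDerivAt_ge (f := fun t => (w - n) t i * v i)
    (f' := fun t => (lam i * ((4 - 12 * qnorm lam (w t)) * (w - n) t i
      + 8 * corr lam v (w t) * v i)) * v i) (g := fun t => lam i * (4 - 12 * qnorm lam (w t)))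
    ht (by fun_prop) (by fun_prop) (fun t ht => (h.hasDerivAt_sub ht.1 i).mul_const _) ?_ ?_
  · intro t ht
    have h1 := hu t ⟨ht.1.le, ht.2.le⟩
    have h2 : 0 ≤ lam i * (8 * corr lam v (w t)) * v i ^ 2 :=
      mul_nonneg (mul_nonneg (h.pos i).le (by linarith)) (sq_nonneg _)
    linarith
  · exact h.coord_zero_nonneg i

lemma wdot_nonneg_of_coord {ψ x : Fin d → ℝ} (hψ : ∀ i, 0 ≤ ψ i) (hx : ∀ i, 0 ≤ x i * v i) :
    0 ≤ wdot ψ x v :=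
  Finset.sum_nonneg fun i _ => by rw [mul_assoc]; exact mul_nonneg (hψ i) (hx i)

lemma wdot_mono_of_coord {ψ φ x : Fin d → ℝ} {c : ℝ} (hψ : ∀ i, ψ i ≤ c * φ i)
    (hx : ∀ i, 0 ≤ x i * v i) : wdot ψ x v ≤ c * wdot φ x v := by
  rw [wdot, wdot, Finset.mul_sum]
  refine Finset.sum_le_sum fun i _ => ?_
  have := mul_le_mul_of_nonneg_right (hψ i) (hx i)
  linarith

lemma corr_le_modeCoord (h : IsEscape lam v w i₀ ρ g θ n) {x : Fin d → ℝ}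
    (hx : ∀ i, 0 ≤ x i * v i) : corr lam v x ≤ 12 * modeCoord ρ lam v x := by
  refine wdot_mono_of_coord (fun i => ?_) hx
  have e1 := h.modeW_mul i
  have e2 := h.modeW_pos h.toIsNormalized i
  have e3 := h.rho_le h.toIsNormalized
  have e4 := h.pos i
  nlinarith

lemma modeCoord_le_corr (h : IsEscape lam v w i₀ ρ g θ n) {x : Fin d → ℝ}
    (hx : ∀ i, 0 ≤ x i * v i) : g * modeCoord ρ lam v x ≤ corr lam v x := by
  have hg := h.g_pos
  have : modeCoord ρ lam v x ≤ g⁻¹ * corr lam v x := by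
    refine wdot_mono_of_coord (fun i => ?_) hx
    have e1 := h.modeW_mul i
    have e2 := h.modeW_pos h.toIsNormalized i
    have e3 := mul_le_mul_of_nonneg_left (h.g_le_gap.trans (h.gap_le i)) e2.le
    rw [inv_mul_eq_div, le_div_iff₀ hg]
    linarith
  rw [inv_mul_eq_div, le_div_iff₀ hg] at this
  linarith

lemma hasDerivAt_modeCoord_sub (h : IsEscape lam v w i₀ ρ g θ n) {t : ℝ} (ht : 0 < t) :
    HasDerivAt (fun t => modeCoord ρ lam v ((w - n) t))
      (ρ * modeCoord ρ lam v ((w - n) t) - 3 * qnorm lam (w t) *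
        (ρ * modeCoord ρ lam v ((w - n) t) - corr lam v ((w - n) t)) + corr lam v (n t)) t := by
  refine (h.hasDerivAt_wdot_sub ht _ _).congr_deriv ?_
  have e := h.four_mul_wdot ((w - n) t) v
  have e2 : wdot (modeW ρ lam * lam) ((w - n) t) v =
      (ρ * modeCoord ρ lam v ((w - n) t) - corr lam v ((w - n) t)) / 4 := by
    rw [modeCoord, corr, ← e]; ring
  rw [h.eqn, e2, corr_eq w n t]
  ring

lemma modeCoord_sub_zero (h : IsEscape lam v w i₀ ρ g θ n) :
    modeCoord ρ lam v ((w - n) 0) = modeCoord ρ lam v (w 0) := by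
  have h2 := h.modeNorm_ge h.toIsNormalized
  have e : wdot (modeW ρ lam) (modeW ρ lam * v) v = modeNorm ρ lam v := by
    rw [modeNorm, wdot_one_mode]
  have : (w - n) 0 = w 0 - n 0 := rfl
  rw [this, h.init, modeCoord, wdot_smul_left, e, div_mul_cancel₀ _ (by linarith)]

/-- Growth of the unstable coordinate, as long as `s` is small and the correlation nonnegative. -/
lemma modeCoord_sub_ge (h : IsEscape lam v w i₀ ρ g θ n) {t : ℝ} (ht : 0 ≤ t)
    (hs : ∀ τ ∈ Icc 0 t, qnorm lam (w τ) ≤ g / 72)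
    (hu : ∀ τ ∈ Icc 0 t, 0 ≤ corr lam v (w τ)) :
    modeCoord ρ lam v (w 0) / 2 * Real.exp ((4 * lam i₀ + g / 2) * t) ≤
      modeCoord ρ lam v ((w - n) t) := by
  have hc := h.cont
  have hc' := h.continuous_sub
  have hg := h.g_pos
  have hl := h.pos i₀
  have hθ := h.θ_pos
  have hθ' := h.θ_le
  set l₀ := modeCoord ρ lam v (w 0) with hl₀
  have hl₀' : 0 < l₀ := h.coord_pos
  set B := 2 * (θ * l₀) / g with hB
  have hBg : B * g = 2 * (θ * l₀) := div_mul_cancel₀ _ hg.ne'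
  have hB0 : 0 < B := by positivity
  have hBl : B ≤ l₀ / 2 := by
    rw [hB, div_le_iff₀ hg]; nlinarith
  have key := nonneg_of_hasDerivAt_ge (f := fun t => modeCoord ρ lam v ((w - n) t)
      - (l₀ - B) * Real.exp ((4 * lam i₀ + g / 2) * t) - B * Real.exp (4 * lam i₀ * t))
    (f' := fun t => (ρ * modeCoord ρ lam v ((w - n) t) - 3 * qnorm lam (w t) *
        (ρ * modeCoord ρ lam v ((w - n) t) - corr lam v ((w - n) t)) + corr lam v (n t))
      - (l₀ - B) * (Real.exp ((4 * lam i₀ + g / 2) * t) * ((4 * lam i₀ + g / 2) * 1))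
      - B * (Real.exp (4 * lam i₀ * t) * (4 * lam i₀ * 1)))
    (g := fun _ => 4 * lam i₀ + g / 2) ht (by fun_prop) continuous_const ?_ ?_ ?_
  · have e1 := Real.exp_pos ((4 * lam i₀ + g / 2) * t)
    have e2 := Real.exp_pos (4 * lam i₀ * t)
    have e3 : l₀ / 2 * Real.exp ((4 * lam i₀ + g / 2) * t) ≤
        (l₀ - B) * Real.exp ((4 * lam i₀ + g / 2) * t) :=
      mul_le_mul_of_nonneg_right (by linarith) e1.le
    have e4 : 0 ≤ B * Real.exp (4 * lam i₀ * t) := by positivity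
    linarith
  · intro t ht
    exact ((h.hasDerivAt_modeCoord_sub ht.1).sub
      ((((hasDerivAt_id t).const_mul _).exp).const_mul _)).sub
      ((((hasDerivAt_id t).const_mul _).exp).const_mul _)
  · intro t ht
    have hst := hs t ⟨ht.1.le, ht.2.le⟩
    have hs0 := qnorm_nonneg h.toIsNormalized (w t)
    have hy := h.coord_nonneg ht.1.le fun τ hτ => hu τ ⟨hτ.1, hτ.2.trans ht.2.le⟩
    have h1 := h.modeCoord_le_corr hy
    have h3 : 0 ≤ corr lam v ((w - n) t) := wdot_nonneg_of_coord (fun i => (h.pos i).le) hy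
    have h4 : 0 ≤ modeCoord ρ lam v ((w - n) t) :=
      wdot_nonneg_of_coord (fun i => (h.modeW_pos h.toIsNormalized i).le) hy
    have h5 := (abs_le.1 (h.abs_noise_le ht.1.le)).1
    rw [← hl₀] at h5
    have h6 := h.rho_le h.toIsNormalized
    have h7 := h.g_le_gap
    have h8 : 3 * qnorm lam (w t) * (ρ * modeCoord ρ lam v ((w - n) t) - corr lam v ((w - n) t)) ≤
        g / 2 * modeCoord ρ lam v ((w - n) t) := by
      have e1 : 3 * qnorm lam (w t) * ρ ≤ 3 * (g / 72) * 12 :=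
        mul_le_mul (by linarith) h6 (h.rho_pos h.toIsNormalized).le (by positivity)
      have e2 := mul_le_mul_of_nonneg_right e1 h4
      have e3 : 0 ≤ 3 * qnorm lam (w t) * corr lam v ((w - n) t) := by positivity
      linarith
    have h9 : (4 * lam i₀ + g / 2) * modeCoord ρ lam v ((w - n) t) ≤
        (ρ - g / 2) * modeCoord ρ lam v ((w - n) t) :=
      mul_le_mul_of_nonneg_right (by linarith) h4
    have h10 : g / 2 * (B * Real.exp (4 * lam i₀ * t)) = θ * l₀ * Real.exp (4 * lam i₀ * t) := by
      linear_combination (Real.exp (4 * lam i₀ * t) / 2) * hBg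
    linarith
  · have e := h.modeCoord_sub_zero
    simp only [mul_zero, Real.exp_zero, mul_one]
    rw [e, ← hl₀]
    linarith

/-- While `s` is small, the correlation stays positive, and the remainder stays negligible with
respect to the unstable coordinate. -/
lemma corr_pos (h : IsEscape lam v w i₀ ρ g θ n) {T : ℝ}
    (hs : ∀ τ ∈ Icc 0 T, qnorm lam (w τ) ≤ g / 72) :
    ∀ t ∈ Icc 0 T, 0 < corr lam v (w t) := by
  have hc := h.cont
  have hθ := h.θ_pos
  have hl₀' := h.coord_pos
  have hg := h.g_pos
  have step : ∀ t ∈ Icc 0 T, (∀ τ ∈ Icc 0 t, 0 ≤ corr lam v (w τ)) → 0 < corr lam v (w t) := by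
    intro t ht hu
    have h1 := h.modeCoord_sub_ge ht.1 (fun τ hτ => hs τ ⟨hτ.1, hτ.2.trans ht.2⟩) hu
    have h2 := h.modeCoord_le_corr (h.coord_nonneg ht.1 hu)
    have h3 := (abs_le.1 (h.abs_noise_le ht.1)).1
    have h4 : Real.exp (4 * lam i₀ * t) ≤ Real.exp ((4 * lam i₀ + g / 2) * t) := by
      refine Real.exp_le_exp.2 ?_
      have := mul_nonneg hg.le ht.1
      nlinarith
    have h5 := mul_le_mul_of_nonneg_left h1 hg.le
    have h6 : θ * modeCoord ρ lam v (w 0) * Real.exp (4 * lam i₀ * t) ≤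
        g / 8 * modeCoord ρ lam v (w 0) * Real.exp ((4 * lam i₀ + g / 2) * t) :=
      mul_le_mul (mul_le_mul_of_nonneg_right h.θ_le hl₀'.le) h4 (Real.exp_pos _).le (by positivity)
    have h7 : 0 < g * modeCoord ρ lam v (w 0) * Real.exp ((4 * lam i₀ + g / 2) * t) := by
      positivity
    rw [corr_eq w n t]
    linarith
  intro t ht
  refine pos_of_nonneg_imp_pos (f := fun t => corr lam v (w t)) (a := 0) (b := T) (by fun_prop) ?_
    step t ht
  have h2 := h.modeCoord_le_corr h.coord_zero_nonneg
  rw [h.modeCoord_sub_zero] at h2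
  have h3 := (abs_le.1 (h.abs_noise_le le_rfl)).1
  rw [mul_zero, Real.exp_zero, mul_one] at h3
  have h4 := mul_le_mul_of_nonneg_right h.θ_le hl₀'.le
  have h5 := mul_pos hg hl₀'
  rw [corr_eq w n 0]
  linarith

/-- The bound on the remainder is a small multiple of the unstable coordinate, which grows
faster. -/
lemma noise_le_modeCoord (h : IsEscape lam v w i₀ ρ g θ n) {t : ℝ} (ht : 0 ≤ t)
    (hs : ∀ τ ∈ Icc 0 t, qnorm lam (w τ) ≤ g / 72) :
    θ * modeCoord ρ lam v (w 0) * Real.exp (4 * lam i₀ * t) ≤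
      2 * θ * modeCoord ρ lam v ((w - n) t) := by
  have hg := h.g_pos
  have hθ := h.θ_pos
  have hl₀' := h.coord_pos
  have h1 := h.modeCoord_sub_ge ht hs fun τ hτ => (h.corr_pos hs τ hτ).le
  have h4 : Real.exp (4 * lam i₀ * t) ≤ Real.exp ((4 * lam i₀ + g / 2) * t) := by
    refine Real.exp_le_exp.2 ?_
    have := mul_nonneg hg.le ht
    nlinarith
  have h5 := mul_le_mul_of_nonneg_left h4 (mul_pos hθ hl₀').le
  have h6 := mul_le_mul_of_nonneg_left h1 (mul_pos two_pos hθ).le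
  linarith

/-- While `s` is small, the correlation is comparable with the unstable coordinate. -/
lemma corr_bounds (h : IsEscape lam v w i₀ ρ g θ n) {t : ℝ} (ht : 0 ≤ t)
    (hs : ∀ τ ∈ Icc 0 t, qnorm lam (w τ) ≤ g / 72) :
    g / 2 * modeCoord ρ lam v ((w - n) t) ≤ corr lam v (w t) ∧
      corr lam v (w t) ≤ 14 * modeCoord ρ lam v ((w - n) t) ∧
      |corr lam v (n t)| ≤ g / 4 * modeCoord ρ lam v ((w - n) t) ∧
      0 < modeCoord ρ lam v ((w - n) t) := by
  have hu : ∀ τ ∈ Icc 0 t, 0 ≤ corr lam v (w τ) := fun τ hτ => (h.corr_pos hs τ hτ).le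
  have hy := h.coord_nonneg ht hu
  have h1 := h.modeCoord_le_corr hy
  have h2 := h.corr_le_modeCoord hy
  have h3 := (h.abs_noise_le ht).trans (h.noise_le_modeCoord ht hs)
  have hl : 0 < modeCoord ρ lam v ((w - n) t) := by
    have := h.modeCoord_sub_ge ht hs hu
    have h5 := h.coord_pos
    exact lt_of_lt_of_le (by positivity) this
  have h4 := mul_le_mul_of_nonneg_right h.θ_le hl.le
  have h6 := mul_le_mul_of_nonneg_right h.g_le_eight hl.le
  have h7 := abs_le.1 h3
  rw [corr_eq w n t]
  refine ⟨?_, ?_, ?_, hl⟩ <;> linarith [h7.1, h7.2]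

/-- While `s` is small, the unstable coordinate grows at an exponential rate beyond `4 λ₁`. -/
lemma modeCoord_deriv_ge (h : IsEscape lam v w i₀ ρ g θ n) {t : ℝ} (ht : 0 ≤ t)
    (hs : ∀ τ ∈ Icc 0 t, qnorm lam (w τ) ≤ g / 72) :
    (4 * lam i₀ + g / 4) * modeCoord ρ lam v ((w - n) t) ≤
      ρ * modeCoord ρ lam v ((w - n) t) - 3 * qnorm lam (w t) *
        (ρ * modeCoord ρ lam v ((w - n) t) - corr lam v ((w - n) t)) + corr lam v (n t) := by
  obtain ⟨-, -, h3, h4⟩ := h.corr_bounds ht hs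
  have hu : ∀ τ ∈ Icc 0 t, 0 ≤ corr lam v (w τ) := fun τ hτ => (h.corr_pos hs τ hτ).le
  have hU : 0 ≤ corr lam v ((w - n) t) :=
    wdot_nonneg_of_coord (fun i => (h.pos i).le) (h.coord_nonneg ht hu)
  have hst := hs t ⟨ht, le_rfl⟩
  have hs0 := qnorm_nonneg h.toIsNormalized (w t)
  have e1 : 3 * qnorm lam (w t) * ρ ≤ 3 * (g / 72) * 12 :=
    mul_le_mul (by linarith) (h.rho_le h.toIsNormalized) (h.rho_pos h.toIsNormalized).le
      (by have := h.g_pos; positivity)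
  have e2 := mul_le_mul_of_nonneg_right e1 h4.le
  have e3 : 0 ≤ 3 * qnorm lam (w t) * corr lam v ((w - n) t) := by positivity
  have e4 := mul_le_mul_of_nonneg_right h.g_le_gap h4.le
  have e5 := (abs_le.1 h3).1
  linarith

lemma qnorm_sub_zero_le (h : IsEscape lam v w i₀ ρ g θ n) :
    qnorm lam ((w - n) 0) ≤ 96 * modeCoord ρ lam v (w 0) ^ 2 := by
  have h2 := h.modeNorm_ge h.toIsNormalized
  have h3 : wdot lam (modeW ρ lam * v) (modeW ρ lam * v) ≤ modeNorm ρ lam v :=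
    wdot_self_mono h.le_one _
  have e : (w - n) 0 = w 0 - n 0 := rfl
  rw [e, h.init, qnorm, wdot_smul_left, wdot_smul_right]
  set l := modeCoord ρ lam v (w 0)
  set m := modeNorm ρ lam v
  have hm : 0 < m := by linarith
  have h4 : l / m * (l / m * wdot lam (modeW ρ lam * v) (modeW ρ lam * v)) ≤
      l / m * (l / m) * m := by
    rw [← mul_assoc]; exact mul_le_mul_of_nonneg_left h3 (mul_self_nonneg _)
  have h5 : l / m * (l / m) * m = l ^ 2 / m := by field_simp
  have h6 : l ^ 2 / m ≤ 96 * l ^ 2 := by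
    rw [div_le_iff₀ hm]; nlinarith [sq_nonneg l]
  linarith

/-- While `s` is small, the size of the student is controlled by its unstable coordinate. -/
lemma qnorm_le_modeCoord (h : IsEscape lam v w i₀ ρ g θ n) {t : ℝ} (ht : 0 ≤ t)
    (hs : ∀ τ ∈ Icc 0 t, qnorm lam (w τ) ≤ g / 72) :
    qnorm lam (w t) ≤ 630000 / g ^ 2 * modeCoord ρ lam v ((w - n) t) ^ 2 := by
  have hc := h.cont
  have hc' := h.continuous_sub
  have hg := h.g_pos
  have hg8 := h.g_le_eight
  -- `B` is such that the cross term, at most `224² / g` times the squared unstable coordinate after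
  -- completing the square, is absorbed by `(g / 4) B` times the same.
  set B := 210000 / g ^ 2 with hB
  have hBg : B * g ^ 2 = 210000 := div_mul_cancel₀ _ (by positivity)
  have hB1 : 96 ≤ B := by rw [hB, le_div_iff₀ (by positivity)]; nlinarith
  have key := nonneg_of_hasDerivAt_ge
    (f := fun t => B * modeCoord ρ lam v ((w - n) t) ^ 2 - qnorm lam ((w - n) t))
    (g := fun _ => 8 * lam i₀ + g / 4) ht (by fun_prop) continuous_const
    (fun t ht => (((h.hasDerivAt_modeCoord_sub ht.1).pow 2).const_mul B).sub
      (h.hasDerivAt_qnorm_sub ht.1)) ?_ ?_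
  · have h1 : qnorm lam (w t) ≤ 2 * qnorm lam ((w - n) t) + 2 * qnorm lam (n t) := by
      have e : w t = (w - n) t + n t := by simp
      conv_lhs => rw [e]
      exact wdot_add_self_le (fun i => (h.pos i).le) _ _
    obtain ⟨-, -, -, h4⟩ := h.corr_bounds ht hs
    have h2 := (h.n_small t ht).trans (pow_le_pow_left₀ (by
      have := h.θ_pos; have := h.coord_pos; positivity) (h.noise_le_modeCoord ht hs) 2)
    have hθ := h.θ_le
    have hθ0 := h.θ_pos
    have h5 : (2 * θ * modeCoord ρ lam v ((w - n) t)) ^ 2 ≤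
        4 * modeCoord ρ lam v ((w - n) t) ^ 2 := by
      rw [mul_pow]
      refine mul_le_mul_of_nonneg_right ?_ (sq_nonneg _)
      nlinarith
    have h6 : 630000 / g ^ 2 = 3 * B := by rw [hB]; ring
    rw [h6]
    nlinarith [sq_nonneg (modeCoord ρ lam v ((w - n) t))]
  · intro t ht
    have hs' : ∀ τ ∈ Icc 0 t, qnorm lam (w τ) ≤ g / 72 :=
      fun τ hτ => hs τ ⟨hτ.1, hτ.2.trans ht.2.le⟩
    obtain ⟨h1, h2, -, h4⟩ := h.corr_bounds ht.1.le hs'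
    have h5 := h.modeCoord_deriv_ge ht.1.le hs'
    set l := modeCoord ρ lam v ((w - n) t)
    set l' := ρ * l - 3 * qnorm lam (w t) * (ρ * l - PhaseRetrieval.corr lam v ((w - n) t))
      + PhaseRetrieval.corr lam v (n t)
    set S := qnorm lam ((w - n) t) with hS
    have hS0 : 0 ≤ S := qnorm_nonneg h.toIsNormalized _
    have h6 : wdot (lam * lam) ((w - n) t) ((w - n) t) ≤ lam i₀ * S := by
      have e : lam i₀ * S = wdot (fun i => lam i₀ * lam i) ((w - n) t) ((w - n) t) := by
        rw [hS, qnorm, wdot, wdot, Finset.mul_sum]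
        exact Finset.sum_congr rfl fun _ _ => by ring
      rw [e]
      exact wdot_self_mono (fun i => mul_le_mul_of_nonneg_right (h.top i) (h.pos i).le) _
    have h6' : 0 ≤ wdot (lam * lam) ((w - n) t) ((w - n) t) :=
      wdot_self_nonneg (fun i => mul_self_nonneg _) _
    have h7 : |wdot (lam * lam) ((w - n) t) v| ≤ √S := by
      have := wdot_mul_self_sq_le h.toIsNormalized ((w - n) t) v
      rw [show qnorm lam v = 1 from h.norm, mul_one] at this
      exact Real.abs_le_sqrt this
    have h8 : corr lam v (w t) * wdot (lam * lam) ((w - n) t) v ≤ 14 * l * √S :=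
      mul_le_mul h2 ((le_abs_self _).trans h7) (by
        refine wdot_nonneg_of_coord (fun i => mul_self_nonneg _) (h.coord_nonneg ht.1.le
          fun τ hτ => (h.corr_pos hs' τ hτ).le)) (by positivity)
    have h9 : (4 - 12 * qnorm lam (w t)) * wdot (lam * lam) ((w - n) t) ((w - n) t) ≤
        4 * (lam i₀ * S) :=
      mul_le_mul (by have := qnorm_nonneg h.toIsNormalized (w t); linarith) h6 h6' (by norm_num)
    have h10 : 224 * (l * √S) ≤ g / 4 * S + 50176 / g * l ^ 2 := by
      have e1 : √S ^ 2 = S := Real.sq_sqrt hS0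
      have e2 : g / 4 * S + 50176 / g * l ^ 2 - 224 * (l * √S) =
          (g * √S - 448 * l) ^ 2 / (4 * g) := by
        have e3 : g / 4 * S = g / 4 * √S ^ 2 := by rw [e1]
        rw [e3]; field_simp; ring
      have : 0 ≤ (g * √S - 448 * l) ^ 2 / (4 * g) := by positivity
      linarith
    have h11 : 50176 / g * l ^ 2 ≤ g / 4 * (B * l ^ 2) := by
      rw [← mul_assoc]
      refine mul_le_mul_of_nonneg_right ?_ (sq_nonneg l)
      rw [div_le_iff₀ hg]; nlinarith
    have h12 := mul_le_mul_of_nonneg_left h5 (mul_pos (by linarith : 0 < 2 * B) h4).le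
    have e : ((2 : ℕ) : ℝ) * l ^ (2 - 1) * l' = 2 * l * l' := by norm_num
    rw [e]
    linarith
  · have h0 := h.qnorm_sub_zero_le
    rw [h.modeCoord_sub_zero]
    nlinarith [sq_nonneg (modeCoord ρ lam v (w 0))]

lemma modeCoord_sub_le (h : IsEscape lam v w i₀ ρ g θ n) {t : ℝ} (ht : 0 ≤ t)
    (hs : ∀ τ ∈ Icc 0 t, qnorm lam (w τ) ≤ g / 72) :
    g * modeCoord ρ lam v ((w - n) t) ≤ 1 := by
  obtain ⟨h1, -, -, h4⟩ := h.corr_bounds ht hs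
  have h2 := corr_sq_le_qnorm h.toIsNormalized (w t)
  have h3 := hs t ⟨ht, le_rfl⟩
  have h5 := h.g_le_eight
  have h6 : corr lam v (w t) ≤ 1 / 2 := by nlinarith
  linarith

/-- The Euclidean norm grows by a bounded amount only, the growth of `s` being exponential. -/
lemma norm_sq_le_of_small (h : IsEscape lam v w i₀ ρ g θ n) {t : ℝ} (ht : 0 ≤ t)
    (hs : ∀ τ ∈ Icc 0 t, qnorm lam (w τ) ≤ g / 72) :
    wdot 1 (w t) (w t) ≤ wdot 1 (w 0) (w 0) + 1890000 / (lam i₀ * g ^ 4) := by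
  have hc := h.cont
  have hc' := h.continuous_sub
  have hg := h.g_pos
  have hl := h.pos i₀
  -- The derivative of the squared norm is at most `24 s`, and that of the squared unstable
  -- coordinate is at least `8 λ₁` times itself.
  set C := 1890000 / (lam i₀ * g ^ 2) with hC
  have hC0 : 0 < C := by positivity
  have key := le_of_hasDerivAt_nonneg
    (f := fun t => C * modeCoord ρ lam v ((w - n) t) ^ 2 - wdot 1 (w t) (w t)) ht (by fun_prop)
    (fun t ht => (((h.hasDerivAt_modeCoord_sub ht.1).pow 2).const_mul C).sub
      (h.hasDerivAt_norm_sq ht.1)) ?_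
  · have h1 := h.modeCoord_sub_le ht hs
    obtain ⟨-, -, -, h4⟩ := h.corr_bounds ht hs
    have h2 : C * modeCoord ρ lam v ((w - n) t) ^ 2 ≤ 1890000 / (lam i₀ * g ^ 4) := by
      have e : 1890000 / (lam i₀ * g ^ 4) = C * (1 / g) ^ 2 := by rw [hC]; field_simp
      rw [e]
      refine mul_le_mul_of_nonneg_left (pow_le_pow_left₀ h4.le ?_ 2) hC0.le
      rw [le_div_iff₀ hg]; linarith
    have h3 : 0 ≤ C * modeCoord ρ lam v ((w - n) 0) ^ 2 := by positivity
    linarith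
  · intro t ht
    have hs' : ∀ τ ∈ Icc 0 t, qnorm lam (w τ) ≤ g / 72 :=
      fun τ hτ => hs τ ⟨hτ.1, hτ.2.trans ht.2.le⟩
    obtain ⟨-, -, -, h4⟩ := h.corr_bounds ht.1.le hs'
    have h5 := h.modeCoord_deriv_ge ht.1.le hs'
    have h6 := h.qnorm_le_modeCoord ht.1.le hs'
    have h7 := corr_sq_le_qnorm h.toIsNormalized (w t)
    set l := modeCoord ρ lam v ((w - n) t)
    set l' := ρ * l - 3 * qnorm lam (w t) * (ρ * l - PhaseRetrieval.corr lam v ((w - n) t))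
      + PhaseRetrieval.corr lam v (n t)
    have e : ((2 : ℕ) : ℝ) * l ^ (2 - 1) * l' = 2 * l * l' := by norm_num
    rw [e]
    have h8 : 4 * lam i₀ * l ≤ l' := by
      have : 0 ≤ g / 4 * l := by positivity
      linarith
    have h9 := mul_le_mul_of_nonneg_left h8 (mul_pos (by linarith : 0 < 2 * C) h4).le
    have h10 : C * lam i₀ * 8 * l ^ 2 = 24 * (630000 / g ^ 2 * l ^ 2) := by
      rw [hC]; field_simp; norm_num
    nlinarith [sq_nonneg (qnorm lam (w t))]

/-- The student leaves the neighbourhood of the origin after a logarithmic time. -/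
lemma exists_qnorm_eq_small (h : IsEscape lam v w i₀ ρ g θ n) :
    ∃ σ, 0 ≤ σ ∧ σ ≤ Real.log (8 / (g * modeCoord ρ lam v (w 0))) / (4 * lam i₀) ∧
      qnorm lam (w σ) = g / 72 ∧ ∀ τ ∈ Icc 0 σ, qnorm lam (w τ) ≤ g / 72 := by
  have hg := h.g_pos
  have hl := h.pos i₀
  have hl0 := h.coord_pos
  have hc := h.cont
  set T := Real.log (8 / (g * modeCoord ρ lam v (w 0))) / (4 * lam i₀) with hT
  have h0 : g * modeCoord ρ lam v (w 0) ≤ 1 := by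
    have := h.modeCoord_sub_le le_rfl fun τ hτ => by
      rw [show τ = 0 from le_antisymm hτ.2 hτ.1]; exact h.small
    rwa [h.modeCoord_sub_zero] at this
  have hT0 : 0 ≤ T := by
    refine div_nonneg (Real.log_nonneg ?_) (by positivity)
    rw [le_div_iff₀ (by positivity)]; linarith
  have hbig : ∃ τ ∈ Icc 0 T, g / 72 ≤ qnorm lam (w τ) := by
    by_contra! hcon
    have hs : ∀ τ ∈ Icc 0 T, qnorm lam (w τ) ≤ g / 72 := fun τ hτ => (hcon τ hτ).le
    have h1 := h.modeCoord_sub_ge hT0 hs fun τ hτ => (h.corr_pos hs τ hτ).le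
    have h2 := h.modeCoord_sub_le hT0 hs
    have h3 : 8 / (g * modeCoord ρ lam v (w 0)) ≤ Real.exp ((4 * lam i₀ + g / 2) * T) := by
      rw [← Real.exp_log (show 0 < 8 / (g * modeCoord ρ lam v (w 0)) by positivity)]
      refine Real.exp_le_exp.2 ?_
      have e : 4 * lam i₀ * T = Real.log (8 / (g * modeCoord ρ lam v (w 0))) := by
        rw [hT]; field_simp
      have : 0 ≤ g / 2 * T := by positivity
      linarith
    have h4 := mul_le_mul_of_nonneg_left h3 (mul_pos hg (half_pos hl0)).le
    have e : g * (modeCoord ρ lam v (w 0) / 2) * (8 / (g * modeCoord ρ lam v (w 0))) = 4 := by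
      field_simp; norm_num
    nlinarith
  obtain ⟨τ, hτ, hτs⟩ := hbig
  obtain ⟨σ, hσ, e1, e2⟩ := exists_first_hit (f := fun t => qnorm lam (w t)) hτ.1 (by fun_prop)
    h.small hτs
  exact ⟨σ, hσ.1, hσ.2.trans hτ.2, e1, e2⟩

/-- The escape from the origin: after a time of order `log (1 / ℓ)`, where `ℓ` is the initial
unstable coordinate, `s` reaches `1 / 3` with a correlation of constant order. Between
`s = g / 72` and `s = 1 / 3` the correlation of the unperturbed part increases at a linear rate at
least, which is why this part takes a constant time only. -/
theorem exists_qnorm_eq (h : IsEscape lam v w i₀ ρ g θ n)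
    (hθ : θ ≤ g * Real.exp (-(160000 / g ^ 4)) / 8) :
    ∃ t, 0 ≤ t ∧
      t ≤ Real.log (8 / (g * modeCoord ρ lam v (w 0))) / (4 * lam i₀) + 40000 / g ^ 4 ∧
      qnorm lam (w t) = 1 / 3 ∧ g ^ 3 / 40000 ≤ corr lam v (w t) ∧
      wdot 1 (w t) (w t) ≤
        wdot 1 (w 0) (w 0) + 1890000 / (lam i₀ * g ^ 4) + 6 * (40000 / g ^ 4) := by
  obtain ⟨σ, hσ0, hσ, hsσ, hs⟩ := h.exists_qnorm_eq_small
  have hc := h.cont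
  have hc' := h.continuous_sub
  have hg := h.g_pos
  have hg8 := h.g_le_eight
  have hl0 := h.coord_pos
  have hθ0 := h.θ_pos
  obtain ⟨h1, h2, h3, h4⟩ := h.corr_bounds hσ0 hs
  set l := modeCoord ρ lam v ((w - n) σ) with hl
  -- The unstable coordinate has constant order when `s` does.
  have hlge : g ^ 2 / 20000 ≤ l := by
    have e1 := h.qnorm_le_modeCoord hσ0 hs
    rw [hsσ, ← hl, div_mul_eq_mul_div, le_div_iff₀ (by positivity)] at e1
    refine le_of_sq_le_sq ?_ h4.le
    have e2 : g ^ 4 ≤ 8 * g ^ 3 := by nlinarith [pow_pos hg 3]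
    nlinarith
  have hσ' : ∀ τ ∈ Icc 0 σ, 0 ≤ corr lam v (w τ) := fun τ hτ => (h.corr_pos hs τ hτ).le
  have hU := h.modeCoord_le_corr (h.coord_nonneg hσ0 hσ')
  rw [← hl] at hU
  set C := 40000 / g ^ 4 with hC
  have hC0 : 0 < C := by positivity
  have hnoise : ∀ t ∈ Icc σ (σ + C), |corr lam v (n t)| ≤ g / 4 * l := by
    intro t ht
    refine (h.abs_noise_le (hσ0.trans ht.1)).trans ?_
    have e1 := h.modeCoord_sub_ge hσ0 hs hσ'
    rw [← hl] at e1
    have e2 : Real.exp (4 * lam i₀ * t) ≤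
        Real.exp ((4 * lam i₀ + g / 2) * σ) * Real.exp (160000 / g ^ 4) := by
      rw [← Real.exp_add]
      refine Real.exp_le_exp.2 ?_
      have e3 : 160000 / g ^ 4 = 4 * C := by rw [hC]; ring
      have e4 : lam i₀ * (t - σ) ≤ 1 * C :=
        mul_le_mul (h.le_one i₀) (by linarith [ht.2]) (by linarith [ht.1]) zero_le_one
      have e5 : 0 ≤ g / 2 * σ := by positivity
      rw [e3]; linarith
    have e3 : θ * Real.exp (160000 / g ^ 4) ≤ g / 8 := by
      have := mul_le_mul_of_nonneg_right hθ (Real.exp_pos (160000 / g ^ 4)).le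
      have e : g * Real.exp (-(160000 / g ^ 4)) / 8 * Real.exp (160000 / g ^ 4) = g / 8 := by
        rw [Real.exp_neg]; field_simp
      linarith
    calc θ * modeCoord ρ lam v (w 0) * Real.exp (4 * lam i₀ * t)
        ≤ θ * modeCoord ρ lam v (w 0) *
          (Real.exp ((4 * lam i₀ + g / 2) * σ) * Real.exp (160000 / g ^ 4)) :=
          mul_le_mul_of_nonneg_left e2 (by positivity)
      _ = 2 * (θ * Real.exp (160000 / g ^ 4)) *
          (modeCoord ρ lam v (w 0) / 2 * Real.exp ((4 * lam i₀ + g / 2) * σ)) := by ring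
      _ ≤ 2 * (g / 8) * l := mul_le_mul (by linarith) e1 (by positivity) (by positivity)
      _ = g / 4 * l := by ring
  have hnorm := h.norm_sq_le_of_small hσ0 hs
  have hgrow : ∀ T ∈ Icc σ (σ + C), (∀ t ∈ Icc σ T, qnorm lam (w t) ≤ 1 / 3) →
      (∀ t ∈ Icc σ T, 0 ≤ corr lam v (w t)) → g * l ≤ corr lam v ((w - n) T) ∧
      (∀ c, 0 ≤ c → (∀ t ∈ Icc σ T, c ≤ corr lam v (w t)) →
        g * l + g * c * (T - σ) ≤ corr lam v ((w - n) T)) := by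
    intro T hT hsT huT
    have hu0 : ∀ t ∈ Icc 0 T, 0 ≤ corr lam v (w t) := by
      intro t ht
      rcases le_total t σ with e | e
      · exact hσ' t ⟨ht.1, e⟩
      · exact huT t ⟨e, ht.2⟩
    have key : ∀ c, 0 ≤ c → (∀ t ∈ Icc σ T, c ≤ corr lam v (w t)) →
        g * l + g * c * (T - σ) ≤ corr lam v ((w - n) T) := by
      intro c hc0 hcT
      have := le_of_hasDerivAt_nonneg
        (f := fun t => corr lam v ((w - n) t) - g * c * t) hT.1 (by fun_prop)
        (fun t ht => (h.hasDerivAt_wdot_sub (hσ0.trans_lt ht.1) lam v).sub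
          ((hasDerivAt_id t).const_mul (g * c))) ?_
      · linarith
      · intro t ht
        have e1 := hsT t ⟨ht.1.le, ht.2.le⟩
        have e2 : 0 ≤ wdot (lam * lam) ((w - n) t) v :=
          wdot_nonneg_of_coord (fun i => mul_self_nonneg _)
            (h.coord_nonneg (hσ0.trans ht.1.le) fun τ hτ => hu0 τ ⟨hτ.1, hτ.2.trans ht.2.le⟩)
        have e3 := hcT t ⟨ht.1.le, ht.2.le⟩
        have e4 : c * (g / 8) ≤ corr lam v (w t) * wdot (lam * lam) v v :=
          mul_le_mul e3 h.g_le (by positivity) (hc0.trans e3)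
        have e5 : 0 ≤ (4 - 12 * qnorm lam (w t)) * wdot (lam * lam) ((w - n) t) v :=
          mul_nonneg (by linarith) e2
        linarith
    refine ⟨?_, key⟩
    have := key 0 le_rfl huT
    simpa using this
  have hgl : 0 < g * l := by positivity
  have hpos : ∀ T ∈ Icc σ (σ + C), (∀ t ∈ Icc σ T, qnorm lam (w t) ≤ 1 / 3) →
      g / 2 * l ≤ corr lam v (w T) := by
    intro T hT hsT
    have step : ∀ t ∈ Icc σ T, (∀ τ ∈ Icc σ t, 0 ≤ corr lam v (w τ)) →
        g / 2 * l < corr lam v (w t) := by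
      intro t ht hu
      have ht' : t ∈ Icc σ (σ + C) := ⟨ht.1, ht.2.trans hT.2⟩
      have e1 := (hgrow t ht' (fun τ hτ => hsT τ ⟨hτ.1, hτ.2.trans ht.2⟩) hu).1
      have e2 := (abs_le.1 (hnoise t ht')).1
      rw [corr_eq w n t]; linarith
    have hp := pos_of_nonneg_imp_pos (f := fun t => corr lam v (w t)) (a := σ) (b := T)
      (by fun_prop) (lt_of_lt_of_le (by positivity) h1)
      fun t ht hu => lt_trans (by positivity) (step t ht hu)
    exact (step T ⟨hT.1, le_rfl⟩ fun τ hτ => (hp τ hτ).le).le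
  have hhit : ∃ τ ∈ Icc σ (σ + C), 1 / 3 ≤ qnorm lam (w τ) := by
    by_contra! hcon
    have hsT : ∀ t ∈ Icc σ (σ + C), qnorm lam (w t) ≤ 1 / 3 := fun t ht => (hcon t ht).le
    have hT : σ + C ∈ Icc σ (σ + C) := ⟨by linarith, le_rfl⟩
    have hlow : ∀ t ∈ Icc σ (σ + C), g / 2 * l ≤ corr lam v (w t) := fun t ht =>
      hpos t ht fun τ hτ => hsT τ ⟨hτ.1, hτ.2.trans ht.2⟩
    have e1 := (hgrow _ hT hsT fun t ht => le_trans (by positivity) (hlow t ht)).2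
      (g / 2 * l) (by positivity) hlow
    have e2 := (abs_le.1 (hnoise _ hT)).1
    have e3 := corr_sq_le_qnorm h.toIsNormalized (w (σ + C))
    have e4 := hsT _ hT
    have e5 : 1 ≤ g * (g / 2 * l) * (σ + C - σ) := by
      have : g * (g / 2 * (g ^ 2 / 20000)) * C = 1 := by rw [hC]; field_simp; norm_num
      have e6 : g * (g / 2 * (g ^ 2 / 20000)) * C ≤ g * (g / 2 * l) * C := by gcongr
      rw [add_sub_cancel_left]; linarith
    rw [corr_eq w n] at e3
    nlinarith
  obtain ⟨τ, hτ, hτs⟩ := hhit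
  obtain ⟨t, ht, e1, e2⟩ := exists_first_hit (f := fun t => qnorm lam (w t)) hτ.1 (by fun_prop)
    (by rw [hsσ]; linarith) hτs
  have ht' : t ∈ Icc σ (σ + C) := ⟨ht.1, ht.2.trans hτ.2⟩
  refine ⟨t, hσ0.trans ht.1, by linarith [ht'.2], e1, ?_, ?_⟩
  · refine le_trans ?_ (hpos t ht' e2)
    have := mul_le_mul_of_nonneg_left hlge (half_pos hg).le
    calc g ^ 3 / 40000 = g / 2 * (g ^ 2 / 20000) := by ring
      _ ≤ _ := this
  · have := h.norm_sq_le h.toIsNormalized hσ0 ht.1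
    linarith [ht'.2]

end IsEscape

/-! ### From the initial point to the basin of the teacher -/

section basin
variable {d : ℕ} {lam v : Fin d → ℝ} {w : ℝ → Fin d → ℝ} {i₀ : Fin d} {ρ g θ : ℝ}

/-- After an initial time `t₀` during which `s` is negligible, the student is close to the unstable
direction: the component along it grows faster, by a factor `exp (g t₀)`, than the residual. -/
lemma IsFlow.exists_isEscape (h : IsFlow lam v w) (hn : IsNormalized lam v)
    (hm : IsMode lam v i₀ ρ) (hg : 0 < g) (hgap : g ≤ ρ - 4 * lam i₀)
    (hg2 : g / 8 ≤ wdot (lam * lam) v v) (hθ : 0 < θ) (hθ' : θ ≤ g / 8) {s₀ S t₀ : ℝ}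
    (ht₀ : 0 ≤ t₀) (hs₀ : qnorm lam (w 0) ≤ s₀) (hS : ∀ t ∈ Icc 0 t₀, qnorm lam (w t) ≤ S)
    (h1 : S ≤ g / 72) (hl : 0 < modeCoord ρ lam v (w 0))
    (h2 : 6 * S * t₀ ≤ modeCoord ρ lam v (w 0)) (h3 : (480 + 1728 / g) * S ^ 2 * t₀ ≤ 12 * s₀)
    (h4 : 24 * s₀ ≤ θ ^ 2 * modeCoord ρ lam v (w 0) ^ 2 * Real.exp (2 * g * t₀)) :
    (∃ n, IsEscape lam v (fun t => w (t₀ + t)) i₀ ρ g θ n) ∧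
      modeCoord ρ lam v (w 0) / 2 ≤ modeCoord ρ lam v (w t₀) := by
  have hρ := hm.rho_pos hn
  have hS0 : 0 ≤ S := (qnorm_nonneg hn _).trans (hS 0 ⟨le_rfl, ht₀⟩)
  have hl2 : modeCoord ρ lam v (w 0) / 2 * Real.exp (ρ * t₀) ≤ modeCoord ρ lam v (w t₀) := by
    refine le_trans (mul_le_mul_of_nonneg_right ?_ (Real.exp_pos _).le)
      (h.modeCoord_ge hn hm ht₀ hS)
    have e1 : √(2 * (S / (ρ - 4 * lam i₀))) ≤ 1 := by
      refine Real.sqrt_le_iff.2 ⟨zero_le_one, ?_⟩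
      rw [one_pow, ← mul_div_assoc, div_le_one (hm.sub_pos i₀)]
      linarith
    have e2 : 3 * S * √(2 * (S / (ρ - 4 * lam i₀))) * t₀ ≤ 3 * S * 1 * t₀ := by gcongr
    linarith
  have hl3 : modeCoord ρ lam v (w 0) / 2 ≤ modeCoord ρ lam v (w t₀) := by
    refine le_trans ?_ hl2
    have : 1 ≤ Real.exp (ρ * t₀) := Real.one_le_exp (by positivity)
    nlinarith
  have hlt : 0 < modeCoord ρ lam v (w t₀) := by linarith
  have hr : qnorm lam (modeResidual ρ lam v (w t₀)) ≤ (θ * modeCoord ρ lam v (w t₀)) ^ 2 := by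
    have e1 := h.linForm_residual_le hn hm ht₀ hS
    have e2 := qnorm_le_linForm (lam := lam) (v := v) (modeResidual ρ lam v (w t₀))
    have e3 : (480 + 1728 / (ρ - 4 * lam i₀)) * S ^ 2 * t₀ ≤ (480 + 1728 / g) * S ^ 2 * t₀ := by
      gcongr
    have e4 : qnorm lam (modeResidual ρ lam v (w t₀)) ≤ 6 * s₀ * Real.exp (8 * lam i₀ * t₀) := by
      have : (12 * qnorm lam (w 0) + (480 + 1728 / (ρ - 4 * lam i₀)) * S ^ 2 * t₀) *
          Real.exp (8 * lam i₀ * t₀) ≤ (24 * s₀) * Real.exp (8 * lam i₀ * t₀) :=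
        mul_le_mul_of_nonneg_right (by linarith) (Real.exp_pos _).le
      linarith
    have e5 : Real.exp (2 * g * t₀) * Real.exp (8 * lam i₀ * t₀) ≤ Real.exp (ρ * t₀) ^ 2 := by
      rw [← Real.exp_add, ← Real.exp_nat_mul]
      refine Real.exp_le_exp.2 ?_
      have := mul_le_mul_of_nonneg_right hgap ht₀
      push_cast
      linarith
    calc _ ≤ 6 * s₀ * Real.exp (8 * lam i₀ * t₀) := e4
      _ ≤ 6 * (θ ^ 2 * modeCoord ρ lam v (w 0) ^ 2 * Real.exp (2 * g * t₀) / 24) *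
          Real.exp (8 * lam i₀ * t₀) := by gcongr; linarith
      _ = θ ^ 2 * (modeCoord ρ lam v (w 0) / 2) ^ 2 *
          (Real.exp (2 * g * t₀) * Real.exp (8 * lam i₀ * t₀)) := by ring
      _ ≤ θ ^ 2 * (modeCoord ρ lam v (w 0) / 2) ^ 2 * Real.exp (ρ * t₀) ^ 2 := by gcongr
      _ = (θ * (modeCoord ρ lam v (w 0) / 2 * Real.exp (ρ * t₀))) ^ 2 := by ring
      _ ≤ _ := by gcongr
  refine ⟨?_, hl3⟩
  have hshift := h.shift ht₀
  obtain ⟨n, hnc, hn0, hnd, hns⟩ := exists_remainder hshift.cont hn hm.top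
    (modeResidual ρ lam v (w t₀))
  have e0 : w (t₀ + 0) = w t₀ := by rw [add_zero]
  refine ⟨n, { hshift, hn, hm with
    g_pos := hg, g_le_gap := hgap, g_le := hg2, n_cont := hnc, n_deriv := hnd, θ_pos := hθ,
    θ_le := hθ', n_small := fun t ht => ?_, init := ?_, coord_pos := ?_, small := ?_ }⟩
  · refine (hns t ht).trans ?_
    rw [e0, mul_pow _ (Real.exp _)]
    exact mul_le_mul_of_nonneg_right hr (sq_nonneg _)
  · rw [e0, hn0, modeResidual, sub_sub_cancel]
  · rw [e0]; exact hlt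
  · rw [e0]; exact (hS t₀ ⟨ht₀, le_rfl⟩).trans h1

/-- While `s` stays below `S`, the Euclidean norm grows slowly. -/
lemma IsFlow.norm_sq_le_of_qnorm_le (h : IsFlow lam v w) (hn : IsNormalized lam v) {S t₀ : ℝ}
    (ht₀ : 0 ≤ t₀) (hS : ∀ t ∈ Icc 0 t₀, qnorm lam (w t) ≤ S) :
    wdot 1 (w t₀) (w t₀) ≤ wdot 1 (w 0) (w 0) + 24 * S * t₀ := by
  have hc := h.cont
  have := le_of_hasDerivAt_nonneg (f := fun t => 24 * S * t - wdot 1 (w t) (w t)) ht₀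
    (by fun_prop) (fun t ht => ((hasDerivAt_id t).const_mul _).sub (h.hasDerivAt_norm_sq ht.1))
    (fun t ht => by
      have e1 := corr_sq_le_qnorm hn (w t)
      have e2 := hS t ⟨ht.1.le, ht.2.le⟩
      nlinarith [sq_nonneg (qnorm lam (w t))])
  linarith

/-- A student with `s = 1 / 3` and positive correlation is beyond the barrier: its correlation
never drops below its present value, because `3 s² - 2 s` is minimal at `s = 1 / 3`. -/
lemma IsFlow.corr_ge_of_qnorm_eq (h : IsFlow lam v w) {cu : ℝ} (hcu : 0 < cu)
    (hs : qnorm lam (w 0) = 1 / 3) (hu : cu ≤ corr lam v (w 0)) :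
    ∀ t, 0 ≤ t → cu ≤ corr lam v (w t) := by
  refine h.corr_ge_of_sq_ge hcu (hcu.trans_le hu) fun t ht => ?_
  have h1 := h.lossUS_antitone le_rfl ht
  simp only [lossUS, hs] at h1
  nlinarith [sq_nonneg (3 * qnorm lam (w t) - 1)]

end basin

lemma eventually_log_le {δ r : ℝ} (hδ : 0 < δ) (hr : 0 < r) :
    ∀ᶠ d : ℕ in atTop, Real.log d ≤ δ * (d : ℝ) ^ r := by
  have := (isLittleO_log_rpow_atTop hr).bound hδ
  filter_upwards [tendsto_natCast_atTop_atTop.eventually this] with d hd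
  have h2 : 0 ≤ (d : ℝ) ^ r := by positivity
  rw [Real.norm_of_nonneg h2] at hd
  exact (le_abs_self _).trans hd

lemma eventually_le_rpow (C : ℝ) {r : ℝ} (hr : 0 < r) :
    ∀ᶠ d : ℕ in atTop, C ≤ (d : ℝ) ^ r :=
  ((tendsto_rpow_atTop hr).comp tendsto_natCast_atTop_atTop).eventually_ge_atTop C

lemma eventually_le_log (C : ℝ) : ∀ᶠ d : ℕ in atTop, C ≤ Real.log d :=
  (Real.tendsto_log_atTop.comp tendsto_natCast_atTop_atTop).eventually_ge_atTop C

lemma exists_rpow_le {a : ℝ} (ha : 1 < a) (C : ℝ) {δ : ℝ} (hδ : 0 < δ) :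
    ∃ q : ℕ, 1 ≤ q ∧ C * (q : ℝ) ^ (1 - a) ≤ δ := by
  obtain ⟨q, hq, hq1⟩ := ((eventually_le_rpow (C / δ) (r := a - 1) (by linarith)).and
    (eventually_ge_atTop 1)).exists
  refine ⟨q, hq1, ?_⟩
  have hq0 : (0 : ℝ) < q := by exact_mod_cast hq1
  rw [div_le_iff₀ hδ] at hq
  rw [show 1 - a = -(a - 1) by ring, Real.rpow_neg hq0.le, ← div_eq_mul_inv,
    div_le_iff₀ (by positivity)]
  linarith

/-- Data of the problem after the probabilistic estimates: a regular teacher, an initial point of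
unit norm with `s` of order `1 / d` and unstable coordinate of order at least `d ^ (-1 / 2)`. -/
structure IsInitial {d : ℕ} (a c M l₀ : ℝ) (lam v : Fin d → ℝ) (w : ℝ → Fin d → ℝ) (i₀ : Fin d)
    (ρ : ℝ) : Prop extends IsRegular a M l₀ lam v, IsMode lam v i₀ ρ, IsFlow lam v w where
  index : (i₀ : ℕ) = 0
  norm_eq : wdot 1 (w 0) (w 0) = 1
  qnorm_le : qnorm lam (w 0) ≤ M / d
  coord_ge : c * (d : ℝ) ^ (-(1 / 2 : ℝ)) ≤ modeCoord ρ lam v (w 0)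
  first_ge : c ≤ |v i₀|

/-- The quantities attached to the first coordinate are bounded below independently of the dimension
and of the regularity of the teacher. -/
lemma IsInitial.le_first {d : ℕ} {a c M l₀ : ℝ} {lam v : Fin d → ℝ} {w : ℝ → Fin d → ℝ} {i₀ : Fin d}
    {ρ : ℝ} (hc : 0 < c) (hl₀ : 0 < l₀) (h : IsInitial a c M l₀ lam v w i₀ ρ) :
    l₀ ≤ lam i₀ ∧ l₀ ^ 2 * c ^ 2 ≤ lam i₀ ^ 2 * v i₀ ^ 2 := by
  have h1 := h.le_lam i₀
  rw [h.index, Nat.cast_zero, zero_add, Real.one_rpow, mul_one] at h1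
  refine ⟨h1, ?_⟩
  have h2 := h.first_ge
  rw [← sq_abs (v i₀)]
  gcongr

set_option maxHeartbeats 1000000 in
/-- The student enters the basin of the teacher, with bounded norm, within a time of order `log d`;
the constant in front of the logarithm does not depend on the regularity of the teacher. -/
theorem exists_isLate {a c l₀ : ℝ} (ha : 1 < a) (hc : 0 < c) (hl₀ : 0 < l₀) :
    ∃ K₁ : ℝ, 0 < K₁ ∧ ∀ M : ℝ, 0 < M → ∃ N : ℝ, 0 ≤ N ∧ ∀ᶠ d : ℕ in atTop,
      ∀ (lam v : Fin d → ℝ) (w : ℝ → Fin d → ℝ) (i₀ : Fin d) (ρ : ℝ),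
        IsInitial a c M l₀ lam v w i₀ ρ →
          ∃ t ∈ Icc 0 (K₁ * Real.log d), IsLate N lam v (fun τ => w (t + τ)) := by
  set g := 8 * (l₀ ^ 2 * c ^ 2) with hg
  have hg0 : 0 < g := by positivity
  set θ := g * Real.exp (-(160000 / g ^ 4)) / 8 with hθ
  have hθ0 : 0 < θ := by positivity
  have hθ8 : θ ≤ g / 8 := by
    have : Real.exp (-(160000 / g ^ 4)) ≤ 1 := Real.exp_le_one_iff.2 (by
      have : 0 < 160000 / g ^ 4 := by positivity
      linarith)
    rw [hθ]; nlinarith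
  set cu := g ^ 3 / 40000 with hcu
  have hcu0 : 0 < cu := by positivity
  set N₁ := 2 + 1890000 / (l₀ * g ^ 4) + 6 * (40000 / g ^ 4) with hN₁
  have hN₁0 : 0 < N₁ := by positivity
  refine ⟨1 / 96 + 1 / (4 * l₀) + 1, by positivity, fun M hM => ?_⟩
  set τ := cu ^ 2 / 4032 with hτ
  have hτ0 : 0 < τ := by positivity
  -- A truncation index beyond which the teacher carries little `Q`-mass.
  obtain ⟨k, hk1, hk⟩ := exists_rpow_le ha M (pow_pos hτ0 2)
  set B := 2 * N₁ + 2 * (1 + (2 / cu) ^ 2) * (M * k) with hB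
  have hB0 : 0 < B := by positivity
  set T₃ := B * Real.exp (36 / (cu / 48) ^ 2) / 12 with hT₃
  have hT₃0 : 0 < T₃ := by positivity
  refine ⟨N₁ + 6 * T₃, by positivity, ?_⟩
  have hδ : 0 < min (c / M) (min (1152 / ((480 + 1728 / g) * M)) (4 / M)) := by
    have : 0 < 480 + 1728 / g := by positivity
    refine lt_min (by positivity) (lt_min (by positivity) (by positivity))
  filter_upwards [eventually_log_le hδ (r := 1 / 4) (by norm_num),
    eventually_le_rpow (72 * M / g) (r := 3 / 4) (by norm_num),
    eventually_le_rpow (24 * M / (c ^ 2 * θ ^ 2)) (r := g / 48) (by positivity),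
    eventually_le_rpow (16 / (g * c)) (r := 1 / 2) (by norm_num),
    eventually_le_log (40000 / g ^ 4 + T₃), eventually_ge_atTop 1] with d e1 e2 e3 e4 e5 hd1
  intro lam v w i₀ ρ h
  have hn := h.toIsNormalized
  have hm := h.toIsMode
  have hf := h.toIsFlow
  have hd : (1 : ℝ) ≤ d := by exact_mod_cast hd1
  have hd0 : (0 : ℝ) < d := by linarith
  have hlog : 0 ≤ Real.log d := Real.log_nonneg hd
  obtain ⟨hl1, hgv⟩ := h.le_first hc hl₀
  have hgap : g ≤ ρ - 4 * lam i₀ := by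
    have := hm.gap_ge hn; rw [hg]; linarith
  have hg2 : g / 8 ≤ wdot (lam * lam) v v := by
    have : (lam * lam) i₀ * v i₀ * v i₀ ≤ wdot (lam * lam) v v :=
      Finset.single_le_sum (f := fun i => (lam * lam) i * v i * v i)
        (fun i _ => by rw [mul_assoc]; exact mul_nonneg (mul_self_nonneg _) (mul_self_nonneg _))
        (Finset.mem_univ i₀)
    simp only [Pi.mul_apply] at this
    rw [hg]; linarith
  -- During this time `s` grows at most by the factor `exp (24 t₀) = d ^ (1 / 4)`.
  set t₀ := Real.log d / 96 with ht₀
  have ht₀0 : 0 ≤ t₀ := by positivity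
  set S := M * (d : ℝ) ^ (-(3 / 4) : ℝ) with hS
  have hS0 : 0 < S := by positivity
  have hSt : ∀ t ∈ Icc 0 t₀, qnorm lam (w t) ≤ S := by
    intro t ht
    refine (hf.qnorm_le_exp hn ht.1).trans ?_
    have h1 : Real.exp (24 * t) ≤ (d : ℝ) ^ (1 / 4 : ℝ) := by
      rw [Real.rpow_def_of_pos hd0]
      refine Real.exp_le_exp.2 ?_
      have := ht.2; rw [ht₀] at this; linarith
    calc qnorm lam (w 0) * Real.exp (24 * t) ≤ M / d * (d : ℝ) ^ (1 / 4 : ℝ) :=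
          mul_le_mul h.qnorm_le h1 (Real.exp_pos _).le (by positivity)
      _ = S := by
        rw [hS, div_eq_mul_inv, ← Real.rpow_neg_one, mul_assoc, ← Real.rpow_add hd0]; norm_num
  -- The only use of `log d` being small compared with powers of `d`.
  have hSlog : ∀ δ : ℝ, min (c / M) (min (1152 / ((480 + 1728 / g) * M)) (4 / M)) ≤ δ / M →
      S * t₀ ≤ δ / 96 * (d : ℝ) ^ (-(1 / 2) : ℝ) := by
    intro δ hδ'
    have h1 : Real.log d ≤ δ / M * (d : ℝ) ^ (1 / 4 : ℝ) :=
      e1.trans (mul_le_mul_of_nonneg_right hδ' (by positivity))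
    calc S * t₀ = M * (d : ℝ) ^ (-(3 / 4) : ℝ) / 96 * Real.log d := by rw [hS, ht₀]; ring
      _ ≤ M * (d : ℝ) ^ (-(3 / 4) : ℝ) / 96 * (δ / M * (d : ℝ) ^ (1 / 4 : ℝ)) := by gcongr
      _ = δ / 96 * ((d : ℝ) ^ (-(3 / 4) : ℝ) * (d : ℝ) ^ (1 / 4 : ℝ)) := by field_simp
      _ = _ := by rw [← Real.rpow_add hd0]; norm_num
  have hSd : S * (d : ℝ) ^ (-(1 / 2) : ℝ) ≤ M / d := by
    have h1 : M / d = M * (d : ℝ) ^ (-1 : ℝ) := by rw [Real.rpow_neg_one]; rfl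
    rw [hS, mul_assoc, ← Real.rpow_add hd0, h1]
    exact mul_le_mul_of_nonneg_left (Real.rpow_le_rpow_of_exponent_le hd (by norm_num)) hM.le
  have hle1 : (d : ℝ) ^ (-(1 / 2) : ℝ) ≤ 1 := Real.rpow_le_one_of_one_le_of_nonpos hd (by norm_num)
  have hpos : 0 < (d : ℝ) ^ (-(1 / 2) : ℝ) := by positivity
  have hcoord := h.coord_ge
  rw [show (-(1 / 2 : ℝ)) = (-(1 / 2) : ℝ) from rfl] at hcoord
  have hl : 0 < modeCoord ρ lam v (w 0) := lt_of_lt_of_le (by positivity) hcoord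
  have hS72 : S ≤ g / 72 := by
    rw [hS, Real.rpow_neg hd0.le, ← div_eq_mul_inv, div_le_iff₀ (by positivity)]
    rw [div_le_iff₀ hg0] at e2; linarith
  obtain ⟨⟨n, hesc⟩, hl2⟩ := hf.exists_isEscape hn hm hg0 hgap hg2 hθ0 hθ8 ht₀0 h.qnorm_le hSt
    hS72 hl
    (by
      have := hSlog c (min_le_left _ _)
      have h2 : 0 < c * (d : ℝ) ^ (-(1 / 2) : ℝ) := by positivity
      linarith)
    (by
      have hG : 0 < 480 + 1728 / g := by positivity
      have h1 := hSlog (1152 / (480 + 1728 / g)) (by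
        rw [div_div]; exact (min_le_right _ _).trans (min_le_left _ _))
      have h2 := mul_le_mul_of_nonneg_left h1 (mul_pos hG hS0).le
      have h3 : (480 + 1728 / g) * S * (1152 / (480 + 1728 / g) / 96 * (d : ℝ) ^ (-(1 / 2) : ℝ)) =
          12 * (S * (d : ℝ) ^ (-(1 / 2) : ℝ)) := by field_simp; norm_num
      nlinarith)
    (by
      have h1 : Real.exp (2 * g * t₀) = (d : ℝ) ^ (g / 48) := by
        rw [Real.rpow_def_of_pos hd0, ht₀]; congr 1; ring
      have h2 : c ^ 2 * (d : ℝ)⁻¹ ≤ modeCoord ρ lam v (w 0) ^ 2 := by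
        have := pow_le_pow_left₀ (by positivity) hcoord 2
        rw [mul_pow, ← Real.rpow_natCast ((d : ℝ) ^ _), ← Real.rpow_mul hd0.le] at this
        norm_num [Real.rpow_neg_one] at this
        exact this
      rw [h1]
      rw [div_le_iff₀ (by positivity)] at e3
      calc 24 * (M / d) = 24 * M * (d : ℝ)⁻¹ := by ring
        _ ≤ (d : ℝ) ^ (g / 48) * (c ^ 2 * θ ^ 2) * (d : ℝ)⁻¹ := by gcongr
        _ = θ ^ 2 * (c ^ 2 * (d : ℝ)⁻¹) * (d : ℝ) ^ (g / 48) := by ring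
        _ ≤ _ := by gcongr)
  obtain ⟨t₁, ht₁0, ht₁, hs₁, hu₁, hw₁⟩ := hesc.exists_qnorm_eq le_rfl
  simp only [add_zero] at ht₁ hw₁
  have hw₀ := hf.norm_sq_le_of_qnorm_le hn ht₀0 hSt
  have hlp := h.pos i₀
  have hN : wdot 1 (w (t₀ + t₁)) (w (t₀ + t₁)) ≤ N₁ := by
    have h1 := hSlog 4 ((min_le_right _ _).trans (min_le_right _ _))
    have h2 : 1890000 / (lam i₀ * g ^ 4) ≤ 1890000 / (l₀ * g ^ 4) := by gcongr
    rw [h.norm_eq] at hw₀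
    rw [hN₁]; linarith
  have htime : t₁ ≤ Real.log d / (4 * l₀) + 40000 / g ^ 4 := by
    refine ht₁.trans (add_le_add ?_ le_rfl)
    have h1 : Real.log (8 / (g * modeCoord ρ lam v (w t₀))) ≤ Real.log d := by
      refine Real.log_le_log (by
        have := hesc.coord_pos; simp only [add_zero] at this; positivity) ?_
      have h3 : c * (d : ℝ) ^ (-(1 / 2) : ℝ) / 2 ≤ modeCoord ρ lam v (w t₀) := by linarith
      have h4 : (d : ℝ) ^ (1 / 2 : ℝ) * (d : ℝ) ^ (1 / 2 : ℝ) = d := by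
        rw [← Real.rpow_add hd0]; norm_num
      have h5 : (d : ℝ) ^ (-(1 / 2) : ℝ) * (d : ℝ) ^ (1 / 2 : ℝ) = 1 := by
        rw [← Real.rpow_add hd0]; norm_num
      calc 8 / (g * modeCoord ρ lam v (w t₀)) ≤ 8 / (g * (c * (d : ℝ) ^ (-(1 / 2) : ℝ) / 2)) := by
            gcongr
        _ = 16 / (g * c) * (d : ℝ) ^ (1 / 2 : ℝ) := by
            rw [div_eq_iff (by positivity)]; field_simp; linear_combination (-16) * h5
        _ ≤ (d : ℝ) ^ (1 / 2 : ℝ) * (d : ℝ) ^ (1 / 2 : ℝ) := by gcongr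
        _ = d := h4
    calc _ ≤ Real.log d / (4 * lam i₀) := by gcongr
      _ ≤ _ := by gcongr
  have hf₂ := (hf.shift ht₀0).shift ht₁0
  have hs₁' : qnorm lam ((fun t => w (t₀ + (t₁ + t))) 0) = 1 / 3 := by simpa using hs₁
  have hu₁' : cu ≤ corr lam v ((fun t => w (t₀ + (t₁ + t))) 0) := by simpa using hu₁
  have hu := hf₂.corr_ge_of_qnorm_eq hcu0 hs₁' hu₁'
  have hN' : wdot 1 ((fun t => w (t₀ + (t₁ + t))) 0) ((fun t => w (t₀ + (t₁ + t))) 0) ≤ N₁ := by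
    simpa using hN
  have hloss := hf₂.lossUS_le_of_corr_ge (k := k) (τ := τ) (B := B) hn hcu0 hu
    (by simp only [lossUS, hs₁']; nlinarith) hτ0.le ((h.tail_le k hk1).trans hk)
    (by rw [hτ]; linarith) hB0 (by
      intro α hα
      have h1 := h.head_le k hk1
      have h2 : α ^ 2 ≤ 1 + (2 / cu) ^ 2 := by
        have := sq_nonneg (2 / cu)
        rcases hα with rfl | rfl <;> linarith
      have h3 : α ^ 2 * wdot (headW k) v v ≤ (1 + (2 / cu) ^ 2) * (M * k) :=
        mul_le_mul h2 h1 (wdot_self_nonneg headW_nonneg v) (by positivity)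
      rw [hB]; linarith)
  refine ⟨t₀ + (t₁ + T₃), ⟨by positivity, ?_⟩, ?_⟩
  · have : (1 / 96 + 1 / (4 * l₀) + 1) * Real.log d =
        t₀ + Real.log d / (4 * l₀) + Real.log d := by rw [ht₀]; ring
    linarith
  · refine { hf.shift (t₀ := t₀ + (t₁ + T₃)) (by positivity) with
      loss_le := by simpa using hloss
      corr_pos := by simpa using hcu0.trans_le (hu T₃ hT₃0.le)
      norm_le := ?_ }
    have := hf₂.norm_sq_le hn le_rfl hT₃0.le
    simp only [add_zero, sub_zero] at this ⊢
    linarith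

/-! ### The accurate time -/

lemma IsAccurate.mono {d : ℕ} {lam v x : Fin d → ℝ} {ε ε' : ℝ} (h : IsAccurate ε lam v x)
    (hε : ε ≤ ε') : IsAccurate ε' lam v x :=
  ⟨⟨by linarith [h.1.1], h.1.2⟩, ⟨by linarith [h.2.1], h.2.2⟩⟩

/-- In the basin, accuracy `ε` is reached by a time of order `ε ^ (-a / (a - 1))`; up to then only
the first `ε ^ (-1 / (a - 1))` coordinates, a number of order at most `√d`, have contributed to
the Euclidean norm of the student and to its Euclidean overlap with the teacher. -/
theorem IsLate.exists_accurate_time {a M l₀ N c₀ : ℝ} (ha : 1 < a) (hM : 1 ≤ M) (hl₀ : 0 < l₀)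
    (hN : 0 ≤ N) (hc₀ : 0 < c₀) :
    ∃ C : ℝ, 0 < C ∧ ∀ᶠ d : ℕ in atTop, ∀ (lam v : Fin d → ℝ) (w : ℝ → Fin d → ℝ),
      IsRegular a M l₀ lam v → IsLate N lam v w → ∀ ε : ℝ,
        c₀ * (d : ℝ) ^ (-((a - 1) / 2)) ≤ ε → ε < 1 →
          ∃ t ∈ Icc 0 (C * ε ^ (-(a / (a - 1)))), IsAccurate ε lam v (w t) ∧
            ∀ τ ∈ Icc 0 t, wdot 1 (w τ) (w τ) ≤ C * (d : ℝ) ^ (1 / 2 : ℝ) ∧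
              |wdot 1 (w τ) v| ≤ |wdot 1 (w 0) v| + C * (d : ℝ) ^ (1 / 2 : ℝ) := by
  have hM0 : 0 < M := by linarith
  have ha1 : 0 < a - 1 := by linarith
  obtain ⟨q, hq1, hq⟩ := exists_rpow_le ha ((2 * N + 65 * M) / l₀) (δ := 1 / (2 * M))
    (by positivity)
  set Z := 4 * M * ((11 * √N + √(4 * N + 132 * M)) * √(27 * M * q)) with hZ
  obtain ⟨B, hBge⟩ := exists_nat_ge (max 2 (max M (Z ^ 2 + 1)))
  have hB2 : 2 ≤ B := by exact_mod_cast (le_max_left _ _).trans hBge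
  have hBM : M ≤ B := (le_max_left _ _).trans ((le_max_right _ _).trans hBge)
  have hBZ : Z < √B := by
    have : Z ^ 2 + 1 ≤ B := (le_max_right _ _).trans ((le_max_right _ _).trans hBge)
    exact Real.lt_sqrt_of_sq_lt (by linarith)
  have hq0 : (0 : ℝ) < q := by exact_mod_cast hq1
  have hB0 : (0 : ℝ) < B := by linarith
  set C₅ := 100 * (2 * N + 65 * M) with hC₅
  have hC₅1 : 1 ≤ C₅ := by rw [hC₅]; linarith
  have hC₅0 : 0 < C₅ := by linarith
  set X := 2 * (C₅ / c₀) ^ (1 / (a - 1)) with hX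
  have hX0 : 0 < X := by positivity
  set C₁ := (4 * N + 132 * M) * (q * B * X) with hC₁
  set C₂ := (12 * N + 400 * M) * (q * B * X) with hC₂
  set C₃ := (q * B) ^ a * (2 ^ a * C₅ ^ (a / (a - 1))) with hC₃
  have hC₁0 : 0 < C₁ := by positivity
  have hC₂0 : 0 < C₂ := by positivity
  have hC₃0 : 0 < C₃ := by positivity
  refine ⟨C₁ + C₂ + C₃, by positivity, ?_⟩
  filter_upwards [eventually_le_rpow (B * X) (r := 1 / 2) (by norm_num), eventually_ge_atTop 1]
    with d e1 hd1 lam v w hr h ε hε hε1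
  have hd0 : (0 : ℝ) < d := by exact_mod_cast hd1
  have hε0 : 0 < ε := lt_of_lt_of_le (by positivity) hε
  -- The number of coordinates to be learned, from `C₅ k ^ (1 - a) = ε`; by the lower bound on `ε`
  -- it is at most of order `√d`.
  set x := (C₅ / ε) ^ (1 / (a - 1)) with hx
  have hx1 : 1 ≤ x := by
    refine Real.one_le_rpow ?_ (by positivity)
    rw [le_div_iff₀ hε0]; linarith
  set k := ⌈x⌉₊ with hk
  have hkx : x ≤ k := Nat.le_ceil x
  have hk2 : (k : ℝ) ≤ 2 * x := by
    have := Nat.ceil_lt_add_one (show 0 ≤ x by linarith); linarith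
  have hk1 : 1 ≤ k := by
    have : (1 : ℝ) ≤ k := hx1.trans hkx
    exact_mod_cast this
  have hxX : 2 * x ≤ X * (d : ℝ) ^ (1 / 2 : ℝ) := by
    have h1 : C₅ / ε ≤ C₅ / c₀ * (d : ℝ) ^ ((a - 1) / 2) := by
      rw [div_le_iff₀ hε0]
      have : (d : ℝ) ^ ((a - 1) / 2) * (d : ℝ) ^ (-((a - 1) / 2)) = 1 := by
        rw [← Real.rpow_add hd0, add_neg_cancel, Real.rpow_zero]
      calc C₅ = C₅ / c₀ * (d : ℝ) ^ ((a - 1) / 2) * (c₀ * (d : ℝ) ^ (-((a - 1) / 2))) := by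
            field_simp; linear_combination (-1 : ℝ) * this
        _ ≤ _ := by gcongr
    have h2 : x ≤ (C₅ / c₀ * (d : ℝ) ^ ((a - 1) / 2)) ^ (1 / (a - 1)) :=
      Real.rpow_le_rpow (by positivity) h1 (by positivity)
    rw [Real.mul_rpow (by positivity) (by positivity), ← Real.rpow_mul hd0.le,
      show (a - 1) / 2 * (1 / (a - 1)) = 1 / 2 by field_simp] at h2
    rw [hX]; linarith
  have hkd : (k : ℝ) ≤ X * (d : ℝ) ^ (1 / 2 : ℝ) := hk2.trans hxX
  have hBd : B * k ≤ d := by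
    have h1 : (d : ℝ) ^ (1 / 2 : ℝ) * (d : ℝ) ^ (1 / 2 : ℝ) = d := by
      rw [← Real.rpow_add hd0]; norm_num
    have : (B : ℝ) * k ≤ d := by
      calc (B : ℝ) * k ≤ B * (X * (d : ℝ) ^ (1 / 2 : ℝ)) := by gcongr
        _ = B * X * (d : ℝ) ^ (1 / 2 : ℝ) := by ring
        _ ≤ (d : ℝ) ^ (1 / 2 : ℝ) * (d : ℝ) ^ (1 / 2 : ℝ) := by gcongr
        _ = d := h1
    exact_mod_cast this
  obtain ⟨t, ht, hacc⟩ := h.exists_isAccurate hr ha hN hM0 hl₀ hq1 hB2 hk1 hq hBM hBZ hBd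
  have hj1 : 1 ≤ q * B * k := Nat.one_le_iff_ne_zero.2 (by
    have : q ≠ 0 := by omega
    have : B ≠ 0 := by omega
    have : k ≠ 0 := by omega
    positivity)
  have hj : ((q * B * k : ℕ) : ℝ) ≤ q * B * X * (d : ℝ) ^ (1 / 2 : ℝ) := by
    push_cast
    calc (q : ℝ) * B * k ≤ q * B * (X * (d : ℝ) ^ (1 / 2 : ℝ)) := by gcongr
      _ = _ := by ring
  have hdh : 0 < (d : ℝ) ^ (1 / 2 : ℝ) := by positivity
  refine ⟨t, ⟨ht.1, ht.2.trans ?_⟩, hacc.mono ?_, fun τ hτ => ⟨?_, ?_⟩⟩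
  · have h1 : (k : ℝ) ^ a ≤ 2 ^ a * C₅ ^ (a / (a - 1)) * ε ^ (-(a / (a - 1))) := by
      calc (k : ℝ) ^ a ≤ (2 * x) ^ a := by gcongr
        _ = 2 ^ a * (C₅ / ε) ^ (a / (a - 1)) := by
          rw [Real.mul_rpow (by norm_num) (by linarith), hx, ← Real.rpow_mul (by positivity)]
          congr 2; field_simp
        _ = _ := by
          rw [Real.div_rpow hC₅0.le hε0.le, Real.rpow_neg hε0.le]; field_simp
    have h2 : (((q * B * k : ℕ) : ℝ)) ^ a = ((q : ℝ) * B) ^ a * (k : ℝ) ^ a := by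
      rw [Nat.cast_mul, Real.mul_rpow (by positivity) (by positivity), Nat.cast_mul]
    have h3 : 0 < ε ^ (-(a / (a - 1))) := by positivity
    calc _ = ((q : ℝ) * B) ^ a * (k : ℝ) ^ a := h2
      _ ≤ ((q : ℝ) * B) ^ a * (2 ^ a * C₅ ^ (a / (a - 1)) * ε ^ (-(a / (a - 1)))) := by gcongr
      _ = C₃ * ε ^ (-(a / (a - 1))) := by rw [hC₃]; ring
      _ ≤ _ := by gcongr; linarith
  · have h1 : (k : ℝ) ^ (1 - a) ≤ x ^ (1 - a) :=
      Real.rpow_le_rpow_of_nonpos (by linarith) hkx (by linarith)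
    have h2 : x ^ (1 - a) = ε / C₅ := by
      rw [hx, ← Real.rpow_mul (by positivity), show 1 / (a - 1) * (1 - a) = -1 by
        field_simp; ring, Real.rpow_neg_one, inv_div]
    rw [h2, le_div_iff₀ hC₅0] at h1
    linarith
  · refine (h.norm_sq_le_mul hr hN hM0.le hj1 hτ.1 (hτ.2.trans ht.2)).trans ?_
    calc (4 * N + 132 * M) * ((q * B * k : ℕ) : ℝ)
        ≤ (4 * N + 132 * M) * (q * B * X * (d : ℝ) ^ (1 / 2 : ℝ)) := by gcongr
      _ = C₁ * (d : ℝ) ^ (1 / 2 : ℝ) := by rw [hC₁]; ring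
      _ ≤ _ := by gcongr; linarith
  · refine (h.abs_wdot_one_le hr hN hM0.le hj1 hτ.1 (hτ.2.trans ht.2)).trans ?_
    refine add_le_add le_rfl ?_
    calc (12 * N + 400 * M) * ((q * B * k : ℕ) : ℝ)
        ≤ (12 * N + 400 * M) * (q * B * X * (d : ℝ) ^ (1 / 2 : ℝ)) := by gcongr
      _ = C₂ * (d : ℝ) ^ (1 / 2 : ℝ) := by rw [hC₂]; ring
      _ ≤ _ := by gcongr; linarith

/-- The gap between the exponents `p` and `2 p` absorbs every constant. -/
lemma eventually_mul_rpow_le (C : ℝ) {p : ℝ} (hp : 0 < p) (hC : 0 < C) :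
    ∀ᶠ d : ℕ in atTop, ∀ ε : ℝ, 0 < ε → ε < 1 →
      C * ε ^ (-p) ≤ Real.log d + ε ^ (-(2 * p)) * Real.log (1 / ε) := by
  set D := max C (Real.exp p) with hD
  have hD0 : 0 < D := lt_of_lt_of_le hC (le_max_left _ _)
  filter_upwards [eventually_le_log (C * D)] with d hd ε hε hε1
  have hlog : 0 < Real.log (1 / ε) := Real.log_pos (by rw [lt_div_iff₀ hε]; linarith)
  have hy : 0 < ε ^ (-p) := by positivity
  have h2 : ε ^ (-(2 * p)) = ε ^ (-p) * ε ^ (-p) := by rw [← Real.rpow_add hε]; ring_nf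
  have hz : 0 < ε ^ (-(2 * p)) := by positivity
  rcases le_total (ε ^ (-p)) D with h | h
  · have : C * ε ^ (-p) ≤ C * D := by gcongr
    have := mul_pos hz hlog
    linarith
  · have h3 : p ≤ p * Real.log (1 / ε) := by
      have h4 : Real.log (ε ^ (-p)) = p * Real.log (1 / ε) := by
        rw [Real.log_rpow hε, one_div, Real.log_inv]; ring
      rw [← h4, Real.le_log_iff_exp_le hy]
      exact (le_max_right _ _).trans h
    have h5 : 1 ≤ Real.log (1 / ε) := by
      by_contra! hc
      nlinarith
    have h6 : C * ε ^ (-p) ≤ ε ^ (-p) * ε ^ (-p) :=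
      mul_le_mul_of_nonneg_right ((le_max_left _ _).trans h) hy.le
    have h7 : 0 ≤ Real.log d := (mul_pos hC hD0).le.trans hd
    rw [h2]
    nlinarith [mul_pos hy hy]

lemma wdot_one_eq_head {d : ℕ} (x y : Fin d → ℝ) : wdot 1 x y = wdot (headW d) x y := by
  have : (headW d : Fin d → ℝ) = 1 := by ext i; simp [headW]
  rw [this]

/-- The plateau estimate on coordinates: the accurate time, and the bound on the difference between
`‖w - v‖²` and `‖v‖²` until then. -/
theorem exists_accurate_time {a c l₀ c₀ : ℝ} (ha : 1 < a) (hc : 0 < c) (hl₀ : 0 < l₀)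
    (hc₀ : 0 < c₀) :
    ∃ K : ℝ, 0 < K ∧ ∀ M : ℝ, 1 ≤ M → ∀ᶠ d : ℕ in atTop,
      ∀ (lam v : Fin d → ℝ) (w : ℝ → Fin d → ℝ) (i₀ : Fin d) (ρ : ℝ),
        IsInitial a c M l₀ lam v w i₀ ρ → ∀ ε : ℝ, c₀ * (d : ℝ) ^ (-((a - 1) / 2)) ≤ ε → ε < 1 →
          ∃ t : ℝ, 0 ≤ t ∧
            t ≤ K * (Real.log d + ε ^ (-(2 * a / (a - 1))) * Real.log (1 / ε)) ∧
            IsAccurate ε lam v (w t) ∧ ∀ τ ∈ Icc 0 t,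
              wdot 1 (w τ) (w τ) + 2 * |wdot 1 (w τ) v| ≤ (d : ℝ) ^ (2 / 3 : ℝ) := by
  obtain ⟨K₁, hK₁, hbasin⟩ := exists_isLate ha hc hl₀
  refine ⟨K₁ + 1, by positivity, fun M hM => ?_⟩
  have hM0 : 0 < M := by linarith
  obtain ⟨N, hN, hbasin⟩ := hbasin M hM0
  obtain ⟨C, hC, hlate⟩ := IsLate.exists_accurate_time ha hM hl₀ hN hc₀
  have hp : 0 < a / (a - 1) := div_pos (by linarith) (by linarith)
  filter_upwards [hbasin, hlate, eventually_mul_rpow_le C hp hC,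
    eventually_log_le (δ := 1 / (12 * K₁)) (r := 1 / 4) (by positivity) (by norm_num),
    eventually_le_rpow 2 (r := 1 / 4) (by norm_num),
    eventually_le_rpow (1 + 2 * √M + 3 * C) (r := 1 / 24) (by norm_num),
    eventually_ge_atTop 1] with d hbasin hlate hslack e1 e2 e3 hd1 lam v w i₀ ρ h ε hε hε1
  have hd : (1 : ℝ) ≤ d := by exact_mod_cast hd1
  have hd0 : (0 : ℝ) < d := by linarith
  have hε0 : 0 < ε := lt_of_lt_of_le (by positivity) hε
  have hlog : 0 ≤ Real.log d := Real.log_nonneg hd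
  have hlogε : 0 < Real.log (1 / ε) := Real.log_pos (by rw [lt_div_iff₀ hε0]; linarith)
  obtain ⟨t₁, ht₁, hL⟩ := hbasin lam v w i₀ ρ h
  obtain ⟨t₂, ht₂, hacc, hbd⟩ := hlate lam v _ h.toIsRegular hL ε hε hε1
  have hgrow : ∀ τ ∈ Icc 0 t₁, wdot 1 (w τ) (w τ) ≤ (d : ℝ) ^ (1 / 4 : ℝ) := by
    intro τ hτ
    have h1 := h.toIsFlow.norm_sq_le h.toIsNormalized le_rfl hτ.1
    rw [h.norm_eq] at h1
    have h2 : K₁ * Real.log d ≤ (d : ℝ) ^ (1 / 4 : ℝ) / 12 := by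
      calc K₁ * Real.log d ≤ K₁ * (1 / (12 * K₁) * (d : ℝ) ^ (1 / 4 : ℝ)) := by gcongr
        _ = _ := by field_simp
    linarith [hτ.2, ht₁.2]
  -- Cauchy-Schwarz with `‖v‖² ≤ M d`; the exponent `5 / 8` is below the `2 / 3` of the plateau.
  have hoverlap : ∀ τ ∈ Icc 0 t₁, |wdot 1 (w τ) v| ≤ √M * (d : ℝ) ^ (5 / 8 : ℝ) := by
    intro τ hτ
    have h1 := abs_head_le h.toIsRegular hM0.le hd1 (by positivity) (hgrow τ hτ)
    rw [← wdot_one_eq_head] at h1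
    refine h1.trans (le_of_eq ?_)
    rw [Real.sqrt_eq_rpow ((d : ℝ) ^ _), Real.sqrt_mul hM0.le, Real.sqrt_eq_rpow (d : ℝ),
      ← Real.rpow_mul hd0.le, mul_left_comm, ← Real.rpow_add hd0]
    norm_num
  have hbig : ∀ r : ℝ, r ≤ 5 / 8 → (d : ℝ) ^ r ≤ (d : ℝ) ^ (5 / 8 : ℝ) := fun r hr =>
    Real.rpow_le_rpow_of_exponent_le hd hr
  have hfin : (1 + 2 * √M + 3 * C) * (d : ℝ) ^ (5 / 8 : ℝ) ≤ (d : ℝ) ^ (2 / 3 : ℝ) := by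
    calc _ ≤ (d : ℝ) ^ (1 / 24 : ℝ) * (d : ℝ) ^ (5 / 8 : ℝ) := by gcongr
      _ = _ := by rw [← Real.rpow_add hd0]; norm_num
  have h5 : 0 < (d : ℝ) ^ (5 / 8 : ℝ) := by positivity
  refine ⟨t₁ + t₂, add_nonneg ht₁.1 ht₂.1, ?_, hacc, fun τ hτ => ?_⟩
  · have h1 := hslack ε hε0 hε1
    rw [show 2 * (a / (a - 1)) = 2 * a / (a - 1) by ring] at h1
    have h2 : 0 < ε ^ (-(2 * a / (a - 1))) := by positivity
    have h3 : 0 ≤ K₁ * (ε ^ (-(2 * a / (a - 1))) * Real.log (1 / ε)) := by positivity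
    linarith [ht₁.2, ht₂.2]
  · rcases le_total τ t₁ with hle | hle
    · have h1 := hgrow τ ⟨hτ.1, hle⟩
      have h2 := hoverlap τ ⟨hτ.1, hle⟩
      have h3 := hbig (1 / 4) (by norm_num)
      have h4 : 0 < C * (d : ℝ) ^ (5 / 8 : ℝ) := by positivity
      linarith
    · have hτ' : τ - t₁ ∈ Icc 0 t₂ := ⟨by linarith, by linarith [hτ.2]⟩
      obtain ⟨h1, h2⟩ := hbd _ hτ'
      simp only [add_sub_cancel, add_zero] at h1 h2
      have h3 := hoverlap t₁ ⟨ht₁.1, le_rfl⟩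
      have h4 : C * (d : ℝ) ^ (1 / 2 : ℝ) ≤ C * (d : ℝ) ^ (5 / 8 : ℝ) :=
        mul_le_mul_of_nonneg_left (hbig _ (by norm_num)) hC.le
      linarith

/-! ### Gaussian moments and the population loss -/

lemma integrable_pow_gaussianReal (v : NNReal) (n : ℕ) :
    Integrable (fun x : ℝ => x ^ n) (gaussianReal 0 v) := by
  rcases eq_or_ne n 0 with rfl | hn
  · simp
  have h := (memLp_id_gaussianReal (μ := 0) (v := v) n).integrable_norm_pow (by exact_mod_cast hn)
  refine (integrable_norm_iff (by fun_prop)).1 ?_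
  simpa [norm_pow] using h

lemma integral_sq_gaussianReal (v : NNReal) : ∫ x, x ^ 2 ∂(gaussianReal 0 v) = v := by
  have h := variance_fun_id_gaussianReal (μ := 0) (v := v)
  rw [variance_of_integral_eq_zero (by fun_prop) (by simp)] at h
  exact h

lemma integral_pow_four_gaussianReal (v : NNReal) :
    ∫ x, x ^ 4 ∂(gaussianReal 0 v) = 3 * (v : ℝ) ^ 2 := by
  have h := iteratedDeriv_mgf_zero (X := id) (μ := gaussianReal 0 v)
    (by rw [integrableExpSet_id_gaussianReal]; simp) 4
  have hX : (gaussianReal 0 v)[id ^ 4] = ∫ x, x ^ 4 ∂(gaussianReal 0 v) := rfl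
  rw [hX] at h
  rw [← h, mgf_id_gaussianReal]
  have e : ∀ t : ℝ, HasDerivAt (fun t : ℝ => Real.exp (0 * t + v * t ^ 2 / 2))
      (v * t * Real.exp (0 * t + v * t ^ 2 / 2)) t := fun t => by
    have := ((((hasDerivAt_id t).const_mul 0).add
      ((((hasDerivAt_id t).pow 2).const_mul (v : ℝ)).div_const 2))).exp
    refine this.congr_deriv ?_
    simp; ring
  have e1 : deriv (fun t : ℝ => Real.exp (0 * t + v * t ^ 2 / 2)) =
      fun t => v * t * Real.exp (0 * t + v * t ^ 2 / 2) := funext fun t => (e t).deriv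
  have e2 : deriv (fun t : ℝ => v * t * Real.exp (0 * t + v * t ^ 2 / 2)) =
      fun t => (v + v ^ 2 * t ^ 2) * Real.exp (0 * t + v * t ^ 2 / 2) := funext fun t => by
    refine ((((hasDerivAt_id t).const_mul (v : ℝ)).mul (e t)).congr_deriv ?_).deriv
    simp; ring
  have e3 : deriv (fun t : ℝ => (v + v ^ 2 * t ^ 2) * Real.exp (0 * t + v * t ^ 2 / 2)) =
      fun t => (3 * v ^ 2 * t + v ^ 3 * t ^ 3) * Real.exp (0 * t + v * t ^ 2 / 2) :=
    funext fun t => by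
      refine ((((((hasDerivAt_id t).pow 2).const_mul ((v : ℝ) ^ 2)).const_add (v : ℝ)).mul
        (e t)).congr_deriv ?_).deriv
      simp; ring
  have e4 : deriv (fun t : ℝ => (3 * v ^ 2 * t + v ^ 3 * t ^ 3) *
      Real.exp (0 * t + v * t ^ 2 / 2)) 0 = 3 * (v : ℝ) ^ 2 := by
    refine (((((hasDerivAt_id (0 : ℝ)).const_mul (3 * (v : ℝ) ^ 2)).add
      (((hasDerivAt_id (0 : ℝ)).pow 3).const_mul ((v : ℝ) ^ 3))).mul
        (e 0)).congr_deriv ?_).deriv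
    simp
  rw [iteratedDeriv_succ', iteratedDeriv_succ', iteratedDeriv_succ', iteratedDeriv_succ',
    iteratedDeriv_zero, e1, e2, e3, e4]

section moments
variable {d : ℕ} {lam : Fin d → ℝ}

lemma map_inner_multivariateGaussian (hlam : ∀ i, 0 ≤ lam i) (y : Vec d) :
    (multivariateGaussian 0 (Matrix.diagonal lam)).map (fun x => inner ℝ x y) =
      gaussianReal 0 (wdot lam y y).toNNReal := by
  have hS : (Matrix.diagonal lam).PosSemidef := Matrix.PosSemidef.diagonal hlam
  have e : (fun x : Vec d => (inner ℝ x y : ℝ)) = innerSL ℝ y := by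
    ext x; rw [real_inner_comm]; rfl
  rw [e, IsGaussian.map_eq_gaussianReal]
  congr 1
  · rw [(innerSL ℝ y).integral_comp_id_comm IsGaussian.integrable_id,
      integral_id_multivariateGaussian, map_zero]
  · have h := covarianceBilin_multivariateGaussian (μ := 0) hS y y
    rw [covarianceBilin_self IsGaussian.memLp_two_id] at h
    congr 1
    refine Eq.trans ?_ (h.trans ?_)
    · rfl
    · simp [Matrix.mulVec_diagonal, dotProduct, wdot]
      exact Finset.sum_congr rfl fun _ _ => by ring

lemma integrable_inner_pow (hlam : ∀ i, 0 ≤ lam i) (y : Vec d) (n : ℕ) :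
    Integrable (fun x : Vec d => (inner ℝ x y : ℝ) ^ n)
      (multivariateGaussian 0 (Matrix.diagonal lam)) := by
  have h := integrable_pow_gaussianReal (wdot lam y y).toNNReal n
  rw [← map_inner_multivariateGaussian hlam] at h
  exact h.comp_measurable (by fun_prop)

lemma integral_inner_sq (hlam : ∀ i, 0 ≤ lam i) (y : Vec d) :
    ∫ x : Vec d, (inner ℝ x y : ℝ) ^ 2 ∂(multivariateGaussian 0 (Matrix.diagonal lam)) =
      wdot lam y y := by
  have h := integral_sq_gaussianReal (wdot lam y y).toNNReal
  rwa [← map_inner_multivariateGaussian hlam, integral_map (by fun_prop) (by fun_prop),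
    Real.coe_toNNReal _ (wdot_self_nonneg hlam _)] at h

lemma integral_inner_pow_four (hlam : ∀ i, 0 ≤ lam i) (y : Vec d) :
    ∫ x : Vec d, (inner ℝ x y : ℝ) ^ 4 ∂(multivariateGaussian 0 (Matrix.diagonal lam)) =
      3 * wdot lam y y ^ 2 := by
  have h := integral_pow_four_gaussianReal (wdot lam y y).toNNReal
  rwa [← map_inner_multivariateGaussian hlam, integral_map (by fun_prop) (by fun_prop),
    Real.coe_toNNReal _ (wdot_self_nonneg hlam _)] at h

lemma inner_sq_mul_sq (x y z : Vec d) : (inner ℝ x y : ℝ) ^ 2 * (inner ℝ x z : ℝ) ^ 2 =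
    ((inner ℝ x (y + z) : ℝ) ^ 4 + (inner ℝ x (y - z) : ℝ) ^ 4 - 2 * (inner ℝ x y : ℝ) ^ 4
      - 2 * (inner ℝ x z : ℝ) ^ 4) / 12 := by
  rw [inner_add_right, inner_sub_right]; ring

lemma integrable_inner_sq_mul_sq (hlam : ∀ i, 0 ≤ lam i) (y z : Vec d) :
    Integrable (fun x : Vec d => (inner ℝ x y : ℝ) ^ 2 * (inner ℝ x z : ℝ) ^ 2)
      (multivariateGaussian 0 (Matrix.diagonal lam)) := by
  simp only [inner_sq_mul_sq]
  exact ((((integrable_inner_pow hlam _ 4).add (integrable_inner_pow hlam _ 4)).sub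
    ((integrable_inner_pow hlam _ 4).const_mul 2)).sub
    ((integrable_inner_pow hlam _ 4).const_mul 2)).div_const 12

/-- Mixed fourth moments of a Gaussian vector, by polarisation. -/
lemma integral_inner_sq_mul_sq (hlam : ∀ i, 0 ≤ lam i) (y z : Vec d) :
    ∫ x : Vec d, (inner ℝ x y : ℝ) ^ 2 * (inner ℝ x z : ℝ) ^ 2
      ∂(multivariateGaussian 0 (Matrix.diagonal lam)) =
      wdot lam y y * wdot lam z z + 2 * wdot lam y z ^ 2 := by
  simp only [inner_sq_mul_sq]
  have i1 := integrable_inner_pow hlam (y + z) 4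
  have i2 := integrable_inner_pow hlam (y - z) 4
  have i3 := (integrable_inner_pow hlam y 4).const_mul 2
  have i4 := (integrable_inner_pow hlam z 4).const_mul 2
  have i12 : Integrable (fun x : Vec d => (inner ℝ x (y + z) : ℝ) ^ 4
      + (inner ℝ x (y - z) : ℝ) ^ 4) (multivariateGaussian 0 (Matrix.diagonal lam)) := i1.add i2
  have i123 : Integrable (fun x : Vec d => (inner ℝ x (y + z) : ℝ) ^ 4
      + (inner ℝ x (y - z) : ℝ) ^ 4 - 2 * (inner ℝ x y : ℝ) ^ 4)
      (multivariateGaussian 0 (Matrix.diagonal lam)) := i12.sub i3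
  rw [integral_div, integral_sub i123 i4, integral_sub i12 i3,
    integral_add i1 i2, integral_const_mul, integral_const_mul]
  simp only [integral_inner_pow_four hlam]
  rw [WithLp.ofLp_add, WithLp.ofLp_sub]
  simp only [wdot_add_left, wdot_sub_left, wdot_add_right, wdot_sub_right, wdot_comm lam z y]
  ring

end moments

lemma sum_rpow_pos {a : ℝ} {d : ℕ} (i : Fin d) :
    0 < ∑ j : Fin d, (((j : ℕ) : ℝ) + 1) ^ (-a) :=
  Finset.sum_pos (fun _ _ => by positivity) ⟨i, Finset.mem_univ i⟩

lemma eig_pos {a : ℝ} {d : ℕ} (i : Fin d) : 0 < eig a i :=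
  div_pos (by positivity) (sum_rpow_pos i)

lemma populationLoss_eq (a : ℝ) {d : ℕ} (v w : Vec d) : populationLoss a v w =
    3 * wdot (eig a) w w ^ 2 - 2 * (wdot (eig a) w w * wdot (eig a) v v +
      2 * wdot (eig a) w v ^ 2) + 3 * wdot (eig a) v v ^ 2 := by
  have hlam : ∀ i : Fin d, 0 ≤ eig a i := fun i => (eig_pos i).le
  have e : ∀ x : Vec d, ((inner ℝ x w : ℝ) ^ 2 - (inner ℝ x v : ℝ) ^ 2) ^ 2 =
      (inner ℝ x w : ℝ) ^ 4 - 2 * ((inner ℝ x w : ℝ) ^ 2 * (inner ℝ x v : ℝ) ^ 2)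
        + (inner ℝ x v : ℝ) ^ 4 := fun x => by ring
  rw [populationLoss, inputLaw]
  simp only [e]
  have i1 := integrable_inner_pow hlam w 4
  have i2 := (integrable_inner_sq_mul_sq hlam w v).const_mul 2
  have i12 : Integrable (fun x : Vec d => (inner ℝ x w : ℝ) ^ 4
      - 2 * ((inner ℝ x w : ℝ) ^ 2 * (inner ℝ x v : ℝ) ^ 2))
      (multivariateGaussian 0 (Matrix.diagonal (eig a))) := i1.sub i2
  rw [integral_add i12 (integrable_inner_pow hlam v 4), integral_sub i1 i2,
    integral_const_mul, integral_inner_pow_four hlam, integral_inner_pow_four hlam,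
    integral_inner_sq_mul_sq hlam]

lemma hasGradientAt_populationLoss (a : ℝ) {d : ℕ} (v w : Vec d) :
    HasGradientAt (populationLoss a v) (WithLp.toLp 2 fun i => eig a i *
      ((12 * wdot (eig a) w w - 4 * wdot (eig a) v v) * w i - 8 * wdot (eig a) w v * v i)) w := by
  have hcoord : ∀ i : Fin d, HasFDerivAt (fun x : Vec d => x i)
      (EuclideanSpace.proj i : Vec d →L[ℝ] ℝ) w := fun i =>
    (EuclideanSpace.proj i : Vec d →L[ℝ] ℝ).hasFDerivAt
  have hs : HasFDerivAt (fun x : Vec d => wdot (eig a) x x)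
      (∑ i, ((eig a i * w i) • (EuclideanSpace.proj i : Vec d →L[ℝ] ℝ)
        + w i • (eig a i • (EuclideanSpace.proj i : Vec d →L[ℝ] ℝ)))) w :=
    HasFDerivAt.fun_sum fun i _ => ((hcoord i).const_mul (eig a i)).mul (hcoord i)
  have hu : HasFDerivAt (fun x : Vec d => wdot (eig a) x v)
      (∑ i, v i • (eig a i • (EuclideanSpace.proj i : Vec d →L[ℝ] ℝ))) w :=
    HasFDerivAt.fun_sum fun i _ => ((hcoord i).const_mul (eig a i)).mul_const (v i)
  have h := ((((hs.pow 2).const_mul 3).sub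
    (((hs.mul_const (wdot (eig a) v v)).add ((hu.pow 2).const_mul 2)).const_mul 2))).add_const
      (3 * wdot (eig a) v v ^ 2)
  rw [hasGradientAt_iff_hasFDerivAt]
  have e : populationLoss a v = fun x : Vec d => 3 * wdot (eig a) x x ^ 2 -
      2 * (wdot (eig a) x x * wdot (eig a) v v + 2 * wdot (eig a) x v ^ 2)
        + 3 * wdot (eig a) v v ^ 2 := funext fun x => populationLoss_eq a v x
  rw [e]
  refine h.congr_fderiv ?_
  ext y
  simp only [InnerProductSpace.toDual_apply_apply, PiLp.inner_apply]
  generalize wdot (eig a) w w = s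
  generalize wdot (eig a) v v = s'
  generalize wdot (eig a) w v = u
  simp [Finset.mul_sum, Finset.sum_add_distrib]
  simp only [← Finset.sum_add_distrib, ← Finset.sum_sub_distrib]
  exact Finset.sum_congr rfl fun _ _ => by ring

/-- In coordinates, the gradient flow of the population loss is the flow studied above. Before the
initial time the trajectory is extended by its initial value. -/
lemma IsGradientFlow.isFlow {a : ℝ} {d : ℕ} {v w₀ : Vec d} {w : ℝ → Vec d}
    (h : IsGradientFlow a v w₀ w) (hv : wdot (eig a) v v = 1) :
    IsFlow (eig a) v (fun t => (w (max t 0)).ofLp) := by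
  have hcont : Continuous fun t => w (max t 0) := by
    have h1 : ContinuousOn w (Ici 0) := fun t ht => (h.2 t ht).continuousWithinAt
    exact h1.comp_continuous (by fun_prop) fun t => le_max_right t 0
  refine ⟨(PiLp.continuous_ofLp 2 _).comp hcont, fun t ht i => ?_⟩
  have h1 := (h.2 t ht.le).hasDerivAt (Ici_mem_nhds ht)
  rw [(hasGradientAt_populationLoss a v (w t)).gradient] at h1
  have key : ∀ G : Vec d, HasDerivAt w G t → HasDerivAt (fun t => w t i) (G i) t := fun G hG =>
    (EuclideanSpace.proj i : Vec d →L[ℝ] ℝ).hasFDerivAt.comp_hasDerivAt t hG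
  have h2 := key _ h1
  have h3 : (fun t => (w (max t 0)).ofLp i) =ᶠ[𝓝 t] fun t => w t i := by
    filter_upwards [Ioi_mem_nhds ht] with τ hτ
    rw [max_eq_left (le_of_lt hτ)]
  refine (h2.congr_of_eventuallyEq h3).congr_deriv ?_
  simp only [max_eq_left ht.le, hv, qnorm, corr]
  generalize wdot (eig a) (w t) (w t) = s
  generalize wdot (eig a) (w t) v = u
  simp
  ring

lemma laplace_sum_exp {d : ℕ} (b lam : Fin d → ℝ) {p : ℝ} (hp : ∀ i, 4 * lam i < p) :
    laplace (fun t => ∑ i, b i * Real.exp (4 * lam i * t)) p = ∑ i, b i / (p - 4 * lam i) := by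
  have e : ∀ t i, Real.exp (-p * t) * (b i * Real.exp (4 * lam i * t)) =
      b i * Real.exp ((4 * lam i - p) * t) := fun t i => by
    rw [mul_left_comm, ← Real.exp_add]; ring_nf
  simp only [laplace, Finset.mul_sum, e]
  rw [integral_finsetSum _ fun i _ =>
    (integrableOn_exp_mul_Ioi (by linarith [hp i]) 0).const_mul (b i)]
  refine Finset.sum_congr rfl fun i _ => ?_
  rw [integral_const_mul, integral_exp_mul_Ioi (by linarith [hp i])]
  rw [mul_zero, Real.exp_zero, ← neg_sub p, neg_div_neg_eq, mul_one_div]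

lemma IsGrowthRate.isMode {a : ℝ} {d : ℕ} {v : Vec d} {ρ : ℝ} (h : IsGrowthRate a v ρ)
    {i₀ : Fin d} (htop : ∀ i : Fin d, eig a i ≤ eig a i₀) : IsMode (eig a) v i₀ ρ := by
  refine ⟨htop, h.1 i₀, ?_⟩
  have h1 : laplace (kernel a v) ρ = wdot (modeW ρ (eig a) * eig a) v v := by
    unfold kernel
    rw [laplace_sum_exp _ _ h.1, wdot]
    refine Finset.sum_congr rfl fun i _ => ?_
    simp only [modeW, Pi.mul_apply]; ring
  rw [← h1]; linarith [h.2]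

lemma IsGrowthRate.laplace_source {a : ℝ} {d : ℕ} {v : Vec d} {ρ : ℝ} (h : IsGrowthRate a v ρ)
    (w₀ : Vec d) : laplace (source a v w₀) ρ = modeCoord ρ (eig a) v w₀ := by
  unfold source
  rw [laplace_sum_exp _ _ h.1, modeCoord, wdot]
  refine Finset.sum_congr rfl fun i _ => ?_
  simp only [modeW]; ring

/-! ### The power-law spectrum -/

/-- The infinite sum which normalises the spectrum in the limit of large dimension. -/
noncomputable def zetaSum (a : ℝ) : ℝ := ∑' n : ℕ, ((n : ℝ) + 1) ^ (-a)

lemma summable_rpow {a : ℝ} (ha : 1 < a) : Summable fun n : ℕ => ((n : ℝ) + 1) ^ (-a) := by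
  have := (summable_nat_add_iff 1).2 (Real.summable_nat_rpow.2 (by linarith : -a < -1))
  simpa using this

lemma sum_fin_le_zetaSum {a : ℝ} (ha : 1 < a) (d : ℕ) :
    ∑ j : Fin d, (((j : ℕ) : ℝ) + 1) ^ (-a) ≤ zetaSum a := by
  rw [Fin.sum_univ_eq_sum_range fun n : ℕ => ((n : ℝ) + 1) ^ (-a)]
  exact (summable_rpow ha).sum_le_tsum _ fun n _ => by positivity

lemma zetaSum_pos {a : ℝ} (ha : 1 < a) : 0 < zetaSum a :=
  lt_of_lt_of_le (sum_rpow_pos (a := a) (0 : Fin 1)) (sum_fin_le_zetaSum ha 1)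

lemma eig_le {a : ℝ} {d : ℕ} (i : Fin d) : eig a i ≤ (((i : ℕ) : ℝ) + 1) ^ (-a) := by
  refine div_le_self (by positivity) ?_
  have h0 : 0 < d := Fin.pos i
  have := Finset.single_le_sum (f := fun j : Fin d => (((j : ℕ) : ℝ) + 1) ^ (-a))
    (fun j _ => by positivity) (Finset.mem_univ ⟨0, h0⟩)
  simpa using this

lemma le_eig {a : ℝ} (ha : 1 < a) {d : ℕ} (i : Fin d) :
    (zetaSum a)⁻¹ * (((i : ℕ) : ℝ) + 1) ^ (-a) ≤ eig a i := by
  rw [inv_mul_eq_div, eig]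
  exact div_le_div_of_nonneg_left (by positivity) (sum_rpow_pos i) (sum_fin_le_zetaSum ha d)

lemma eig_le_one {a : ℝ} (ha : 1 < a) {d : ℕ} (i : Fin d) : eig a i ≤ 1 := by
  refine (eig_le i).trans (Real.rpow_le_one_of_one_le_of_nonpos ?_ (by linarith))
  have : (0 : ℝ) ≤ ((i : ℕ) : ℝ) := by positivity
  linarith

lemma eig_le_eig_zero {a : ℝ} (ha : 1 < a) {d : ℕ} {i₀ : Fin d} (h0 : (i₀ : ℕ) = 0) (i : Fin d) :
    eig a i ≤ eig a i₀ := by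
  refine div_le_div_of_nonneg_right ?_ (sum_rpow_pos i).le
  rw [h0, Nat.cast_zero, zero_add, Real.one_rpow]
  refine Real.rpow_le_one_of_one_le_of_nonpos ?_ (by linarith)
  have : (0 : ℝ) ≤ ((i : ℕ) : ℝ) := by positivity
  linarith

lemma sum_eig {a : ℝ} {d : ℕ} (i : Fin d) : ∑ i : Fin d, eig a i = 1 := by
  simp only [eig, ← Finset.sum_div]
  exact div_self (sum_rpow_pos i).ne'

/-! ### Regular teachers -/

lemma wdot_headW_mono {d : ℕ} {n k : ℕ} (h : n ≤ k) (g : Fin d → ℝ) :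
    wdot (headW n) g g ≤ wdot (headW k) g g := by
  refine wdot_self_mono (fun i => ?_) g
  unfold headW
  split_ifs <;> first | omega | norm_num

/-- Integral comparison for the tail of a power series, in telescoping form. -/
lemma rpow_neg_le_sub {a : ℝ} (ha : 1 < a) {x : ℝ} (hx : 0 < x) :
    (a - 1) * (x + 1) ^ (-a) ≤ x ^ (1 - a) - (x + 1) ^ (1 - a) := by
  have hx1 : 0 < x + 1 := by linarith
  set r := x / (x + 1) with hr
  have hr0 : 0 < r := by positivity
  have h1 : 1 + (a - 1) / (x + 1) ≤ r ^ (1 - a) := by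
    rw [Real.rpow_def_of_pos hr0]
    have h2 := Real.add_one_le_exp (Real.log r * (1 - a))
    have h3 := Real.log_le_sub_one_of_pos hr0
    have h4 : (a - 1) / (x + 1) = (a - 1) * (1 - r) := by rw [hr]; field_simp; ring
    nlinarith
  have h5 : x ^ (1 - a) = r ^ (1 - a) * (x + 1) ^ (1 - a) := by
    rw [← Real.mul_rpow hr0.le hx1.le, hr, div_mul_cancel₀ _ hx1.ne']
  have h6 : (x + 1) ^ (1 - a) = (x + 1) * (x + 1) ^ (-a) := by
    rw [sub_eq_add_neg, Real.rpow_add hx1, Real.rpow_one]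
  have h7 : 0 < (x + 1) ^ (1 - a) := by positivity
  have h8 := mul_le_mul_of_nonneg_right h1 h7.le
  have h9 : (a - 1) / (x + 1) * (x + 1) ^ (1 - a) = (a - 1) * (x + 1) ^ (-a) := by
    rw [h6]; field_simp
  rw [h5]; linarith

lemma sum_Ico_rpow_le {a : ℝ} (ha : 1 < a) {k : ℕ} (hk : 1 ≤ k) {n : ℕ} (hn : k ≤ n) :
    ∑ i ∈ Finset.Ico k n, ((i : ℝ) + 1) ^ (-a) ≤ (k : ℝ) ^ (1 - a) / (a - 1) := by
  have ha1 : 0 < a - 1 := by linarith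
  have key : (a - 1) * ∑ i ∈ Finset.Ico k n, ((i : ℝ) + 1) ^ (-a) ≤
      (k : ℝ) ^ (1 - a) - (n : ℝ) ^ (1 - a) := by
    induction n, hn using Nat.le_induction with
    | base => simp
    | succ n hn ih =>
      rw [Finset.sum_Ico_succ_top hn, mul_add]
      have := rpow_neg_le_sub ha (x := n) (by exact_mod_cast hk.trans hn)
      push_cast
      linarith
  rw [le_div_iff₀ ha1]
  have : (0 : ℝ) ≤ (n : ℝ) ^ (1 - a) := by positivity
  linarith

/-- Summation by parts against the decreasing weights of the spectrum. -/
lemma sum_Ico_mul_le {b x : ℕ → ℝ} {D : ℝ} {k : ℕ} (hb0 : ∀ n, 0 ≤ b n) (hb : Antitone b)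
    (hx0 : ∀ n, 0 ≤ x n)
    (hx : ∀ n, k ≤ n → ∑ i ∈ Finset.range n, x i ≤ D * n) {n : ℕ} (hn : k ≤ n) :
    ∑ i ∈ Finset.Ico k n, b i * x i ≤ D * k * b k + D * ∑ i ∈ Finset.Ico k n, b i := by
  have key : ∑ i ∈ Finset.Ico k n, b i * x i + b n * (D * n - ∑ i ∈ Finset.range n, x i) ≤
      D * k * b k + D * ∑ i ∈ Finset.Ico k n, b i := by
    induction n, hn using Nat.le_induction with
    | base =>
      have := mul_nonneg (hb0 k) (Finset.sum_nonneg fun i (_ : i ∈ Finset.range k) => hx0 i)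
      simp; linarith
    | succ n hn ih =>
      rw [Finset.sum_Ico_succ_top hn, Finset.sum_Ico_succ_top hn, Finset.sum_range_succ]
      have h1 := hx (n + 1) (by omega)
      rw [Finset.sum_range_succ] at h1
      have h2 := mul_le_mul_of_nonneg_right (hb (Nat.le_succ n)) (sub_nonneg.2 h1)
      push_cast at h2 ⊢
      linarith
  have := mul_nonneg (hb0 n) (sub_nonneg.2 (hx n hn))
  linarith

lemma sum_fin_eq {d : ℕ} (F : ℕ → ℝ) : ∑ i : Fin d, F i = ∑ i ∈ Finset.range d, F i :=
  Fin.sum_univ_eq_sum_range F d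

/-- Linear growth of the partial sums controls the tails in the `Q`-norm. -/
lemma tailMass_le_of_head_le {a : ℝ} (ha : 1 < a) {d : ℕ} {g : Fin d → ℝ} {D : ℝ} (hD : 0 ≤ D)
    (hU : ∀ k : ℕ, 1 ≤ k → wdot (headW k) g g ≤ D * k) {k : ℕ} (hk : 1 ≤ k) :
    tailMass (eig a) g k ≤ D * (1 + 1 / (a - 1)) * (k : ℝ) ^ (1 - a) := by
  have ha1 : 0 < a - 1 := by linarith
  have hk0 : (0 : ℝ) < k := by exact_mod_cast hk
  set x : ℕ → ℝ := fun n => if h : n < d then g ⟨n, h⟩ ^ 2 else 0 with hx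
  have hx0 : ∀ n, 0 ≤ x n := fun n => by simp only [hx]; split_ifs <;> positivity
  have hxi : ∀ i : Fin d, x i = g i ^ 2 := fun i => by simp [hx]
  have hb : Antitone fun n : ℕ => ((n : ℝ) + 1) ^ (-a) := fun m n hmn => by
    have : (m : ℝ) ≤ n := by exact_mod_cast hmn
    exact Real.rpow_le_rpow_of_nonpos (by positivity) (by linarith) (by linarith)
  have hS : ∀ n, k ≤ n → ∑ i ∈ Finset.range n, x i ≤ D * n := by
    intro n hn
    refine le_trans (le_of_eq ?_) (hU n (hk.trans hn))
    have h1 : wdot (headW n) g g = ∑ i : Fin d, if (i : ℕ) < n then x i else 0 :=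
      Finset.sum_congr rfl fun i _ => by rw [hxi, headW]; split_ifs <;> ring
    rw [h1, sum_fin_eq fun i => if i < n then x i else 0, ← Finset.sum_filter]
    symm
    refine Finset.sum_subset (fun i hi => by simp at hi ⊢; exact hi.2) fun i hi hi' => ?_
    simp only [Finset.mem_filter, Finset.mem_range, not_and'] at hi hi'
    simp [hx, hi' hi]
  have h1 : tailMass (eig a) g k ≤ ∑ i ∈ Finset.Ico k (max k d), ((i : ℝ) + 1) ^ (-a) * x i := by
    have h2 : tailMass (eig a) g k ≤
        ∑ i : Fin d, if (i : ℕ) < k then 0 else (((i : ℕ) : ℝ) + 1) ^ (-a) * x i := by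
      rw [tailMass, wdot]
      refine Finset.sum_le_sum fun i _ => ?_
      rw [hxi, Pi.mul_apply, tailW]
      split_ifs
      · simp
      · have := mul_le_mul_of_nonneg_right (eig_le (a := a) i) (sq_nonneg (g i))
        linarith
    refine h2.trans ?_
    rw [sum_fin_eq fun i => if i < k then 0 else ((i : ℝ) + 1) ^ (-a) * x i]
    have h3 : ∀ i ∈ Finset.range d, (if i < k then 0 else ((i : ℝ) + 1) ^ (-a) * x i) =
        if i ∈ Finset.Ico k (max k d) then ((i : ℝ) + 1) ^ (-a) * x i else 0 := by
      intro i hi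
      simp only [Finset.mem_range] at hi
      simp only [Finset.mem_Ico, lt_max_iff, hi, or_true, and_true]
      split_ifs <;> first | rfl | omega
    rw [Finset.sum_congr rfl h3, ← Finset.sum_filter]
    refine Finset.sum_le_sum_of_subset_of_nonneg (fun i hi => (Finset.mem_filter.1 hi).2)
      fun i _ _ => ?_
    exact mul_nonneg (by positivity) (hx0 i)
  refine h1.trans ((sum_Ico_mul_le (fun n => by positivity) hb hx0 hS (le_max_left k d)).trans ?_)
  have h4 := mul_le_mul_of_nonneg_left (sum_Ico_rpow_le ha hk (le_max_left k d)) hD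
  have h5 : (k : ℝ) * ((k : ℝ) + 1) ^ (-a) ≤ (k : ℝ) ^ (1 - a) := by
    have : ((k : ℝ) + 1) ^ (-a) ≤ (k : ℝ) ^ (-a) :=
      Real.rpow_le_rpow_of_nonpos hk0 (by linarith) (by linarith)
    calc _ ≤ (k : ℝ) * (k : ℝ) ^ (-a) := by gcongr
      _ = _ := by rw [sub_eq_add_neg, Real.rpow_add hk0, Real.rpow_one]
  have h6 := mul_le_mul_of_nonneg_left h5 hD
  calc _ ≤ D * (k : ℝ) ^ (1 - a) + D * ((k : ℝ) ^ (1 - a) / (a - 1)) := by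
        refine add_le_add ?_ h4
        rw [mul_assoc]; exact h6
    _ = _ := by ring

lemma wdot_teacher {a : ℝ} {d : ℕ} (ψ : Fin d → ℝ) (g : Vec d) :
    wdot ψ (teacher a g) (teacher a g) = wdot ψ g g / wdot (eig a) g g := by
  have h0 : 0 ≤ wdot (eig a) g g := wdot_self_nonneg (fun i => (eig_pos i).le) _
  have h1 : qInner a g g = wdot (eig a) g g := rfl
  rw [teacher, h1, WithLp.ofLp_smul, wdot_smul_left, wdot_smul_right, ← mul_assoc, ← mul_inv,
    Real.mul_self_sqrt h0, inv_mul_eq_div]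

/-- A Gaussian vector whose partial sums of squares have linear order yields a regular teacher. -/
lemma exists_isRegular_teacher {a : ℝ} (ha : 1 < a) {D : ℝ} (hD : 0 < D) {n₀ : ℕ} (hn₀ : 1 ≤ n₀) :
    ∃ M : ℝ, 1 ≤ M ∧ ∀ (d : ℕ) (g : Vec d), n₀ ≤ d →
      (∀ k : ℕ, 1 ≤ k → wdot (headW k) g g ≤ D * k) →
      (∀ k : ℕ, n₀ ≤ k → k ≤ d → (k : ℝ) / 4 ≤ wdot (headW k) g g) →
        IsRegular a M (zetaSum a)⁻¹ (eig a) (teacher a g) := by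
  have ha1 : 0 < a - 1 := by linarith
  have hz := zetaSum_pos ha
  have hn0 : (0 : ℝ) < n₀ := by exact_mod_cast hn₀
  set Q := D + D * (1 + 1 / (a - 1)) with hQ
  have hQ0 : 0 < Q := by positivity
  set q₀ := (zetaSum a)⁻¹ * (n₀ : ℝ) ^ (-a) * (n₀ / 4) with hq₀
  have hq₀0 : 0 < q₀ := by positivity
  set M := 1 + n₀ + Q / q₀ + 4 * Q with hM
  have hM1 : 1 ≤ M := by
    have : 0 < Q / q₀ := by positivity
    rw [hM]; linarith
  have hMQ : Q / q₀ ≤ M := by rw [hM]; linarith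
  have hMn : (n₀ : ℝ) ≤ M := by
    have : 0 < Q / q₀ := by positivity
    rw [hM]; linarith
  have hM4 : 4 * Q ≤ M := by
    have : 0 < Q / q₀ := by positivity
    rw [hM]; linarith
  have hDQ : D ≤ Q := by
    have : 0 < D * (1 + 1 / (a - 1)) := by positivity
    rw [hQ]; linarith
  refine ⟨M, hM1, fun d g hd hU hL => ?_⟩
  set q := wdot (eig a) g g with hq
  have hqQ : q ≤ Q := by
    have h1 := wdot_head_mul (k := 1) (lam := eig a) (g : Fin d → ℝ) g
    have h2 := tailMass_le_of_head_le ha hD.le hU le_rfl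
    have h3 := hU 1 le_rfl
    have h4 : wdot (headW 1 * eig a) g g ≤ wdot (headW 1) g g :=
      wdot_self_mono (fun i => mul_le_of_le_one_right (headW_nonneg i) (eig_le_one ha i)) _
    rw [tailMass] at h2
    simp only [Nat.cast_one, Real.one_rpow, mul_one] at h2 h3
    rw [hQ]; linarith
  have hqq : q₀ ≤ q := by
    have h1 := hL n₀ le_rfl hd
    have h2 : (zetaSum a)⁻¹ * (n₀ : ℝ) ^ (-a) * wdot (headW n₀) g g ≤ q := by
      rw [hq, wdot, wdot, Finset.mul_sum]
      refine Finset.sum_le_sum fun i _ => ?_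
      unfold headW
      split_ifs with h
      · have h3 : (zetaSum a)⁻¹ * (n₀ : ℝ) ^ (-a) ≤ eig a i := by
          refine le_trans ?_ (le_eig ha i)
          refine mul_le_mul_of_nonneg_left ?_ (by positivity)
          have : ((i : ℕ) : ℝ) + 1 ≤ n₀ := by exact_mod_cast h
          exact Real.rpow_le_rpow_of_nonpos (by positivity) this (by linarith)
        have := mul_le_mul_of_nonneg_right h3 (mul_self_nonneg (g i))
        linarith
      · have := mul_nonneg (eig_pos (a := a) i).le (mul_self_nonneg (g i))
        linarith
    have h3 : q₀ ≤ (zetaSum a)⁻¹ * (n₀ : ℝ) ^ (-a) * wdot (headW n₀) g g :=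
      mul_le_mul_of_nonneg_left h1 (by positivity)
    linarith
  have hq0 : 0 < q := by linarith
  refine {
    pos := eig_pos, le_one := eig_le_one ha, norm := ?_, lam_le := eig_le, le_lam := le_eig ha,
    head_le := fun k hk => ?_, le_head := fun k hk hkd => ?_, tail_le := fun k hk => ?_ }
  · rw [wdot_teacher]; exact div_self hq0.ne'
  · rw [wdot_teacher, div_le_iff₀ hq0]
    have h1 : D ≤ M * q := by
      calc D ≤ Q := hDQ
        _ = Q / q₀ * q₀ := by field_simp
        _ ≤ M * q := by gcongr
    calc _ ≤ D * k := hU k hk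
      _ ≤ M * q * k := by gcongr
      _ = _ := by ring
  · rw [wdot_teacher, div_le_div_iff₀ (by linarith) hq0]
    have h1 := hL k (by exact_mod_cast hMn.trans hk) hkd
    have hk0 : (0 : ℝ) ≤ k := by positivity
    calc (k : ℝ) * q ≤ k * Q := by gcongr
      _ = k / 4 * (4 * Q) := by ring
      _ ≤ _ := mul_le_mul h1 hM4 (by positivity) (wdot_self_nonneg headW_nonneg _)
  · have h2 := tailMass_le_of_head_le ha hD.le hU hk
    have h3 : tailMass (eig a) (teacher a g) k = tailMass (eig a) g k / q := wdot_teacher _ g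
    rw [h3, div_le_iff₀ hq0]
    have h1 : D * (1 + 1 / (a - 1)) ≤ M * q := by
      calc _ ≤ Q := by rw [hQ]; linarith
        _ = Q / q₀ * q₀ := by field_simp
        _ ≤ M * q := by gcongr
    calc _ ≤ D * (1 + 1 / (a - 1)) * (k : ℝ) ^ (1 - a) := h2
      _ ≤ M * q * (k : ℝ) ^ (1 - a) := by gcongr
      _ = _ := by ring

/-! ### Probability of regular data -/

section gaussian
variable {d : ℕ}

lemma stdGaussian_eq : stdGaussian (Vec d) = multivariateGaussian 0 (Matrix.diagonal 1) := by
  rw [← multivariateGaussian_zero_one]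
  congr 1

lemma inner_single (x : Vec d) (i : Fin d) :
    inner ℝ x (EuclideanSpace.single i 1) = x i := by
  simp [EuclideanSpace.inner_single_right]

lemma wdot_one_single (i j : Fin d) : wdot 1 (EuclideanSpace.single i (1 : ℝ) : Vec d)
    (EuclideanSpace.single j (1 : ℝ) : Vec d) = if i = j then 1 else 0 := by
  simp [wdot, eq_comm]

lemma integrable_coord_sq (i : Fin d) :
    Integrable (fun x : Vec d => x i ^ 2) (stdGaussian (Vec d)) := by
  have := integrable_inner_pow (lam := (1 : Fin d → ℝ)) (fun _ => zero_le_one)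
    (EuclideanSpace.single i 1) 2
  rw [← stdGaussian_eq] at this
  simpa only [inner_single] using this

lemma integral_coord_sq (i : Fin d) : ∫ x : Vec d, x i ^ 2 ∂(stdGaussian (Vec d)) = 1 := by
  have := integral_inner_sq (lam := (1 : Fin d → ℝ)) (fun _ => zero_le_one)
    (EuclideanSpace.single i 1)
  rw [← stdGaussian_eq] at this
  simpa only [inner_single, wdot_one_single, if_true] using this

lemma integrable_coord_sq_mul (i j : Fin d) :
    Integrable (fun x : Vec d => x i ^ 2 * x j ^ 2) (stdGaussian (Vec d)) := by
  have := integrable_inner_sq_mul_sq (lam := (1 : Fin d → ℝ)) (fun _ => zero_le_one)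
    (EuclideanSpace.single i 1) (EuclideanSpace.single j 1)
  rw [← stdGaussian_eq] at this
  simpa only [inner_single] using this

lemma integral_coord_sq_mul (i j : Fin d) :
    ∫ x : Vec d, x i ^ 2 * x j ^ 2 ∂(stdGaussian (Vec d)) = 1 + 2 * if i = j then 1 else 0 := by
  have := integral_inner_sq_mul_sq (lam := (1 : Fin d → ℝ)) (fun _ => zero_le_one)
    (EuclideanSpace.single i 1) (EuclideanSpace.single j 1)
  rw [← stdGaussian_eq] at this
  simp only [inner_single, wdot_one_single, if_true] at this
  rw [this]; split_ifs <;> norm_num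

/-- The squared deviation of a weighted sum of squares of standard Gaussian coordinates. -/
lemma integral_sq_deviation (h : Fin d → ℝ) :
    Integrable (fun x : Vec d => (∑ i, h i * (x i ^ 2 - 1)) ^ 2) (stdGaussian (Vec d)) ∧
      ∫ x : Vec d, (∑ i, h i * (x i ^ 2 - 1)) ^ 2 ∂(stdGaussian (Vec d)) = 2 * ∑ i, h i ^ 2 := by
  have e : ∀ x : Vec d, (∑ i, h i * (x i ^ 2 - 1)) ^ 2 =
      ∑ i, ∑ j, h i * h j * (x i ^ 2 * x j ^ 2 - x i ^ 2 - x j ^ 2 + 1) := fun x => by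
    rw [sq, Finset.sum_mul_sum]
    exact Finset.sum_congr rfl fun i _ => Finset.sum_congr rfl fun j _ => by ring
  have hI : ∀ i j, Integrable (fun x : Vec d => x i ^ 2 * x j ^ 2 - x i ^ 2 - x j ^ 2 + 1)
      (stdGaussian (Vec d)) := fun i j =>
    (((integrable_coord_sq_mul i j).sub (integrable_coord_sq i)).sub
      (integrable_coord_sq j)).add (integrable_const 1)
  have hv : ∀ i j, ∫ x : Vec d, (x i ^ 2 * x j ^ 2 - x i ^ 2 - x j ^ 2 + 1)
      ∂(stdGaussian (Vec d)) = 2 * if i = j then 1 else 0 := fun i j => by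
    have i1 : Integrable (fun x : Vec d => x i ^ 2 * x j ^ 2 - x i ^ 2) (stdGaussian (Vec d)) :=
      (integrable_coord_sq_mul i j).sub (integrable_coord_sq i)
    have i2 : Integrable (fun x : Vec d => x i ^ 2 * x j ^ 2 - x i ^ 2 - x j ^ 2)
      (stdGaussian (Vec d)) := i1.sub (integrable_coord_sq j)
    rw [integral_add i2 (integrable_const 1), integral_sub i1 (integrable_coord_sq j),
      integral_sub (integrable_coord_sq_mul i j) (integrable_coord_sq i), integral_coord_sq_mul,
      integral_coord_sq, integral_coord_sq]
    simp
  simp only [e]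
  refine ⟨integrable_finsetSum _ fun i _ => integrable_finsetSum _ fun j _ =>
    (hI i j).const_mul _, ?_⟩
  rw [integral_finsetSum _ fun i _ => integrable_finsetSum _ fun j _ => (hI i j).const_mul _]
  simp_rw [integral_finsetSum _ fun j _ => (hI _ j).const_mul _, integral_const_mul, hv]
  simp [Finset.mul_sum]
  exact Finset.sum_congr rfl fun i _ => by ring

lemma sum_headW_le (n : ℕ) : ∑ i : Fin d, headW n i ≤ (n : ℝ) := by
  unfold headW
  rw [sum_fin_eq fun i => if i < n then (1 : ℝ) else 0, Finset.sum_boole]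
  have : (Finset.range d).filter (· < n) ⊆ Finset.range n := fun i hi => by
    simp at hi ⊢; exact hi.2
  exact_mod_cast (Finset.card_le_card this).trans (by simp)

lemma sum_headW_eq {n : ℕ} (hn : n ≤ d) : ∑ i : Fin d, headW n i = (n : ℝ) := by
  unfold headW
  rw [sum_fin_eq fun i => if i < n then (1 : ℝ) else 0, Finset.sum_boole]
  have : (Finset.range d).filter (· < n) = Finset.range n := by
    ext i; simp; omega
  rw [this]; simp

/-- Chebyshev's inequality for the sum of the first `n` squared coordinates. -/
lemma measure_head_deviation_le {n : ℕ} {t : ℝ} (ht : 0 < t) :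
    stdGaussian (Vec d) {x | t ≤ |wdot (headW n) x x - ∑ i : Fin d, headW n i|} ≤
      ENNReal.ofReal (2 * n / t ^ 2) := by
  obtain ⟨h1, h2⟩ := integral_sq_deviation (d := d) (headW n)
  have h3 := mul_meas_ge_le_integral_of_nonneg (ae_of_all _ fun x => sq_nonneg _) h1 (t ^ 2)
  have h4 : ∑ i : Fin d, headW n i ^ 2 ≤ (n : ℝ) := by
    refine le_trans (le_of_eq (Finset.sum_congr rfl fun i _ => ?_)) (sum_headW_le (d := d) n)
    unfold headW; split_ifs <;> norm_num
  have e : {x : Vec d | t ≤ |wdot (headW n) x x - ∑ i : Fin d, headW n i|} =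
      {x : Vec d | t ^ 2 ≤ (∑ i, headW n i * (x i ^ 2 - 1)) ^ 2} := by
    ext x
    have e1 : wdot (headW n) x x - ∑ i : Fin d, headW n i =
        ∑ i, headW n i * (x i ^ 2 - 1) := by
      rw [wdot, ← Finset.sum_sub_distrib]
      exact Finset.sum_congr rfl fun i _ => by ring
    simp only [mem_ofPred_eq, e1]
    rw [sq_le_sq, abs_of_pos ht]
  rw [e, ← ofReal_measureReal]
  refine ENNReal.ofReal_le_ofReal ?_
  rw [le_div_iff₀ (by positivity)]
  linarith

lemma tsum_ofReal_geometric {c : ℝ} (hc : 0 ≤ c) :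
    ∑' m : ℕ, ENNReal.ofReal (c * (1 / 2) ^ m) = ENNReal.ofReal (2 * c) := by
  rw [← ENNReal.ofReal_tsum_of_nonneg (fun m => by positivity)
    (summable_geometric_two.mul_left c), tsum_mul_left, tsum_geometric_two]
  ring_nf

/-- With large probability the partial sums of squares of a Gaussian vector have linear order, at
all scales at once. It suffices to look at dyadic scales. -/
lemma measure_not_linear_le {D : ℝ} (hD : 0 < D) (m₀ : ℕ) :
    stdGaussian (Vec d) {g | ¬ ((∀ k : ℕ, 1 ≤ k → wdot (headW k) g g ≤ 2 * (1 + D) * k) ∧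
        ∀ k : ℕ, 2 ^ m₀ ≤ k → k ≤ d → (k : ℝ) / 4 ≤ wdot (headW k) g g)} ≤
      ENNReal.ofReal (4 / D ^ 2) + ENNReal.ofReal (16 * (1 / 2) ^ m₀) := by
  set U : ℕ → Set (Vec d) := fun m =>
    {g | D * 2 ^ m ≤ |wdot (headW (2 ^ m)) g g - ∑ i : Fin d, headW (2 ^ m) i|} with hU
  set L : ℕ → Set (Vec d) := fun m =>
    {g | (2 : ℝ) ^ (m₀ + m) / 2 ≤
      |wdot (headW (2 ^ (m₀ + m))) g g - ∑ i : Fin d, headW (2 ^ (m₀ + m)) i|} with hL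
  have hsub : {g : Vec d | ¬ ((∀ k : ℕ, 1 ≤ k → wdot (headW k) g g ≤ 2 * (1 + D) * k) ∧
        ∀ k : ℕ, 2 ^ m₀ ≤ k → k ≤ d → (k : ℝ) / 4 ≤ wdot (headW k) g g)} ⊆
      (⋃ m, U m) ∪ ⋃ m, L m := by
    intro g hg
    by_contra hcon
    simp only [mem_union, mem_iUnion, not_or, not_exists] at hcon
    refine hg ⟨fun k hk => ?_, fun k hk hkd => ?_⟩
    · have h1 := hcon.1 (Nat.log 2 k + 1)
      simp only [hU, mem_ofPred_eq, not_le] at h1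
      have h2 : k < 2 ^ (Nat.log 2 k + 1) := Nat.lt_pow_succ_log_self (by norm_num) k
      have h3 : 2 ^ Nat.log 2 k ≤ k := Nat.pow_log_le_self 2 (by omega)
      have h4 := wdot_headW_mono h2.le (g : Fin d → ℝ)
      have h5 := (abs_lt.1 h1).2
      have h6 := sum_headW_le (d := d) (2 ^ (Nat.log 2 k + 1))
      have h7 : (2 : ℝ) ^ (Nat.log 2 k + 1) ≤ 2 * k := by
        have : ((2 ^ Nat.log 2 k : ℕ) : ℝ) ≤ k := by exact_mod_cast h3
        push_cast at this
        rw [pow_succ]; linarith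
      push_cast at h6
      nlinarith
    · have hk0 : k ≠ 0 := by have := Nat.one_le_two_pow (n := m₀); omega
      have h0 : m₀ ≤ Nat.log 2 k := (Nat.le_log_iff_pow_le (by norm_num) hk0).2 hk
      have h1 := hcon.2 (Nat.log 2 k - m₀)
      simp only [hL, mem_ofPred_eq, not_le, Nat.add_sub_of_le h0] at h1
      have h2 : k < 2 ^ (Nat.log 2 k + 1) := Nat.lt_pow_succ_log_self (by norm_num) k
      have h3 : 2 ^ Nat.log 2 k ≤ k := Nat.pow_log_le_self 2 hk0
      have h4 := wdot_headW_mono h3 (g : Fin d → ℝ)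
      have h5 := (abs_lt.1 h1).1
      rw [sum_headW_eq (h3.trans hkd)] at h5
      have h7 : (k : ℝ) ≤ 2 * 2 ^ Nat.log 2 k := by
        have : (k : ℝ) ≤ ((2 ^ (Nat.log 2 k + 1) : ℕ) : ℝ) := by exact_mod_cast h2.le
        push_cast at this
        rw [pow_succ] at this; linarith
      push_cast at h5
      linarith
  have hp : ∀ m : ℕ, (2 : ℝ) ^ m * (1 / 2) ^ m = 1 := fun m => by rw [← mul_pow]; norm_num
  refine (measure_mono hsub).trans ((measure_union_le _ _).trans (add_le_add ?_ ?_))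
  · refine (measure_iUnion_le _).trans ?_
    calc ∑' m, stdGaussian (Vec d) (U m) ≤ ∑' m : ℕ, ENNReal.ofReal (2 / D ^ 2 * (1 / 2) ^ m) := by
          refine ENNReal.tsum_le_tsum fun m => (measure_head_deviation_le (by positivity)).trans ?_
          refine ENNReal.ofReal_le_ofReal (le_of_eq ?_)
          push_cast
          rw [div_eq_iff (by positivity)]
          field_simp
          exact (hp m).symm
      _ = ENNReal.ofReal (2 * (2 / D ^ 2)) := tsum_ofReal_geometric (by positivity)
      _ = _ := by ring_nf
  · refine (measure_iUnion_le _).trans ?_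
    calc ∑' m, stdGaussian (Vec d) (L m) ≤
        ∑' m : ℕ, ENNReal.ofReal (8 * (1 / 2) ^ m₀ * (1 / 2) ^ m) := by
          refine ENNReal.tsum_le_tsum fun m => (measure_head_deviation_le (by positivity)).trans ?_
          refine ENNReal.ofReal_le_ofReal (le_of_eq ?_)
          push_cast
          rw [mul_assoc, ← pow_add, div_eq_iff (by positivity)]
          field_simp
          linear_combination (-8) * hp (m₀ + m)
      _ = ENNReal.ofReal (2 * (8 * (1 / 2) ^ m₀)) := tsum_ofReal_geometric (by positivity)
      _ = _ := by ring_nf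

end gaussian

/-! ### The uniform measure on the sphere -/

section sphere
variable {d : ℕ}

lemma uniformSphere_univ (hd : 1 ≤ d) : uniformSphere d univ = 1 := by
  rw [uniformSphere, Measure.smul_apply, smul_eq_mul]
  refine ENNReal.inv_mul_cancel ?_ (measure_ne_top _ _)
  rw [Ne, Measure.measure_univ_eq_zero, Measure.toSphere_eq_zero_iff_finrank,
    finrank_euclideanSpace_fin]
  omega

/-- The action of a linear isometry on the unit sphere. -/
noncomputable def sphereMap (T : Vec d ≃ₗᵢ[ℝ] Vec d) (x : Metric.sphere (0 : Vec d) 1) :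
    Metric.sphere (0 : Vec d) 1 := ⟨T x, by simp⟩

lemma measurable_sphereMap (T : Vec d ≃ₗᵢ[ℝ] Vec d) : Measurable (sphereMap T) :=
  (T.continuous.measurable.comp measurable_subtype_coe).subtype_mk

open scoped Pointwise in
/-- The surface measure is invariant under linear isometries. -/
lemma map_sphereMap (T : Vec d ≃ₗᵢ[ℝ] Vec d) :
    (volume : Measure (Vec d)).toSphere.map (sphereMap T) =
      (volume : Measure (Vec d)).toSphere := by
  ext s hs
  rw [Measure.map_apply (measurable_sphereMap T) hs,
    Measure.toSphere_apply' _ (measurable_sphereMap T hs), Measure.toSphere_apply' _ hs]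
  have hset : Ioo (0 : ℝ) 1 • (Subtype.val '' (sphereMap T ⁻¹' s)) =
      T ⁻¹' (Ioo (0 : ℝ) 1 • (Subtype.val '' s)) := by
    ext x
    simp only [Set.mem_smul, mem_preimage]
    constructor
    · rintro ⟨r, hr, -, ⟨y, hy, rfl⟩, rfl⟩
      exact ⟨r, hr, _, ⟨sphereMap T y, hy, rfl⟩, (T.map_smul r y).symm⟩
    · rintro ⟨r, hr, -, ⟨y, hy, rfl⟩, hx⟩
      have hy' : sphereMap T ⟨T.symm y, by simp⟩ = y := Subtype.ext (T.apply_symm_apply y)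
      refine ⟨r, hr, _, ⟨⟨T.symm y, by simp⟩, ?_, rfl⟩, ?_⟩
      · show sphereMap T _ ∈ s
        rw [hy']
        exact hy
      · apply T.injective
        rw [T.map_smul, ← hx]
        simp
  rw [hset, T.measurePreserving.measure_preimage_emb T.toHomeomorph.measurableEmbedding]

lemma lintegral_coord_sq_eq (i j : Fin d) :
    ∫⁻ x, ENNReal.ofReal ((x : Vec d) i ^ 2) ∂(uniformSphere d) =
      ∫⁻ x, ENNReal.ofReal ((x : Vec d) j ^ 2) ∂(uniformSphere d) := by
  set T : Vec d ≃ₗᵢ[ℝ] Vec d := LinearIsometryEquiv.piLpCongrLeft 2 ℝ ℝ (Equiv.swap i j) with hT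
  have hTi : ∀ x : Vec d, T x i = x j := fun x => by
    simp [hT, LinearIsometryEquiv.piLpCongrLeft_apply]
  rw [uniformSphere, lintegral_smul_measure, lintegral_smul_measure]
  congr 1
  conv_lhs => rw [← map_sphereMap T]
  rw [lintegral_map (by fun_prop) (measurable_sphereMap T)]
  simp only [sphereMap, hTi]

lemma lintegral_coord_sq (hd : 1 ≤ d) (i : Fin d) :
    ∫⁻ x, ENNReal.ofReal ((x : Vec d) i ^ 2) ∂(uniformSphere d) = (d : ENNReal)⁻¹ := by
  have h1 : ∑ j : Fin d, ∫⁻ x, ENNReal.ofReal ((x : Vec d) j ^ 2) ∂(uniformSphere d) = 1 := by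
    rw [← lintegral_finsetSum _ fun j _ => by fun_prop]
    have e : ∀ x : Metric.sphere (0 : Vec d) 1,
        ∑ j : Fin d, ENNReal.ofReal ((x : Vec d) j ^ 2) = 1 := fun x => by
      rw [← ENNReal.ofReal_sum_of_nonneg fun j _ => sq_nonneg _,
        ← EuclideanSpace.real_norm_sq_eq, norm_eq_of_mem_sphere]
      simp
    simp only [e, lintegral_one, uniformSphere_univ hd]
  rw [Finset.sum_congr rfl fun j _ => lintegral_coord_sq_eq j i, Finset.sum_const,
    Finset.card_univ, Fintype.card_fin, nsmul_eq_mul] at h1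
  exact ENNReal.eq_inv_of_mul_eq_one_left (by rwa [mul_comm] at h1)

/-- Markov's inequality for the initial squared `Q`-norm, whose mean is `1 / d`. -/
lemma measure_qnorm_gt_le {a : ℝ} (hd : 1 ≤ d) {M : ℝ} (hM : 0 < M) :
    uniformSphere d {x | ¬ qnorm (eig a) (x : Vec d) ≤ M / d} ≤ ENNReal.ofReal (1 / M) := by
  have hd0 : (0 : ℝ) < d := by exact_mod_cast hd
  have e : ∀ x : Metric.sphere (0 : Vec d) 1, ENNReal.ofReal (qnorm (eig a) (x : Vec d)) =
      ∑ i : Fin d, ENNReal.ofReal (eig a i) * ENNReal.ofReal ((x : Vec d) i ^ 2) := fun x => by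
    rw [qnorm, wdot, ENNReal.ofReal_sum_of_nonneg fun i _ => by
      rw [mul_assoc]; exact mul_nonneg (eig_pos i).le (mul_self_nonneg _)]
    refine Finset.sum_congr rfl fun i _ => ?_
    rw [← ENNReal.ofReal_mul (eig_pos i).le]
    ring_nf
  have h1 : ∫⁻ x, ENNReal.ofReal (qnorm (eig a) (x : Vec d)) ∂(uniformSphere d) =
      (d : ENNReal)⁻¹ := by
    simp only [e]
    rw [lintegral_finsetSum _ fun j _ => by fun_prop]
    simp_rw [lintegral_const_mul' _ _ ENNReal.ofReal_ne_top, lintegral_coord_sq hd]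
    rw [← Finset.sum_mul, ← ENNReal.ofReal_sum_of_nonneg fun i _ => (eig_pos i).le,
      sum_eig ⟨0, hd⟩, ENNReal.ofReal_one, one_mul]
  have hmeas : AEMeasurable (fun x : Metric.sphere (0 : Vec d) 1 =>
      ENNReal.ofReal (qnorm (eig a) (x : Vec d))) (uniformSphere d) := by
    simp only [e]; fun_prop
  have h2 := meas_ge_le_lintegral_div hmeas (ε := ENNReal.ofReal (M / d))
    (by rw [Ne, ENNReal.ofReal_eq_zero, not_le]; positivity) ENNReal.ofReal_ne_top
  rw [h1, ← ENNReal.ofReal_natCast, ← ENNReal.ofReal_inv_of_pos hd0,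
    ← ENNReal.ofReal_div_of_pos (by positivity),
    show (d : ℝ)⁻¹ / (M / d) = 1 / M by field_simp] at h2
  refine (measure_mono fun x hx => ?_).trans h2
  exact ENNReal.ofReal_le_ofReal (not_le.1 hx).le

end sphere

/-! ### The plateau estimate for regular data -/

section sign
variable {d : ℕ} {lam v : Fin d → ℝ}

lemma wdot_neg_neg (ψ v : Fin d → ℝ) : wdot ψ (-v) (-v) = wdot ψ v v := by simp [wdot]

lemma wdot_neg_right (ψ x v : Fin d → ℝ) : wdot ψ x (-v) = -wdot ψ x v := by simp [wdot]

lemma IsRegular.neg {a M l₀ : ℝ} (h : IsRegular a M l₀ lam v) : IsRegular a M l₀ lam (-v) where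
  pos := h.pos
  le_one := h.le_one
  norm := by rw [wdot_neg_neg]; exact h.norm
  lam_le := h.lam_le
  le_lam := h.le_lam
  head_le k hk := by rw [wdot_neg_neg]; exact h.head_le k hk
  le_head k hk hkd := by rw [wdot_neg_neg]; exact h.le_head k hk hkd
  tail_le k hk := by rw [tailMass, wdot_neg_neg]; exact h.tail_le k hk

lemma IsMode.neg {i₀ : Fin d} {ρ : ℝ} (h : IsMode lam v i₀ ρ) : IsMode lam (-v) i₀ ρ :=
  ⟨h.top, h.lt, by rw [wdot_neg_neg]; exact h.eqn⟩

lemma IsFlow.neg {w : ℝ → Fin d → ℝ} (h : IsFlow lam v w) : IsFlow lam (-v) w :=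
  ⟨h.cont, fun t ht i => (h.deriv t ht i).congr_deriv (by
    simp only [corr, wdot_neg_right, Pi.neg_apply]; ring)⟩

end sign

lemma abs_mse_sub_le {d : ℕ} {w v : Vec d} {D : ℝ}
    (h : wdot 1 w w + 2 * |wdot 1 w v| ≤ D) :
    |mse w v - teacherPower v| ≤ 1 / d * D ∧ |mseUpToSign w v - teacherPower v| ≤ 1 / d * D := by
  have hww : 0 ≤ wdot 1 w w := wdot_self_nonneg (fun _ => zero_le_one) _
  have hd : (0 : ℝ) ≤ 1 / d := by positivity
  have h1 : ∑ i, (w i - v i) ^ 2 = wdot 1 w w - 2 * wdot 1 w v + ∑ i, (v i) ^ 2 := by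
    simp only [wdot, Finset.mul_sum, ← Finset.sum_sub_distrib, ← Finset.sum_add_distrib,
      Pi.one_apply]
    exact Finset.sum_congr rfl fun _ _ => by ring
  have h2 : ∑ i, (w i + v i) ^ 2 = wdot 1 w w + 2 * wdot 1 w v + ∑ i, (v i) ^ 2 := by
    simp only [wdot, Finset.mul_sum, ← Finset.sum_add_distrib, Pi.one_apply]
    exact Finset.sum_congr rfl fun _ _ => by ring
  have e1 : mse w v - teacherPower v = 1 / d * (wdot 1 w w - 2 * wdot 1 w v) := by
    rw [mse, teacherPower, h1]; ring
  have e2 : mseUpToSign w v - teacherPower v = 1 / d * (wdot 1 w w - 2 * |wdot 1 w v|) := by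
    have : min (‖w - v‖ ^ 2) (‖w + v‖ ^ 2) =
        wdot 1 w w - 2 * |wdot 1 w v| + ∑ i, (v i) ^ 2 := by
      rw [EuclideanSpace.real_norm_sq_eq, EuclideanSpace.real_norm_sq_eq]
      simp only [PiLp.sub_apply, PiLp.add_apply]
      rw [h1, h2]
      rcases abs_cases (wdot 1 w v) with ⟨e, he⟩ | ⟨e, he⟩ <;> rw [e]
      · rw [min_eq_left (by linarith)]
      · rw [min_eq_right (by linarith)]; ring
    rw [mseUpToSign, this, teacherPower]; ring
  have h3 := neg_abs_le (wdot 1 w v)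
  have h4 := le_abs_self (wdot 1 w v)
  have h5 := abs_nonneg (wdot 1 w v)
  rw [e1, e2, abs_mul, abs_mul, abs_of_nonneg hd]
  refine ⟨mul_le_mul_of_nonneg_left (abs_le.2 ⟨?_, ?_⟩) hd,
    mul_le_mul_of_nonneg_left (abs_le.2 ⟨?_, ?_⟩) hd⟩ <;> linarith

lemma IsRegular.mono {d : ℕ} {lam v : Fin d → ℝ} {a M M' l₀ : ℝ} (h : IsRegular a M l₀ lam v)
    (hM : M ≤ M') (hM0 : 0 < M) : IsRegular a M' l₀ lam v where
  toIsNormalized := h.toIsNormalized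
  lam_le := h.lam_le
  le_lam := h.le_lam
  head_le k hk := (h.head_le k hk).trans (by gcongr)
  le_head k hk hkd := le_trans (by gcongr) (h.le_head k (hM.trans hk) hkd)
  tail_le k hk := (h.tail_le k hk).trans (by gcongr)

/-- The plateau estimate holds for every regular teacher and every good initial point, with a
constant which does not depend on the regularity, once the dimension is large. -/
theorem exists_plateauHolds {a c C c₀ : ℝ} (ha : 1 < a) (hc : 0 < c) (hc₀ : 0 < c₀) :
    ∃ K : ℝ, 0 < K ∧ ∀ M : ℝ, 1 ≤ M → ∀ᶠ d : ℕ in atTop, ∀ v w₀ : Vec d,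
      GoodInit a c C v w₀ → IsRegular a M (zetaSum a)⁻¹ (eig a) v → ‖w₀‖ = 1 →
        qnorm (eig a) w₀ ≤ M / d → PlateauHolds a c₀ K v w₀ := by
  obtain ⟨K, hK, h⟩ := exists_accurate_time ha hc (inv_pos.2 (zetaSum_pos ha)) hc₀
  refine ⟨K + 1, by positivity, fun M hM => ?_⟩
  filter_upwards [h M hM, eventually_le_log 1, eventually_ge_atTop 1] with d hacc hlog hd1
    v w₀ hgood hreg hw₀ hq ε hε hε1 w hw
  have hd0 : (0 : ℝ) < d := by exact_mod_cast hd1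
  have hε0 : 0 < ε := lt_of_lt_of_le (by positivity) hε
  obtain ⟨-, ⟨ρ, hρ, hsrc⟩, hfirst⟩ := hgood
  set i₀ : Fin d := ⟨0, hd1⟩ with hi₀
  have hmode := hρ.isMode (eig_le_eig_zero ha (show (i₀ : ℕ) = 0 from rfl))
  have hflow := hw.isFlow hreg.norm
  set W : ℝ → Fin d → ℝ := fun t => (w (max t 0)).ofLp with hW
  have hW0 : W 0 = w₀ := by simp only [hW, max_self]; rw [hw.1]
  have hWt : ∀ t, 0 ≤ t → W t = w t := fun t ht => by simp only [hW, max_eq_left ht]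
  rw [hρ.laplace_source] at hsrc
  have hnorm : wdot 1 (W 0) (W 0) = 1 := by
    have := EuclideanSpace.real_norm_sq_eq w₀
    rw [hw₀, one_pow] at this
    rw [hW0, this]
    exact Finset.sum_congr rfl fun i _ => by simp; ring
  -- The sign of the teacher is irrelevant for the flow.
  obtain ⟨t, ht0, ht, hu, hs, hbd⟩ : ∃ t : ℝ, 0 ≤ t ∧
      t ≤ K * (Real.log d + ε ^ (-(2 * a / (a - 1))) * Real.log (1 / ε)) ∧
      |corr (eig a) v (W t)| ∈ Icc (1 - ε) 1 ∧ qnorm (eig a) (W t) ∈ Icc (1 - ε) 1 ∧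
      ∀ τ ∈ Icc 0 t, wdot 1 (W τ) (W τ) + 2 * |wdot 1 (W τ) v| ≤ (d : ℝ) ^ (2 / 3 : ℝ) := by
    rcases le_total 0 (modeCoord ρ (eig a) v w₀) with hl | hl
    · obtain ⟨t, ht0, ht, ⟨hu, hs⟩, hbd⟩ := hacc (eig a) v W i₀ ρ { hreg, hmode, hflow with
        index := rfl
        norm_eq := hnorm
        qnorm_le := by rw [hW0]; exact hq
        coord_ge := by rw [hW0, ← abs_of_nonneg hl]; exact hsrc.1
        first_ge := (hfirst i₀ rfl).1 } ε hε hε1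
      exact ⟨t, ht0, ht, by rwa [abs_of_nonneg (by linarith [hu.1])], hs, hbd⟩
    · obtain ⟨t, ht0, ht, ⟨hu, hs⟩, hbd⟩ := hacc (eig a) (-v.ofLp) W i₀ ρ
        { hreg.neg, hmode.neg, hflow.neg with
          index := rfl
          norm_eq := hnorm
          qnorm_le := by rw [hW0]; exact hq
          coord_ge := by
            rw [hW0, modeCoord, wdot_neg_right, ← modeCoord, ← abs_of_nonpos hl]; exact hsrc.1
          first_ge := by rw [Pi.neg_apply, abs_neg]; exact (hfirst i₀ rfl).1 } ε hε hε1
      have e : corr (eig a) (-v.ofLp) (W t) = -corr (eig a) v (W t) := wdot_neg_right _ _ _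
      refine ⟨t, ht0, ht, ?_, hs, fun τ hτ => ?_⟩
      · rw [← abs_neg, ← e, abs_of_nonneg (by linarith [hu.1])]; exact hu
      · have := hbd τ hτ
        rwa [wdot_neg_right, abs_neg] at this
  have hc := hflow.cont
  have hcl : IsClosed {t | |corr (eig a) v (W t)| ∈ Icc (1 - ε) 1 ∧
      qnorm (eig a) (W t) ∈ Icc (1 - ε) 1} :=
    (isClosed_Icc.preimage (by fun_prop : Continuous fun t => |corr (eig a) v (W t)|)).inter
      (isClosed_Icc.preimage (by fun_prop : Continuous fun t => qnorm (eig a) (W t)))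
  have hmem : ∀ τ, τ ∈ accurateTimes a ε v w ↔ 0 ≤ τ ∧ |corr (eig a) v (W τ)| ∈ Icc (1 - ε) 1 ∧
      qnorm (eig a) (W τ) ∈ Icc (1 - ε) 1 := fun τ => by
    refine and_congr_right fun hτ => ?_
    rw [hWt τ hτ]; rfl
  obtain ⟨T, ⟨hT, hTacc⟩, hmin⟩ := (isCompact_Icc.inter_right hcl).exists_isLeast
    ⟨t, ⟨ht0, le_rfl⟩, hu, hs⟩
  have hlogε : 0 < Real.log (1 / ε) := Real.log_pos (by rw [lt_div_iff₀ hε0]; linarith)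
  refine ⟨T, ⟨(hmem T).2 ⟨hT.1, hTacc⟩, fun τ hτ => ?_⟩, ?_, ?_⟩
  · have h1 := (hmem τ).1 hτ
    rcases le_total τ t with hle | hle
    · exact hmin ⟨⟨h1.1, hle⟩, h1.2⟩
    · exact hT.2.trans hle
  · have : 0 < ε ^ (-(2 * a / (a - 1))) * Real.log (1 / ε) := by positivity
    linarith [hT.2]
  · have hb := hbd T hT
    rw [hWt T hT.1] at hb
    have hrate : 1 / (d : ℝ) * (d : ℝ) ^ (2 / 3 : ℝ) ≤ (K + 1) * plateauRate a ε d := by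
      have h1 : 1 / (d : ℝ) * (d : ℝ) ^ (2 / 3 : ℝ) = (1 / (d : ℝ)) ^ (1 / 3 : ℝ) := by
        rw [one_div, Real.inv_rpow hd0.le, ← Real.rpow_neg_one, ← Real.rpow_add hd0,
          ← Real.rpow_neg hd0.le]
        norm_num
      have h2 : (1 / (d : ℝ)) ^ (1 / 3 : ℝ) ≤ (Real.log d / (d : ℝ)) ^ (1 / 3 : ℝ) := by gcongr
      have h3 : 0 ≤ (ε ^ (-a) / (d : ℝ)) ^ (1 / 3 : ℝ) := by positivity
      have h4 : 0 ≤ plateauRate a ε d := by unfold plateauRate; positivity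
      have h5 : (1 / (d : ℝ)) ^ (1 / 3 : ℝ) ≤ plateauRate a ε d := by unfold plateauRate; linarith
      rw [h1]; nlinarith
    obtain ⟨h1, h2⟩ := abs_mse_sub_le hb
    exact ⟨h1.trans hrate, h2.trans hrate⟩

/-- Data are regular, with a large enough constant, up to an arbitrarily small probability. -/
lemma exists_measure_not_regular_le {a : ℝ} (ha : 1 < a) {η : ℝ} (hη : 0 < η) :
    ∃ M : ℝ, 1 ≤ M ∧ ∀ᶠ d : ℕ in atTop,
      setupLaw d {p | ¬ (IsRegular a M (zetaSum a)⁻¹ (eig a) (teacher a p.1) ∧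
        qnorm (eig a) (p.2 : Vec d) ≤ M / d)} ≤ ENNReal.ofReal η := by
  -- Three events of probability at most `η / 3` each.
  obtain ⟨m₀, hm₀⟩ := exists_pow_lt_of_lt_one (show 0 < η / 48 by positivity)
    (show (1 / 2 : ℝ) < 1 by norm_num)
  set D := √(12 / η) with hD
  have hD0 : 0 < D := Real.sqrt_pos.2 (by positivity)
  have hDη : 4 / D ^ 2 = η / 3 := by
    rw [hD, Real.sq_sqrt (by positivity)]; field_simp; norm_num
  obtain ⟨M, hM, hreg⟩ := exists_isRegular_teacher ha (D := 2 * (1 + D)) (by positivity)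
    (Nat.one_le_two_pow (n := m₀))
  have hM0 : 0 < M := by linarith
  set M' := max M (3 / η) with hM'
  have hM'0 : 0 < M' := lt_of_lt_of_le hM0 (le_max_left _ _)
  refine ⟨M', hM.trans (le_max_left _ _), ?_⟩
  filter_upwards [eventually_ge_atTop (2 ^ m₀), eventually_ge_atTop 1] with d hd hd1
  have hprob : IsProbabilityMeasure (uniformSphere d) := ⟨uniformSphere_univ hd1⟩
  set G : Set (Vec d) := {g | ¬ ((∀ k : ℕ, 1 ≤ k → wdot (headW k) g g ≤ 2 * (1 + D) * k) ∧
        ∀ k : ℕ, 2 ^ m₀ ≤ k → k ≤ d → (k : ℝ) / 4 ≤ wdot (headW k) g g)} with hG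
  set S : Set (Metric.sphere (0 : Vec d) 1) := {x | ¬ qnorm (eig a) (x : Vec d) ≤ M' / d} with hS
  have hsub : {p : Vec d × Metric.sphere (0 : Vec d) 1 |
      ¬ (IsRegular a M' (zetaSum a)⁻¹ (eig a) (teacher a p.1) ∧
        qnorm (eig a) (p.2 : Vec d) ≤ M' / d)} ⊆ G ×ˢ univ ∪ univ ×ˢ S := by
    intro p hp
    by_contra hcon
    simp only [mem_union, mem_prod, mem_univ, and_true, true_and, not_or] at hcon
    have h1 := not_not.1 hcon.1
    exact hp ⟨(hreg d p.1 hd h1.1 h1.2).mono (le_max_left _ _) hM0, not_not.1 hcon.2⟩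
  refine (measure_mono hsub).trans ((measure_union_le _ _).trans ?_)
  rw [setupLaw, Measure.prod_prod, Measure.prod_prod, measure_univ, measure_univ, mul_one, one_mul]
  have h1 := measure_not_linear_le (d := d) hD0 m₀
  have h2 := measure_qnorm_gt_le (a := a) hd1 hM'0
  calc _ ≤ ENNReal.ofReal (4 / D ^ 2) + ENNReal.ofReal (16 * (1 / 2) ^ m₀)
        + ENNReal.ofReal (1 / M') := add_le_add h1 h2
    _ = ENNReal.ofReal (4 / D ^ 2 + 16 * (1 / 2) ^ m₀ + 1 / M') := by
        rw [ENNReal.ofReal_add (by positivity) (by positivity),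
          ENNReal.ofReal_add (by positivity) (by positivity)]
    _ ≤ _ := by
        refine ENNReal.ofReal_le_ofReal ?_
        have : 1 / M' ≤ η / 3 := by
          rw [div_le_iff₀ hM'0]
          have h3 : 3 / η ≤ M' := le_max_right _ _
          rw [div_le_iff₀ hη] at h3; linarith
        linarith

end PhaseRetrieval

theorem mainTheorem3 (a c C c₀ : ℝ) (ha : 1 < a) (hc : 0 < c) (hC : 0 < C) (hc₀ : 0 < c₀) :
    ∃ K : ℝ, 0 < K ∧
      Tendsto
        (fun d : ℕ => PhaseRetrieval.setupLaw d
          {p | PhaseRetrieval.GoodInit a c C (PhaseRetrieval.teacher a p.1) (p.2 : PhaseRetrieval.Vec d) ∧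
            ¬ PhaseRetrieval.PlateauHolds a c₀ K
              (PhaseRetrieval.teacher a p.1) (p.2 : PhaseRetrieval.Vec d)})
        atTop (𝓝 0) := by
  -- `K` is chosen before the regularity `M`, which depends on the probability to be reached.
  obtain ⟨K, hK, h⟩ := PhaseRetrieval.exists_plateauHolds (C := C) ha hc hc₀
  refine ⟨K, hK, ENNReal.tendsto_nhds_zero.2 fun η hη => ?_⟩
  obtain ⟨η', hη', hlt⟩ : ∃ η' : ℝ, 0 < η' ∧ ENNReal.ofReal η' ≤ η := by
    obtain ⟨r, hr0, hr⟩ := ENNReal.lt_iff_exists_nnreal_btwn.1 hη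
    exact ⟨r, by exact_mod_cast hr0, by rw [ENNReal.ofReal_coe_nnreal]; exact hr.le⟩
  obtain ⟨M, hM, hprob⟩ := PhaseRetrieval.exists_measure_not_regular_le ha hη'
  filter_upwards [h M hM, hprob] with d hd hp
  refine (measure_mono fun p hp hreg => ?_).trans (hp.trans hlt)
  exact hp.2 (hd _ _ hp.1 hreg.1 (norm_eq_of_mem_sphere p.2) hreg.2)
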